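/- Let $D$ be a compact (Hausdorff) smooth manifold, possibly with boundary, let $M$ be a finite-dimensional (Hausdorff, $\sigma$-compact) smooth manifold without boundary, let $\pi^E\colon E\to M$ be a smooth vector bundle of finite rank, and let $k\ge 2$ be an integer. Write $\mathcal M=\mathcal C^k(D,M)$ and $\mathcal E=\mathcal C^k(D,E)$, with their standard structures of smooth Banach manifolds, and let $\pi^{\mathcal E}\colon\mathcal E\to\mathcal M$ be left-composition with $\pi^E$; its fiber $\mathcal E_f$ over $f\in\mathcal M$ is the space of $\mathcal C^k$ sections of $E$ along $f$. For $p\in D$ let $\mathrm{ev}_p$ denote evaluation at $p$, both $\mathcal E\to E$ and $\mathcal M\to M$. A connection on a (Banach) vector bundle $\pi\colon V\to X$ is a smooth map $P\colon TV\to V$ such that (a) for $x\in X$ and $e\in V_x$, the restriction $P_e$ of $P$ to $T_eV$ is a linear map into $V_x$; (b) for every smooth local trivialization over an open set $U\subset X$, given by linear isomorphisms $s(x)\colon V_0\to V_x$, $x\in U$, with $\tilde s(e)=s(\pi(e))^{-1}e$, there is a smooth map $x\mapsto\Gamma_x$ on $U$, with $\Gamma_x$ a continuous bilinear map $T_xX\times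 V_x\to V_x$, such that $$P(\eta)=s(x)\big(\mathrm d\tilde s_e(\eta)\big)+\Gamma_x\big(\mathrm d\pi_e(\eta),e\big)\qquad\text{for all }x\in U,\ e\in V_x,\ \eta\in T_eV .$$ A smooth vector bundle morphism $T\colon V\to V'$ over a smooth map of the bases, between bundles with connections $P$ and $P'$, is affine if $P'\circ\mathrm dT=T\circ P$. Let $P^E\colon TE\to E$ be a connection on $E$. Then $\pi^{\mathcal E}\colon\mathcal E\to\mathcal M$ is a Banach vector bundle, and $\eta\mapsto\big(p\mapsto \mathrm d(\mathrm{ev}_p)\eta\big)$ is a bijection from $T\mathcal E$ onto $\mathcal C^k(D,TE)$. Under this identification, left-composition with $P^E$, that is $$P^{\mathcal E}\colon T\mathcal E\cong\mathcal C^k(D,TE)\to\mathcal C^k(D,E)=\mathcal E,\qquad P^{\mathcal E}(\eta)=P^E\circ\eta,$$ is a connection on $\pi^{\mathcal E}\colon\mathcal E\to\mathcal M$ (the natural connection). With respect to $P^{\mathcal E}$ and $P^E$, the map $\mathrm{ev}_p\colon\mathcal E\to E$ (over $\mathrm{ev}_p\colon\mathcal M\to M$) is affine for every $p\in D$, and $P^{\mathcal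 E}$ is the only connection on $\pi^{\mathcal E}$ with this property. -/

import Mathlib

open Set Filter Topology Bundle
open scoped Manifold ContDiff

noncomputable section

/-! ### Banach manifolds with varying model spaces

The components of `C^k(D, N)` are modelled on different Banach spaces, so that a notion of Banach
manifold is needed in which each chart has a model space of its own. -/

universe u u' uf w

/-- A chart of the set `X`: a bijection between a subset of `X` and an open subset of a
Banach space `V`. -/
structure BanachChart (X : Type u) where
  V : Type w
  [normed : NormedAddCommGroup V]
  [space : NormedSpace ℝ V]
  [complete : CompleteSpace V]
  toEquiv : PartialEquiv X V
  open_target : IsOpen toEquiv.target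

attribute [instance] BanachChart.normed BanachChart.space BanachChart.complete

/-- A set of pairwise smoothly compatible charts of `X`. -/
structure BanachAtlas (X : Type u) where
  charts : Set (BanachChart.{u, w} X)
  compat : ∀ c ∈ charts, ∀ c' ∈ charts, ∀ x ∈ c.toEquiv.source, x ∈ c'.toEquiv.source →
    (∀ᶠ v in 𝓝 (c.toEquiv x), c.toEquiv.symm v ∈ c'.toEquiv.source) ∧
      ContDiffAt ℝ ∞ (fun v => c'.toEquiv (c.toEquiv.symm v)) (c.toEquiv x)

namespace BanachAtlas

variable {X : Type u} {Y : Type u'} (A : BanachAtlas.{u, w} X) (B : BanachAtlas.{u', w} Y)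

/-- The charts around a point. -/
abbrev ChartAt (x : X) : Type _ := {c : BanachChart.{u, w} X // c ∈ A.charts ∧ x ∈ c.toEquiv.source}

/-- `X` is a (Hausdorff, smooth) Banach manifold with the given atlas: the charts cover `X`, and
distinct points have disjoint neighbourhoods. -/
structure IsBanachManifold : Prop where
  cover : ∀ x, ∃ c ∈ A.charts, x ∈ c.toEquiv.source
  separated : ∀ x y, x ≠ y → ∃ c ∈ A.charts, ∃ c' ∈ A.charts,
    x ∈ c.toEquiv.source ∧ y ∈ c'.toEquiv.source ∧
      ∃ O ∈ 𝓝 (c.toEquiv x), ∃ O' ∈ 𝓝 (c'.toEquiv y),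
        Disjoint (c.toEquiv.symm '' (O ∩ c.toEquiv.target))
          (c'.toEquiv.symm '' (O' ∩ c'.toEquiv.target))

/-- Open sets of the manifold topology. -/
def IsOpenSet (U : Set X) : Prop :=
  ∀ c ∈ A.charts, IsOpen (c.toEquiv.target ∩ c.toEquiv.symm ⁻¹' U)

/-- Smoothness at a point of a map between two Banach manifolds (continuity included). -/
def SmoothAt (f : X → Y) (x : X) : Prop :=
  ∃ c ∈ A.charts, ∃ c' ∈ B.charts, x ∈ c.toEquiv.source ∧ f x ∈ c'.toEquiv.source ∧
    (∀ᶠ v in 𝓝 (c.toEquiv x), f (c.toEquiv.symm v) ∈ c'.toEquiv.source) ∧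
      ContDiffAt ℝ ∞ (fun v => c'.toEquiv (f (c.toEquiv.symm v))) (c.toEquiv x)

/-- The tangent space at `x`: a tangent vector is a family of vectors `v c`, one in the model space
of each chart `c` around `x`, that correspond to each other under the differentials of the
transition maps. -/
def TangentSp (x : X) : Submodule ℝ (∀ c : A.ChartAt x, c.1.V) where
  carrier := {v | ∀ c c' : A.ChartAt x,
    fderiv ℝ (fun z => c'.1.toEquiv (c.1.toEquiv.symm z)) (c.1.toEquiv x) (v c) = v c'}
  add_mem' := by
    intro a b ha hb c c'
    simp only [Pi.add_apply, map_add]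
    rw [ha c c', hb c c']
  zero_mem' := by
    intro c c'
    simp
  smul_mem' := by
    intro r a ha c c'
    simp only [Pi.smul_apply, map_smul]
    rw [ha c c']

/-- The tangent vector at `x` that the chart `c` represents by `v`. -/
def mkTangent {x : X} (c : A.ChartAt x) (v : c.1.V) : A.TangentSp x :=
  ⟨fun c' => fderiv ℝ (fun z => c'.1.toEquiv (c.1.toEquiv.symm z)) (c.1.toEquiv x) v, by
    intro c₁ c₂
    obtain ⟨h1, d1⟩ := A.compat c.1 c.2.1 c₁.1 c₁.2.1 x c.2.2 c₁.2.2
    obtain ⟨_, d2⟩ := A.compat c₁.1 c₁.2.1 c₂.1 c₂.2.1 x c₁.2.2 c₂.2.2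
    have hx : c₁.1.toEquiv (c.1.toEquiv.symm (c.1.toEquiv x)) = c₁.1.toEquiv x := by
      rw [c.1.toEquiv.left_inv c.2.2]
    have hd1 := (d1.differentiableAt (by simp)).hasFDerivAt
    have hd2 := (d2.differentiableAt (by simp)).hasFDerivAt
    have hcomp := HasFDerivAt.comp (f := fun z => c₁.1.toEquiv (c.1.toEquiv.symm z))
      (g := fun z => c₂.1.toEquiv (c₁.1.toEquiv.symm z)) (c.1.toEquiv x) (hx.symm ▸ hd2) hd1
    have heq : (fun z => c₂.1.toEquiv (c.1.toEquiv.symm z)) =ᶠ[𝓝 (c.1.toEquiv x)]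
        ((fun z => c₂.1.toEquiv (c₁.1.toEquiv.symm z)) ∘
          fun z => c₁.1.toEquiv (c.1.toEquiv.symm z)) := by
      filter_upwards [h1] with z hz
      simp only [Function.comp]
      rw [c₁.1.toEquiv.left_inv hz]
    have := (hcomp.congr_of_eventuallyEq heq).fderiv
    rw [hx] at this
    exact (DFunLike.congr_fun this v).symm⟩

theorem mkTangent_apply {x : X} (c c' : A.ChartAt x) (v : c.1.V) :
    (A.mkTangent c v).1 c' =
      fderiv ℝ (fun z => c'.1.toEquiv (c.1.toEquiv.symm z)) (c.1.toEquiv x) v := rfl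

theorem mkTangent_self {x : X} (c : A.ChartAt x) (v : c.1.V) :
    (A.mkTangent c v).1 c = v := by
  rw [mkTangent_apply]
  have heq : (fun z => c.1.toEquiv (c.1.toEquiv.symm z)) =ᶠ[𝓝 (c.1.toEquiv x)] id := by
    filter_upwards [c.1.open_target.mem_nhds (c.1.toEquiv.map_source c.2.2)] with z hz
    exact c.1.toEquiv.right_inv hz
  rw [heq.fderiv_eq, fderiv_id]
  rfl

theorem mkTangent_coord {x : X} (c : A.ChartAt x) (η : A.TangentSp x) :
    A.mkTangent c (η.1 c) = η := by
  apply Subtype.ext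
  funext c'
  exact η.2 c c'

/-- The tangent bundle, as a set. -/
abbrev TangentTotal : Type _ := Σ x, A.TangentSp x

open Classical in
/-- The representative of `η` in the chart `c` (zero if `c` is not a chart around its base point). -/
def coord (c : BanachChart.{u, w} X) (η : A.TangentTotal) : c.V :=
  if h : c ∈ A.charts ∧ η.1 ∈ c.toEquiv.source then η.2.1 ⟨c, h⟩ else 0

open Classical in
/-- The tangent vector at the point `c⁻¹ z.1` that the chart `c` represents by `z.2`. -/
def ofCoord (c : BanachChart.{u, w} X) (z : c.V × c.V) : A.TangentTotal :=
  ⟨c.toEquiv.symm z.1,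
    if h : c ∈ A.charts ∧ c.toEquiv.symm z.1 ∈ c.toEquiv.source then A.mkTangent ⟨c, h⟩ z.2 else 0⟩

/-- The chart of the tangent bundle induced by a chart. -/
def tangentChart (c : BanachChart.{u, w} X) (hc : c ∈ A.charts) :
    BanachChart A.TangentTotal where
  V := c.V × c.V
  toEquiv :=
    { toFun := fun η => (c.toEquiv η.1, A.coord c η)
      invFun := A.ofCoord c
      source := {η | η.1 ∈ c.toEquiv.source}
      target := c.toEquiv.target ×ˢ univ
      map_source' := fun η hη => ⟨c.toEquiv.map_source hη, mem_univ _⟩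
      map_target' := fun z hz => c.toEquiv.map_target hz.1
      left_inv' := by
        rintro ⟨x, η⟩ hx
        have hx' : x ∈ c.toEquiv.source := hx
        have key : ∀ y (hy : y = x) (hs : y ∈ c.toEquiv.source),
            (⟨y, A.mkTangent ⟨c, hc, hs⟩ (A.coord c ⟨x, η⟩)⟩ : A.TangentTotal) = ⟨x, η⟩ := by
          rintro y rfl hs
          have : A.coord c ⟨y, η⟩ = η.1 ⟨c, hc, hx'⟩ := dif_pos ⟨hc, hx'⟩
          rw [this]
          exact congrArg (Sigma.mk y) (A.mkTangent_coord ⟨c, hc, hs⟩ η)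
        have hs : c.toEquiv.symm (c.toEquiv x) ∈ c.toEquiv.source :=
          c.toEquiv.map_target (c.toEquiv.map_source hx')
        have h1 : A.ofCoord c (c.toEquiv x, A.coord c ⟨x, η⟩) =
            ⟨c.toEquiv.symm (c.toEquiv x), A.mkTangent ⟨c, hc, hs⟩ (A.coord c ⟨x, η⟩)⟩ := by
          unfold ofCoord
          rw [dif_pos ⟨hc, hs⟩]
        exact h1.trans (key _ (c.toEquiv.left_inv hx') hs)
      right_inv' := by
        rintro ⟨z, v⟩ hz
        have hz' : z ∈ c.toEquiv.target := hz.1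
        have hs := c.toEquiv.map_target hz'
        refine Prod.ext (c.toEquiv.right_inv hz') ?_
        change A.coord c (A.ofCoord c (z, v)) = v
        have h1 : A.ofCoord c (z, v) = ⟨c.toEquiv.symm z, A.mkTangent ⟨c, hc, hs⟩ v⟩ := by
          unfold ofCoord
          rw [dif_pos ⟨hc, hs⟩]
        rw [h1]
        unfold coord
        rw [dif_pos ⟨hc, hs⟩]
        exact A.mkTangent_self ⟨c, hc, hs⟩ v }
  open_target := c.open_target.prod isOpen_univ

/-- The tangent bundle, as a Banach manifold. -/
def tangent : BanachAtlas.{max u (w + 1), w} A.TangentTotal where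
  charts := {C | ∃ (c : BanachChart.{u, w} X) (hc : c ∈ A.charts), C = A.tangentChart c hc}
  compat := by
    rintro _ ⟨c, hc, rfl⟩ _ ⟨c', hc', rfl⟩ η hη hη'
    have hx : η.1 ∈ c.toEquiv.source := hη
    have hx' : η.1 ∈ c'.toEquiv.source := hη'
    obtain ⟨h1, d1⟩ := A.compat c hc c' hc' η.1 hx hx'
    set p : c.V × c.V := (c.toEquiv η.1, A.coord c η) with hp
    have hev : ∀ᶠ z : c.V × c.V in 𝓝 p, c.toEquiv.symm z.1 ∈ c'.toEquiv.source :=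
      (continuousAt_fst (p := p)).eventually h1
    refine ⟨hev, ?_⟩
    have hT : ∀ᶠ z : c.V × c.V in 𝓝 p, z.1 ∈ c.toEquiv.target :=
      (continuousAt_fst (p := p)).eventually (c.open_target.mem_nhds (c.toEquiv.map_source hx))
    have heq : (fun z : c.V × c.V => (A.tangentChart c' hc').toEquiv
          ((A.tangentChart c hc).toEquiv.symm z)) =ᶠ[𝓝 p]
        fun z => (c'.toEquiv (c.toEquiv.symm z.1),
          fderiv ℝ (fun y => c'.toEquiv (c.toEquiv.symm y)) z.1 z.2) := by
      filter_upwards [hev, hT] with z hz hzT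
      refine Prod.ext rfl ?_
      change A.coord c' (A.ofCoord c z) = _
      have hs := c.toEquiv.map_target hzT
      have e1 : A.ofCoord c z = ⟨c.toEquiv.symm z.1, A.mkTangent ⟨c, hc, hs⟩ z.2⟩ := by
        unfold ofCoord
        rw [dif_pos ⟨hc, hs⟩]
      rw [e1]
      unfold coord
      rw [dif_pos ⟨hc', hz⟩]
      change fderiv ℝ _ (c.toEquiv (c.toEquiv.symm z.1)) z.2 = _
      rw [c.toEquiv.right_inv hzT]
    refine ContDiffAt.congr_of_eventuallyEq ?_ heq
    have d1' : ContDiffAt ℝ ∞ (fun v => c'.toEquiv (c.toEquiv.symm v)) p.1 := d1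
    have hf : ContDiffAt ℝ ∞ (fderiv ℝ (fun v => c'.toEquiv (c.toEquiv.symm v))) p.1 :=
      d1'.fderiv_right (by simp)
    exact (d1'.comp p contDiffAt_fst).prodMk ((hf.comp p contDiffAt_fst).clm_apply contDiffAt_snd)

/-- A Banach space, as a Banach manifold. -/
def ofSpace (V : Type w) [NormedAddCommGroup V] [NormedSpace ℝ V] [CompleteSpace V] :
    BanachAtlas.{w, w} V where
  charts := {⟨V, PartialEquiv.refl V, isOpen_univ⟩}
  compat := by
    rintro _ rfl _ rfl x _ _
    exact ⟨Eventually.of_forall fun _ => mem_univ _, contDiffAt_id⟩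

/-- The product of two Banach manifolds. -/
def prod : BanachAtlas.{max u u', w} (X × Y) where
  charts := {C | ∃ c ∈ A.charts, ∃ c' ∈ B.charts,
    C = ⟨c.V × c'.V, c.toEquiv.prod c'.toEquiv, c.open_target.prod c'.open_target⟩}
  compat := by
    rintro _ ⟨a, ha, b, hb, rfl⟩ _ ⟨a', ha', b', hb', rfl⟩ ⟨x, y⟩ hxy hxy'
    obtain ⟨h1, d1⟩ := A.compat a ha a' ha' x hxy.1 hxy'.1
    obtain ⟨h2, d2⟩ := B.compat b hb b' hb' y hxy.2 hxy'.2
    refine ⟨?_, ?_⟩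
    · have := h1.prod_nhds h2
      exact this
    · exact ContDiffAt.prodMap d1 d2

open Classical in
/-- The differential at `x` of a map between Banach manifolds, computed in some charts around `x`
and `f x`; for smooth maps it does not depend on them. -/
def tangentMap (f : X → Y) (x : X) (η : A.TangentSp x) : B.TangentSp (f x) :=
  if h : Nonempty (A.ChartAt x) ∧ Nonempty (B.ChartAt (f x)) then
    B.mkTangent h.2.some
      (fderiv ℝ (fun v => h.2.some.1.toEquiv (f (h.1.some.1.toEquiv.symm v)))
        (h.1.some.1.toEquiv x) (η.1 h.1.some))
  else 0

section IntoManifold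

variable {EN : Type*} [NormedAddCommGroup EN] [NormedSpace ℝ EN] {HN : Type*} [TopologicalSpace HN]
  (J : ModelWithCorners ℝ EN HN) {N : Type*} [TopologicalSpace N] [ChartedSpace HN N]

/-- Smoothness of a map from a Banach manifold to a manifold with a fixed model space. -/
def SmoothInto (f : X → N) : Prop :=
  ∀ x, ∃ c ∈ A.charts, x ∈ c.toEquiv.source ∧
    ContMDiffAt 𝓘(ℝ, c.V) J ∞ (fun v => f (c.toEquiv.symm v)) (c.toEquiv x)

open Classical in
/-- The differential at `x` of a map from a Banach manifold to a manifold with a fixed model space,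
computed in some chart around `x`; for smooth maps it does not depend on the chart. -/
def mderiv (f : X → N) (x : X) (η : A.TangentSp x) : TangentSpace J (f x) :=
  if h : Nonempty (A.ChartAt x) then
    (mfderiv 𝓘(ℝ, h.some.1.V) J (fun v => f (h.some.1.toEquiv.symm v))
      (h.some.1.toEquiv x) (η.1 h.some) : EN)
  else (0 : EN)

end IntoManifold

end BanachAtlas

/-! ### Banach vector bundles and their connections -/

/-- A map `proj : Y → X` between sets with smooth atlases whose fibres carry the structure of a
vector space: `Y` is identified with the set of pairs of a point `x` and a vector of `Fib x`. -/
structure LinearFibration (X : Type u) (Y : Type u') where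
  base : BanachAtlas.{u, w} X
  total : BanachAtlas.{u', w} Y
  Fib : X → Type uf
  [addCommGroup : ∀ x, AddCommGroup (Fib x)]
  [module : ∀ x, Module ℝ (Fib x)]
  equiv : Y ≃ Σ x, Fib x

attribute [instance] LinearFibration.addCommGroup LinearFibration.module

namespace LinearFibration

variable {X : Type u} {Y : Type u'} (L : LinearFibration.{u, u', uf, w} X Y)

/-- The projection. -/
def proj (y : Y) : X := (L.equiv y).1

/-- The point `y`, as a vector of its fibre. -/
def vec (y : Y) : L.Fib (L.proj y) := (L.equiv y).2

/-- The point of the total space given by a vector of a fibre. -/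
def pt {x : X} (e : L.Fib x) : Y := L.equiv.symm ⟨x, e⟩

/-- A smooth local trivialization over the open set `U` with typical fibre the Banach space `E₀`:
linear isomorphisms `s x : E₀ → Fib x` for `x ∈ U`, with inverses `inv x`, that make up a
diffeomorphism from `U × E₀` onto the part of the total space over `U`.
(Outside of `U`, the values of `s` and `inv` have no meaning.) -/
structure LocalTriv where
  E₀ : Type w
  [normed : NormedAddCommGroup E₀]
  [space : NormedSpace ℝ E₀]
  [complete : CompleteSpace E₀]
  U : Set X
  open_U : L.base.IsOpenSet U
  s : ∀ x, E₀ →ₗ[ℝ] L.Fib x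
  inv : ∀ x, L.Fib x →ₗ[ℝ] E₀
  inv_s : ∀ x ∈ U, ∀ z, inv x (s x z) = z
  s_inv : ∀ x ∈ U, ∀ e, s x (inv x e) = e
  smooth_s : ∀ x ∈ U, ∀ z, (L.base.prod (BanachAtlas.ofSpace E₀)).SmoothAt L.total
    (fun q => L.pt (s q.1 q.2)) (x, z)
  smooth_inv : ∀ y, L.proj y ∈ U →
    L.total.SmoothAt (BanachAtlas.ofSpace E₀) (fun y => inv (L.proj y) (L.vec y)) y

attribute [instance] LocalTriv.normed LocalTriv.space LocalTriv.complete

/-- The fibration is a Banach vector bundle: both spaces are Banach manifolds, and the local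
trivializations cover the base. -/
structure IsBanachVectorBundle : Prop where
  base_manifold : L.base.IsBanachManifold
  total_manifold : L.total.IsBanachManifold
  trivial : ∀ x, ∃ t : L.LocalTriv, x ∈ t.U

/-- A connection: a smooth map `P` from the tangent bundle of the total space to the total space,
linear from the tangent space at `y` to the fibre through `y`, that in each local trivialization
is given by a smooth Christoffel symbol `Γ`. Smoothness of `Γ` means that it is given in charts of
the base, and in the trivialization, by a smooth map `γ` into the Banach space of continuous
bilinear maps. -/
structure IsConnection (P : ∀ y : Y, L.total.TangentSp y →ₗ[ℝ] L.Fib (L.proj y)) : Prop where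
  smooth : ∀ η : L.total.TangentTotal,
    L.total.tangent.SmoothAt L.total (fun η => L.pt (P η.1 η.2)) η
  christoffel : ∀ t : L.LocalTriv,
    ∃ Γ : ∀ x, L.base.TangentSp x →ₗ[ℝ] L.Fib x →ₗ[ℝ] L.Fib x,
      (∀ c ∈ L.base.charts, ∃ γ : c.V → c.V →L[ℝ] t.E₀ →L[ℝ] t.E₀,
        ContDiffOn ℝ ∞ γ (c.toEquiv.target ∩ c.toEquiv.symm ⁻¹' t.U) ∧
        ∀ x ∈ c.toEquiv.source, x ∈ t.U → ∀ (v : L.base.TangentSp x) (e : L.Fib x),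
          t.inv x (Γ x v e) = γ (c.toEquiv x) (L.base.coord c ⟨x, v⟩) (t.inv x e)) ∧
      ∀ y : Y, L.proj y ∈ t.U → ∀ η : L.total.TangentSp y,
        P y η =
          t.s (L.proj y)
            (L.total.mderiv 𝓘(ℝ, t.E₀) (fun y => t.inv (L.proj y) (L.vec y)) y η) +
          Γ (L.proj y) (L.total.tangentMap L.base L.proj y η) (L.vec y)

end LinearFibration

/-! ### Finite-dimensional vector bundles -/

section FiniteDimensional

variable {EM : Type*} [NormedAddCommGroup EM] [NormedSpace ℝ EM] {HM : Type*} [TopologicalSpace HM]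
  (IM : ModelWithCorners ℝ EM HM) {M : Type*} [TopologicalSpace M] [ChartedSpace HM M]
  [IsManifold IM ∞ M]
  (F : Type*) [NormedAddCommGroup F] [NormedSpace ℝ F]
  {E : M → Type*} [∀ x, AddCommGroup (E x)] [∀ x, Module ℝ (E x)]
  [∀ x, TopologicalSpace (E x)] [∀ x, IsTopologicalAddGroup (E x)]
  [∀ x, ContinuousSMul ℝ (E x)]
  [TopologicalSpace (TotalSpace F E)] [FiberBundle F E] [VectorBundle ℝ F E]
  [ContMDiffVectorBundle ∞ F E IM]

/-- A connection on a vector bundle `E → M`: a smooth map `P : TE → E`, linear from `T_e E` to the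
fibre through `e`, that in each local trivialization of the bundle is given by a smooth
Christoffel symbol `Γ`. -/
structure IsBundleConnection
    (P : ∀ e : TotalSpace F E, TangentSpace (IM.prod 𝓘(ℝ, F)) e →ₗ[ℝ] E e.proj) : Prop where
  smooth : ContMDiff (IM.prod 𝓘(ℝ, F)).tangent (IM.prod 𝓘(ℝ, F)) ∞
    (fun η : TangentBundle (IM.prod 𝓘(ℝ, F)) (TotalSpace F E) =>
      (⟨η.proj.proj, P η.proj η.2⟩ : TotalSpace F E))
  christoffel : ∀ (t : Trivialization F (π F E)) [MemTrivializationAtlas t],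
    ∃ Γ : ∀ x, TangentSpace IM x →L[ℝ] E x →L[ℝ] E x,
      ContMDiffOn IM (IM.prod 𝓘(ℝ, EM →L[ℝ] F →L[ℝ] F)) ∞
        (fun x => TotalSpace.mk' (EM →L[ℝ] F →L[ℝ] F)
          (E := fun x => TangentSpace IM x →L[ℝ] E x →L[ℝ] E x) x (Γ x)) t.baseSet ∧
      ∀ e : TotalSpace F E, e.proj ∈ t.baseSet → ∀ η : TangentSpace (IM.prod 𝓘(ℝ, F)) e,
        P e η =
          t.symm e.proj
            (mfderiv (IM.prod 𝓘(ℝ, F)) 𝓘(ℝ, F) (fun z : TotalSpace F E => (t z).2) e η) +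
          Γ e.proj (mfderiv (IM.prod 𝓘(ℝ, F)) IM (TotalSpace.proj : TotalSpace F E → M) e η) e.2

/-- A map `T`, over the map `f` of the bases, from a Banach vector bundle with connection `P` to a
finite-dimensional vector bundle with connection `PE` is affine: it is a smooth bundle morphism,
and `PE ∘ dT = T ∘ P`. -/
structure IsAffineBundleMap {X : Type u} {Y : Type u'} (L : LinearFibration.{u, u', uf, w} X Y)
    (P : ∀ y : Y, L.total.TangentSp y →ₗ[ℝ] L.Fib (L.proj y))
    (PE : ∀ e : TotalSpace F E, TangentSpace (IM.prod 𝓘(ℝ, F)) e →ₗ[ℝ] E e.proj)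
    (f : X → M) (T : Y → TotalSpace F E) : Prop where
  smooth_base : L.base.SmoothInto IM f
  smooth_total : L.total.SmoothInto (IM.prod 𝓘(ℝ, F)) T
  linear : ∃ A : ∀ x, L.Fib x →ₗ[ℝ] E (f x), ∀ x (e : L.Fib x), T (L.pt e) = ⟨f x, A x e⟩
  affine : ∀ y (η : L.total.TangentSp y),
    (⟨(T y).proj, PE (T y) (L.total.mderiv (IM.prod 𝓘(ℝ, F)) T y η)⟩ : TotalSpace F E) =
      T (L.pt (P y η))

end FiniteDimensional

/-! ### The Banach space `C^k(D, W)` for a compact manifold `D` and a normed space `W` -/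

section Ck

universe uD uN

/-- The set `C^k(D, N)`. -/
abbrev CkMap {ED : Type*} [NormedAddCommGroup ED] [NormedSpace ℝ ED]
    {HD : Type*} [TopologicalSpace HD] (I : ModelWithCorners ℝ ED HD)
    {EN : Type*} [NormedAddCommGroup EN] [NormedSpace ℝ EN]
    {HN : Type*} [TopologicalSpace HN] (J : ModelWithCorners ℝ EN HN)
    (D : Type uD) [TopologicalSpace D] [ChartedSpace HD D]
    (N : Type uN) [TopologicalSpace N] [ChartedSpace HN N] (k : ℕ) : Type (max uD uN) :=
  ContMDiffMap I J D N (k : WithTop ℕ∞)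

/-- A compact manifold is covered by the interiors of finitely many compact sets, each of them
contained in the domain of a chart. -/
theorem exists_chartCover {ED : Type*} [NormedAddCommGroup ED] [NormedSpace ℝ ED]
    [FiniteDimensional ℝ ED] {HD : Type*} [TopologicalSpace HD] (I : ModelWithCorners ℝ ED HD)
    (D : Type uD) [TopologicalSpace D] [ChartedSpace HD D] [CompactSpace D] :
    ∃ q : Finset D × (D → Set D),
      (∀ x, IsCompact (q.2 x) ∧ q.2 x ⊆ (chartAt HD x).source) ∧
        ∀ y, ∃ x ∈ q.1, y ∈ interior (q.2 x) := by
  have : LocallyCompactSpace D := Manifold.locallyCompact_of_finiteDimensional I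
  have h : ∀ x : D, ∃ K : Set D, IsCompact K ∧ K ⊆ (chartAt HD x).source ∧ K ∈ 𝓝 x := by
    intro x
    obtain ⟨K, hK, hsub, hc⟩ :=
      local_compact_nhds ((chartAt HD x).open_source.mem_nhds (mem_chart_source HD x))
    exact ⟨K, hc, hsub, hK⟩
  choose K hc hs hn using h
  obtain ⟨t, ht⟩ := isCompact_univ.elim_nhds_subcover (fun x => interior (K x))
    (fun x _ => interior_mem_nhds.2 (hn x))
  refine ⟨(t, K), fun x => ⟨hc x, hs x⟩, fun y => ?_⟩
  simpa using ht.2 (mem_univ y)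

variable {ED : Type*} [NormedAddCommGroup ED] [NormedSpace ℝ ED] [FiniteDimensional ℝ ED]
  {HD : Type*} [TopologicalSpace HD] (I : ModelWithCorners ℝ ED HD)
  (D : Type uD) [TopologicalSpace D] [ChartedSpace HD D] [CompactSpace D]

/-- The centres of the charts of a fixed finite cover of `D` by compact subsets of chart domains. -/
def coverIndex : Finset D := (exists_chartCover I D).choose.1

/-- The compact sets of the cover. -/
def coverSet (x : D) : Set D := (exists_chartCover I D).choose.2 x

instance coverSet_compact (x : D) : CompactSpace (coverSet I D x) :=
  isCompact_iff_compactSpace.1 ((exists_chartCover I D).choose_spec.1 x).1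

theorem coverSet_subset (x : D) : coverSet I D x ⊆ (extChartAt I x).source := by
  rw [extChartAt_source]
  exact ((exists_chartCover I D).choose_spec.1 x).2

theorem exists_mem_coverSet (y : D) : ∃ x ∈ coverIndex I D, y ∈ coverSet I D x := by
  obtain ⟨x, hx, hy⟩ := (exists_chartCover I D).choose_spec.2 y
  exact ⟨x, hx, interior_subset hy⟩

variable [IsManifold I ∞ D] (k : ℕ) (W : Type*) [NormedAddCommGroup W] [NormedSpace ℝ W]

theorem contDiffOn_coord {f : D → W} (hf : ContMDiff I 𝓘(ℝ, W) (k : WithTop ℕ∞) f) (x : D) :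
    ContDiffOn ℝ k (fun z => f ((extChartAt I x).symm z)) (extChartAt I x).target := by
  have : IsManifold I (k : WithTop ℕ∞) D := IsManifold.of_le (n := ∞) (by exact_mod_cast le_top)
  rw [← contMDiffOn_iff_contDiffOn]
  exact hf.comp_contMDiffOn (contMDiffOn_extChartAt_symm x)

/-- The partial derivatives of order at most `k` in the charts of the cover. -/
def ckJet : CkMap I 𝓘(ℝ, W) D W k →ₗ[ℝ]
    (∀ (x : coverIndex I D) (l : Fin (k + 1)), C(coverSet I D x.1, ED [×(l : ℕ)]→L[ℝ] W)) where
  toFun f x l :=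
    { toFun := fun y => iteratedFDerivWithin ℝ l (fun z => f ((extChartAt I x.1).symm z))
        (extChartAt I x.1).target (extChartAt I x.1 y.1)
      continuous_toFun := by
        have h := (contDiffOn_coord I D k W f.contMDiff x.1).continuousOn_iteratedFDerivWithin
          (m := (l : ℕ)) (by exact_mod_cast Nat.lt_succ_iff.1 l.2)
          (uniqueDiffOn_extChartAt_target x.1)
        have h2 : ContinuousOn (extChartAt I x.1) (coverSet I D x.1) :=
          (continuousOn_extChartAt x.1).mono (coverSet_subset I D x.1)
        exact continuousOn_iff_continuous_domRestrict.1 (h.comp h2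
          (fun y hy => (extChartAt I x.1).map_source (coverSet_subset I D x.1 hy))) }
  map_add' f g := by
    funext x l
    ext1 y
    have hy := (extChartAt I x.1).map_source (coverSet_subset I D x.1 y.2)
    have hl : ((l : ℕ) : WithTop ℕ∞) ≤ k := by exact_mod_cast Nat.lt_succ_iff.1 l.2
    exact iteratedFDerivWithin_add_apply
      (((contDiffOn_coord I D k W f.contMDiff x.1).of_le hl) _ hy)
      (((contDiffOn_coord I D k W g.contMDiff x.1).of_le hl) _ hy)
      (uniqueDiffOn_extChartAt_target x.1) hy
  map_smul' r f := by
    funext x l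
    ext1 y
    have hy := (extChartAt I x.1).map_source (coverSet_subset I D x.1 y.2)
    have hl : ((l : ℕ) : WithTop ℕ∞) ≤ k := by exact_mod_cast Nat.lt_succ_iff.1 l.2
    exact iteratedFDerivWithin_const_smul_apply
      (((contDiffOn_coord I D k W f.contMDiff x.1).of_le hl) _ hy)
      (uniqueDiffOn_extChartAt_target x.1) hy

theorem ckJet_injective : Function.Injective (ckJet I D k W) := by
  intro f g h
  ext y
  obtain ⟨x, hx, hy⟩ := exists_mem_coverSet I D y
  have h1 := congrArg (fun T => T ⟨x, hx⟩ 0 ⟨y, hy⟩ 0) h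
  have h2 := (extChartAt I x).left_inv (coverSet_subset I D x hy)
  change f ((extChartAt I x).symm (extChartAt I x y)) =
    g ((extChartAt I x).symm (extChartAt I x y)) at h1
  rwa [h2] at h1

/-- The `C^k` norm: the maximum of the sup norms of the derivatives of order at most `k` in the
charts of the cover. -/
instance ckNormedAddCommGroup : NormedAddCommGroup (CkMap I 𝓘(ℝ, W) D W k) :=
  NormedAddCommGroup.induced _ _ (ckJet I D k W) (ckJet_injective I D k W)

instance ckNormedSpace : NormedSpace ℝ (CkMap I 𝓘(ℝ, W) D W k) :=
  NormedSpace.induced ℝ _ _ (ckJet I D k W)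

/-! ### The Banach manifold `C^k(D, N)` -/

variable {D k}
variable {EN : Type*} [NormedAddCommGroup EN] [NormedSpace ℝ EN] {HN : Type*} [TopologicalSpace HN]
  (J : ModelWithCorners ℝ EN HN) {N : Type uN} [TopologicalSpace N] [ChartedSpace HN N]

/-- Left-composition `h_* : C^k(D, N) → C^k(D, W)` with a smooth map `h : N → W`. -/
def leftComp {W : Type*} [NormedAddCommGroup W] [NormedSpace ℝ W] (h : C^∞⟮J, N; 𝓘(ℝ, W), W⟯)
    (g : CkMap I J D N k) : CkMap I 𝓘(ℝ, W) D W k :=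
  ⟨fun p => h (g p), (h.contMDiff.of_le (by exact_mod_cast le_top)).comp g.contMDiff⟩

/-- The charts of the standard Banach manifold structure of `C^k(D, N)`, for which `C^k(D, N)` is
locally a submanifold of the Banach spaces `C^k(D, ℝ^m)` by means of the left-compositions with
smooth maps `h : N → ℝ^m`: the inverse of the chart is smooth as a map into these spaces, and
the chart itself is, near each point of its domain, the restriction of a smooth map `G` that is
defined on an open subset `O` of such a space. -/
def IsCkChart (c : BanachChart.{max uD uN, uD} (CkMap I J D N k)) : Prop :=
  (∀ (m : ℕ) (h : C^∞⟮J, N; 𝓘(ℝ, EuclideanSpace ℝ (Fin m)), EuclideanSpace ℝ (Fin m)⟯),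
    ContDiffOn ℝ ∞ (fun v => leftComp I J h (c.toEquiv.symm v)) c.toEquiv.target) ∧
  ∀ f ∈ c.toEquiv.source,
    ∃ (m : ℕ) (h : C^∞⟮J, N; 𝓘(ℝ, EuclideanSpace ℝ (Fin m)), EuclideanSpace ℝ (Fin m)⟯)
      (O : Set (CkMap I 𝓘(ℝ, EuclideanSpace ℝ (Fin m)) D (EuclideanSpace ℝ (Fin m)) k))
      (G : CkMap I 𝓘(ℝ, EuclideanSpace ℝ (Fin m)) D (EuclideanSpace ℝ (Fin m)) k → c.V),
      IsOpen O ∧ leftComp I J h f ∈ O ∧ ContDiffOn ℝ ∞ G O ∧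
        ∀ g, leftComp I J h g ∈ O → g ∈ c.toEquiv.source ∧ c.toEquiv g = G (leftComp I J h g)

variable (D N k) in
/-- The standard smooth atlas of `C^k(D, N)`. -/
def ckAtlas : BanachAtlas.{max uD uN, uD} (CkMap I J D N k) where
  charts := {c | IsCkChart I J c}
  compat := by
    intro c hc c' hc' x hx hx'
    obtain ⟨m, h, O, G, hO, hxO, hG, hsub⟩ := hc'.2 x hx'
    have hinv : ContDiffAt ℝ ∞ (fun v => leftComp I J h (c.toEquiv.symm v)) (c.toEquiv x) :=
      (hc.1 m h).contDiffAt (c.open_target.mem_nhds (c.toEquiv.map_source hx))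
    have hval : leftComp I J h (c.toEquiv.symm (c.toEquiv x)) ∈ O := by
      rw [c.toEquiv.left_inv hx]
      exact hxO
    have hev : ∀ᶠ v in 𝓝 (c.toEquiv x), leftComp I J h (c.toEquiv.symm v) ∈ O :=
      hinv.continuousAt.eventually (hO.mem_nhds hval)
    refine ⟨hev.mono fun v hv => (hsub _ hv).1, ?_⟩
    have hcomp := (hG.contDiffAt (hO.mem_nhds hval)).comp (c.toEquiv x) hinv
    exact hcomp.congr_of_eventuallyEq (hev.mono fun v hv => (hsub _ hv).2)

/-! ### The bundle `C^k(D, E) → C^k(D, M)` and its evaluation maps -/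

variable {EM : Type*} [NormedAddCommGroup EM] [NormedSpace ℝ EM] {HM : Type*} [TopologicalSpace HM]
  (IM : ModelWithCorners ℝ EM HM) {M : Type*} [TopologicalSpace M] [ChartedSpace HM M]
  [IsManifold IM ∞ M]
  (F : Type*) [NormedAddCommGroup F] [NormedSpace ℝ F]
  (E : M → Type*) [∀ x, AddCommGroup (E x)] [∀ x, Module ℝ (E x)]
  [∀ x, TopologicalSpace (E x)]
  [TopologicalSpace (TotalSpace F E)] [FiberBundle F E] [VectorBundle ℝ F E]
  [ContMDiffVectorBundle ∞ F E IM]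

/-- The vector space of `C^k` sections of `E` along `f`. -/
def ckFiber (f : CkMap I IM D M k) : Submodule ℝ (∀ p, E (f p)) where
  carrier := {σ | ContMDiff I (IM.prod 𝓘(ℝ, F)) k (fun p => (⟨f p, σ p⟩ : TotalSpace F E))}
  add_mem' := by
    intro a b ha hb p
    have : ContMDiffVectorBundle (k : WithTop ℕ∞) F E IM :=
      ContMDiffVectorBundle.of_le (n := ∞) (by exact_mod_cast le_top)
    have ha' := (contMDiffAt_totalSpace.1 (ha p)).2
    have hb' := (contMDiffAt_totalSpace.1 (hb p)).2
    refine contMDiffAt_totalSpace.2 ⟨f.contMDiff p, ?_⟩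
    refine (ha'.add hb').congr_of_eventuallyEq ?_
    filter_upwards [f.contMDiff.continuous.continuousAt.preimage_mem_nhds
      ((trivializationAt F E (f p)).open_baseSet.mem_nhds
        (FiberBundle.mem_baseSet_trivializationAt' (f p)))] with q hq
    exact ((trivializationAt F E (f p)).linear ℝ hq).map_add (a q) (b q)
  zero_mem' := by
    intro p
    have : ContMDiffVectorBundle (k : WithTop ℕ∞) F E IM :=
      ContMDiffVectorBundle.of_le (n := ∞) (by exact_mod_cast le_top)
    refine contMDiffAt_totalSpace.2 ⟨f.contMDiff p, ?_⟩
    refine (contMDiffAt_const (c := (0 : F))).congr_of_eventuallyEq ?_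
    filter_upwards [f.contMDiff.continuous.continuousAt.preimage_mem_nhds
      ((trivializationAt F E (f p)).open_baseSet.mem_nhds
        (FiberBundle.mem_baseSet_trivializationAt' (f p)))] with q hq
    exact ((trivializationAt F E (f p)).linear ℝ hq).map_zero
  smul_mem' := by
    intro r a ha p
    have : ContMDiffVectorBundle (k : WithTop ℕ∞) F E IM :=
      ContMDiffVectorBundle.of_le (n := ∞) (by exact_mod_cast le_top)
    have ha' := (contMDiffAt_totalSpace.1 (ha p)).2
    refine contMDiffAt_totalSpace.2 ⟨f.contMDiff p, ?_⟩
    refine ((r • ContinuousLinearMap.id ℝ F).contMDiff.contMDiffAt.comp p ha').congr_of_eventuallyEq ?_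
    filter_upwards [f.contMDiff.continuous.continuousAt.preimage_mem_nhds
      ((trivializationAt F E (f p)).open_baseSet.mem_nhds
        (FiberBundle.mem_baseSet_trivializationAt' (f p)))] with q hq
    exact ((trivializationAt F E (f p)).linear ℝ hq).map_smul r (a q)

/-- Left-composition with the bundle projection, `C^k(D, E) → C^k(D, M)`. -/
def ckProj (G : CkMap I (IM.prod 𝓘(ℝ, F)) D (TotalSpace F E) k) : CkMap I IM D M k :=
  ⟨fun p => (G p).proj, (contMDiff_proj E).comp G.contMDiff⟩

variable (D k) in
/-- `C^k(D, E) → C^k(D, M)` as a fibration with linear fibres. -/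
def ckBundle : LinearFibration (CkMap I IM D M k)
    (CkMap I (IM.prod 𝓘(ℝ, F)) D (TotalSpace F E) k) where
  base := ckAtlas I D k IM M
  total := ckAtlas I D k (IM.prod 𝓘(ℝ, F)) (TotalSpace F E)
  Fib f := ckFiber I IM F E f
  equiv :=
    { toFun := fun G => ⟨ckProj I IM F E G, ⟨fun p => (G p).2, G.contMDiff⟩⟩
      invFun := fun q => ⟨fun p => ⟨q.1 p, q.2.1 p⟩, q.2.2⟩
      left_inv := fun _ => rfl
      right_inv := fun _ => rfl }

end Ck

/-! Maps into a manifold `N` are handled through smooth maps `h : N → ℝ^m`. Near a given compact set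
some `h` has a smooth left inverse `r` (`exists_isSmoothLeftInverse`), so that near `f` the operator
`u ↦ h ∘ r ∘ u` is a smooth idempotent of an open set of the Banach space `C^k(D, ℝ^m)`, whose fixed
points represent the maps into `N`. Such an idempotent is conjugate to its differential near a fixed
point (`exists_linearization_of_idempotent`), and the fixed space of the differential is the model
space of a chart (`exists_isCkChart`). The analytic input is the smoothness of `u ↦ φ ∘ u`
(`contDiffOn_ckComp`): Faà di Bruno's formula turns it into a superposition operator on continuous
jets over compact sets, and the jet map is an isometric embedding of a complete space, so smoothness
descends along it. Every later smoothness claim about `C^k(D, N)` is reduced to this one by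
composing with maps `h`.

The differential of `h_*` takes `η` to the map `p ↦ dh (d ev_p η)`. Charts factor through some
`h_*`, so the values `d ev_p η` determine `η`; and a `C^k` field `ξ` along `f` is the velocity at `t
= 0` of the curve `t ↦ r ∘ (h ∘ f + t dh ξ)`. This identifies the tangent bundle of `C^k(D, N)` with
`C^k(D, TN)` (`bijOn_mderiv_eval`).

For the bundle structure, `E` is a direct summand of a trivial bundle near a compact set, by means
of fibrewise linear maps `a`, `b` with `b ∘ a = ψ` and `ψ = 1` on that set. The sections along `f`
then sit inside `C^k(D, ℝ^r)` as the image of the multiplication by `a ∘ b`, and these images are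
identified with each other for nearby `f` as the images of nearby projections are
(`exists_localTriv`).

The natural connection has the value `PE (d ev_p η)` at `p`, and it is smooth because it is a
left-composition with a smooth map. A tangent vector at `s f e` splits into a vertical vector and
the image of its projection under the section `g ↦ s g e`. On the first the connection is the
identity; its value on the second is the Christoffel symbol. Linearity of the symbol is checked at
each `p`, and its smoothness as a family of bounded bilinear maps follows from joint smoothness by
differentiating at zero (`exists_contDiffOn_bilinear`). Uniqueness holds because affinity of `ev_p`
prescribes the value at `p`, for every `p`. -/

section Construction

set_option maxSynthPendingDepth 3
set_option linter.unusedSectionVars false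

/-! ### Superposition operators on spaces of continuous maps -/

namespace ContinuousMap

universe uK v

variable {K : Type uK} [TopologicalSpace K] [CompactSpace K]

open Classical in
/-- The superposition operator `u ↦ φ ∘ u` (zero if `φ ∘ u` is not continuous). -/
def superpose {V W : Type*} [TopologicalSpace V] [TopologicalSpace W] [Zero W]
    (φ : V → W) (u : C(K, V)) : C(K, W) :=
  if h : Continuous (φ ∘ u) then ⟨φ ∘ u, h⟩ else 0

theorem superpose_apply {V W : Type*} [TopologicalSpace V] [TopologicalSpace W] [Zero W]
    {φ : V → W} {O : Set V} (hφ : ContinuousOn φ O) {u : C(K, V)}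
    (hu : ∀ y, u y ∈ O) (y : K) : superpose φ u y = φ (u y) := by
  have h : Continuous (φ ∘ u) := hφ.comp_continuous u.continuous hu
  rw [superpose, dif_pos h]
  rfl

variable {V : Type v} [NormedAddCommGroup V] [NormedSpace ℝ V]

/-- Pointwise application of a continuous family of operators, as a bilinear map. -/
def applyLinear (W : Type*) [NormedAddCommGroup W] [NormedSpace ℝ W] :
    C(K, V →L[ℝ] W) →ₗ[ℝ] C(K, V) →ₗ[ℝ] C(K, W) :=
  LinearMap.mk₂ ℝ (fun (A : C(K, V →L[ℝ] W)) (u : C(K, V)) =>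
      (⟨fun y => A y (u y), A.continuous.clm_apply u.continuous⟩ : C(K, W)))
    (fun _ _ _ => by ext; simp) (fun _ _ _ => by ext; simp)
    (fun _ _ _ => by ext; simp) (fun _ _ _ => by ext; simp)

/-- Pointwise application of a continuous family of operators. -/
def applyL (W : Type*) [NormedAddCommGroup W] [NormedSpace ℝ W] :
    C(K, V →L[ℝ] W) →L[ℝ] C(K, V) →L[ℝ] C(K, W) :=
  (applyLinear W).mkContinuous₂ 1 fun A u => by
    rw [one_mul]
    refine (ContinuousMap.norm_le _ (mul_nonneg (norm_nonneg A) (norm_nonneg u))).2 fun y => ?_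
    exact ((A y).le_opNorm _).trans (mul_le_mul (A.norm_coe_le_norm y) (u.norm_coe_le_norm y)
      (norm_nonneg _) (norm_nonneg _))

theorem applyL_apply {W : Type*} [NormedAddCommGroup W] [NormedSpace ℝ W]
    (A : C(K, V →L[ℝ] W)) (u : C(K, V)) (y : K) : applyL W A u y = A y (u y) := rfl

theorem isOpen_forall_mem {O : Set V} (hO : IsOpen O) : IsOpen {u : C(K, V) | ∀ y, u y ∈ O} := by
  have := ContinuousMap.isOpen_setOfPred_mapsTo (X := K) (Y := V) isCompact_univ hO
  simpa [MapsTo] using this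

/-- The range of `u` is compact, so `fderiv ℝ φ` is uniformly continuous near it; the mean value
inequality on balls of one common radius then gives a first order remainder that is uniform in `y`.
-/
theorem hasFDerivAt_superpose {W : Type*} [NormedAddCommGroup W] [NormedSpace ℝ W] {φ : V → W}
    {O : Set V} (hO : IsOpen O) (hφ : ContDiffOn ℝ ∞ φ O) {u : C(K, V)} (hu : ∀ y, u y ∈ O) :
    HasFDerivAt (superpose φ) (applyL W (superpose (fderiv ℝ φ) u)) u := by
  have hd : ∀ v ∈ O, HasFDerivAt φ (fderiv ℝ φ v) v := fun v hv =>
    ((hφ.contDiffAt (hO.mem_nhds hv)).differentiableAt (by simp)).hasFDerivAt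
  have hc : ContinuousOn (fderiv ℝ φ) O :=
    hφ.continuousOn_fderiv_of_isOpen hO (by simp)
  have hcpt : IsCompact (range u) := isCompact_range u.continuous
  have hsub : range u ⊆ O := by rintro _ ⟨y, rfl⟩; exact hu y
  rw [hasFDerivAt_iff_isLittleO_nhds_zero, Asymptotics.isLittleO_iff]
  intro ε hε
  obtain ⟨δ₁, hδ₁, h1⟩ := hcpt.exists_thickening_subset_open hO hsub
  have h2 := hcpt.uniformContinuousAt_of_continuousAt (fderiv ℝ φ)
    (fun a ha => hc.continuousAt (hO.mem_nhds (hsub ha))) (Metric.dist_mem_uniformity hε)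
  obtain ⟨δ₂, hδ₂, h2⟩ := Metric.mem_uniformity_dist.1 h2
  have hball : ∀ y, ∀ v ∈ Metric.ball (u y) (min δ₁ δ₂), v ∈ O ∧
      ‖fderiv ℝ φ v - fderiv ℝ φ (u y)‖ ≤ ε := by
    intro y v hv
    have hv' := Metric.mem_ball.1 hv
    refine ⟨h1 (Metric.mem_thickening_iff.2 ⟨u y, mem_range_self y,
      hv'.trans_le (min_le_left _ _)⟩), ?_⟩
    have := h2 (a := u y) (b := v) (by rw [dist_comm]; exact hv'.trans_le (min_le_right _ _))
      (mem_range_self y)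
    rw [mem_ofPred_eq, dist_comm, dist_eq_norm] at this
    exact this.le
  filter_upwards [Metric.ball_mem_nhds (0 : C(K, V)) (lt_min hδ₁ hδ₂)] with h hh
  rw [mem_ball_zero_iff] at hh
  have hmem : ∀ y, (u + h) y ∈ Metric.ball (u y) (min δ₁ δ₂) := by
    intro y
    rw [Metric.mem_ball, dist_eq_norm, ContinuousMap.add_apply, add_sub_cancel_left]
    exact (h.norm_coe_le_norm y).trans_lt hh
  refine (ContinuousMap.norm_le _ (by positivity)).2 fun y => ?_
  simp only [ContinuousMap.sub_apply, applyL_apply]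
  rw [superpose_apply hφ.continuousOn (fun y => (hball y _ (hmem y)).1),
    superpose_apply hφ.continuousOn hu, superpose_apply hc hu]
  have := (convex_ball (u y) (min δ₁ δ₂)).norm_image_sub_le_of_norm_hasFDerivWithin_le' (f := φ)
    (f' := fderiv ℝ φ) (φ := fderiv ℝ φ (u y)) (C := ε)
    (fun v hv => (hd v (hball y v hv).1).hasFDerivWithinAt) (fun v hv => (hball y v hv).2)
    (Metric.mem_ball_self (lt_min hδ₁ hδ₂)) (hmem y)
  have e : (u + h) y - u y = h y := by simp
  rw [e] at this
  exact this.trans (mul_le_mul_of_nonneg_left (h.norm_coe_le_norm y) hε.le)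

/-- The derivative of a superposition operator is again one, for `fderiv ℝ φ`, followed by the
bounded linear map `applyL`; hence induction on the order. `W` lives in the universe of `V` since
the induction replaces `W` by `V →L[ℝ] W`. -/
theorem contDiffOn_superpose {W : Type v} [NormedAddCommGroup W] [NormedSpace ℝ W] {φ : V → W}
    {O : Set V} (hO : IsOpen O) (hφ : ContDiffOn ℝ ∞ φ O) :
    ContDiffOn ℝ ∞ (superpose (K := K) φ) {u | ∀ y, u y ∈ O} := by
  have key : ∀ (n : ℕ) (W : Type v) [NormedAddCommGroup W] [NormedSpace ℝ W] (φ : V → W),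
      ContDiffOn ℝ ∞ φ O → ContDiffOn ℝ n (superpose (K := K) φ) {u | ∀ y, u y ∈ O} := by
    intro n
    induction n with
    | zero =>
      intro W _ _ φ hφ
      exact contDiffOn_zero.2 fun u hu =>
        (hasFDerivAt_superpose hO hφ hu).continuousAt.continuousWithinAt
    | succ n ih =>
      intro W _ _ φ hφ
      refine (contDiffOn_succ_iff_fderiv_of_isOpen (n := n) (s := {u : C(K, V) | ∀ y, u y ∈ O})
        (isOpen_forall_mem hO)).2 ⟨fun u hu => (hasFDerivAt_superpose hO hφ hu).differentiableAt.differentiableWithinAt,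
          by simp, ?_⟩
      have h := (applyL (K := K) (V := V) W).contDiff.comp_contDiffOn
        (ih (V →L[ℝ] W) (fderiv ℝ φ) (hφ.fderiv_of_isOpen hO (by simp)))
      exact h.congr fun u hu => (hasFDerivAt_superpose hO hφ hu).fderiv
  exact contDiffOn_infty.2 fun n => key n W φ hφ

end ContinuousMap

/-! ### Smoothness of maps into a closed subspace -/

universe uZ ua ub

/-- The values of the derivative of `i ∘ f` are limits of difference quotients in the range of `i`,
which is closed because `F` is complete. So the derivative factors through `i`, and the remainder
estimate is unchanged since `i` preserves norms. -/
theorem LinearIsometry.exists_hasFDerivAt_of_comp {Z F F' : Type*}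
    [NormedAddCommGroup Z] [NormedSpace ℝ Z] [NormedAddCommGroup F] [NormedSpace ℝ F]
    [CompleteSpace F] [NormedAddCommGroup F'] [NormedSpace ℝ F'] (i : F →ₗᵢ[ℝ] F') {f : Z → F}
    {z : Z} (h : DifferentiableAt ℝ (fun z => i (f z)) z) :
    ∃ L : Z →L[ℝ] F, HasFDerivAt f L z ∧
      i.toContinuousLinearMap.comp L = fderiv ℝ (fun z => i (f z)) z := by
  set L' := fderiv ℝ (fun z => i (f z)) z
  have hL' : HasFDerivAt (fun z => i (f z)) L' z := h.hasFDerivAt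
  have hcl : IsClosed (range i) := i.isometry.isClosedEmbedding.isClosed_range
  have hmem : ∀ v, L' v ∈ range i := by
    intro v
    have h1 := hL'.lim v (c := fun n : ℕ => (n : ℝ)) (l := atTop)
      (by simpa using tendsto_natCast_atTop_atTop (R := ℝ))
    refine hcl.mem_of_tendsto h1 (Eventually.of_forall fun n => ?_)
    exact ⟨(n : ℝ) • (f (z + (n : ℝ)⁻¹ • v) - f z), by simp⟩
  let e := i.equivRange
  let L : Z →L[ℝ] F := (e.symm.toContinuousLinearEquiv : _ →L[ℝ] F).comp
    (L'.codRestrict i.range fun v => by simpa using hmem v)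
  have hiL : ∀ v, i (L v) = L' v := by
    intro v
    have : e (L v) = ⟨L' v, by simpa using hmem v⟩ := e.apply_symm_apply _
    exact congrArg Subtype.val this
  refine ⟨L, ?_, by ext v; exact hiL v⟩
  rw [hasFDerivAt_iff_isLittleO_nhds_zero] at hL' ⊢
  refine (Asymptotics.isLittleO_norm_left.1 ?_)
  refine (Asymptotics.isLittleO_norm_left.2 hL').congr_left fun v => ?_
  rw [← hiL, ← map_sub, ← map_sub, i.norm_map]

/-- Induction on the order: composition with `i` is itself an isometry `j` between the operator
spaces in which the derivatives of `f` and `i ∘ f` live. -/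
theorem LinearIsometry.contDiffOn_of_comp {Z : Type uZ} {F : Type max uZ ua} {F' : Type max uZ ub}
    [NormedAddCommGroup Z] [NormedSpace ℝ Z] [NormedAddCommGroup F] [NormedSpace ℝ F]
    [CompleteSpace F] [NormedAddCommGroup F'] [NormedSpace ℝ F'] (i : F →ₗᵢ[ℝ] F') {f : Z → F}
    {O : Set Z} (hO : IsOpen O) (h : ContDiffOn ℝ ∞ (fun z => i (f z)) O) :
    ContDiffOn ℝ ∞ f O := by
  have key : ∀ (n : ℕ) (F : Type max uZ ua) (F' : Type max uZ ub) [NormedAddCommGroup F]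
      [NormedSpace ℝ F] [CompleteSpace F] [NormedAddCommGroup F'] [NormedSpace ℝ F']
      (i : F →ₗᵢ[ℝ] F') (f : Z → F), ContDiffOn ℝ n (fun z => i (f z)) O → ContDiffOn ℝ n f O := by
    intro n
    induction n with
    | zero =>
      intro F F' _ _ _ _ _ i f h
      have h := contDiffOn_zero.1 h
      exact contDiffOn_zero.2 (i.isometry.isUniformInducing.isInducing.continuousOn_iff.2 h)
    | succ n ih =>
      intro F F' _ _ _ _ _ i f h
      obtain ⟨hd, -, hc⟩ := (contDiffOn_succ_iff_fderiv_of_isOpen (n := n) hO).1 h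
      have hf : ∀ z ∈ O, DifferentiableAt ℝ f z ∧
          i.toContinuousLinearMap.comp (fderiv ℝ f z) = fderiv ℝ (fun z => i (f z)) z := by
        intro z hz
        obtain ⟨L, hL, hL'⟩ := i.exists_hasFDerivAt_of_comp ((hd z hz).differentiableAt
          (hO.mem_nhds hz))
        exact ⟨hL.differentiableAt, by rw [hL.fderiv, hL']⟩
      refine (contDiffOn_succ_iff_fderiv_of_isOpen (n := n) hO).2
        ⟨fun z hz => (hf z hz).1.differentiableWithinAt, by simp, ?_⟩
      let j : (Z →L[ℝ] F) →ₗᵢ[ℝ] (Z →L[ℝ] F') :=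
        { toLinearMap := (ContinuousLinearMap.compL ℝ Z F F' i.toContinuousLinearMap).toLinearMap
          norm_map' := fun L => by
            change ‖i.toContinuousLinearMap.comp L‖ = ‖L‖
            exact i.norm_toContinuousLinearMap_comp }
      exact ih _ _ j (fderiv ℝ f) (hc.congr fun z hz => (hf z hz).2)
  exact contDiffOn_infty.2 fun n => key n F F' i f (contDiffOn_infty.1 h n)

/-! ### Linearization of a smooth retraction -/

/-- Near a fixed point, a smooth idempotent map of a Banach space is conjugate to its
differential. -/
theorem exists_linearization_of_idempotent {X : Type*} [NormedAddCommGroup X] [NormedSpace ℝ X]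
    [CompleteSpace X] {R : X → X} {O : Set X} (hO : IsOpen O) (hR : ContDiffOn ℝ ∞ R O)
    (hi : ∀ u ∈ O, R (R u) = R u) {u₀ : X} (h₀ : u₀ ∈ O) (hf : R u₀ = u₀) :
    ∃ (A : X →L[ℝ] X) (e : OpenPartialHomeomorph X X), (∀ u, A (A u) = A u) ∧ u₀ ∈ e.source ∧
      e.source ⊆ O ∧ ContDiffOn ℝ ∞ e.symm e.target ∧
      ∀ u, e u = A (R u) + ((u - R u) - A (u - R u)) := by
  set A := fderiv ℝ R u₀
  have hRd : HasFDerivAt R A u₀ :=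
    ((hR.contDiffAt (hO.mem_nhds h₀)).differentiableAt (by simp)).hasFDerivAt
  have hAA : A.comp A = A := by
    have h1 : HasFDerivAt (R ∘ R) (A.comp A) u₀ :=
      HasFDerivAt.comp u₀ (by rw [hf]; exact hRd) hRd
    have h2 : R ∘ R =ᶠ[𝓝 u₀] R := by
      filter_upwards [hO.mem_nhds h₀] with u hu using hi u hu
    exact (h1.congr_of_eventuallyEq h2.symm).unique hRd
  have hA : ∀ u, A (A u) = A u := fun u => DFunLike.congr_fun hAA u
  -- This is `A R + (1 - A)(1 - R)`. It satisfies `φ ∘ R = A ∘ φ` where `R` is idempotent, and its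
  -- derivative at `u₀` is `A² + (1 - A)² = 1`, so that the inverse function theorem applies.
  let φ : X → X := fun u => A (R u) + ((u - R u) - A (u - R u))
  have hφ : ContDiffOn ℝ ∞ φ O := by
    have h1 : ContDiffOn ℝ ∞ (fun u => u - R u) O := contDiffOn_id.sub hR
    exact (A.contDiff.comp_contDiffOn hR).add (h1.sub (A.contDiff.comp_contDiffOn h1))
  have hφd : HasFDerivAt φ ((ContinuousLinearEquiv.refl ℝ X : X ≃L[ℝ] X) : X →L[ℝ] X) u₀ := by
    have h1 := (hasFDerivAt_id u₀).sub hRd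
    have h2 := (A.hasFDerivAt.comp u₀ hRd).add (h1.sub (A.hasFDerivAt.comp u₀ h1))
    refine h2.congr_fderiv ?_
    ext v
    simp [hA]
  have hφu := hφ.contDiffAt (hO.mem_nhds h₀)
  let e₀ := hφu.toOpenPartialHomeomorph φ hφd (by simp)
  have he₀ : ∀ u, e₀ u = φ u := fun u => rfl
  have hu₀ : u₀ ∈ e₀.source := hφu.mem_toOpenPartialHomeomorph_source hφd (by simp)
  have hcont : ContinuousOn (fderiv ℝ φ) O := hφ.continuousOn_fderiv_of_isOpen hO (by simp)
  -- The inverse function theorem gives smoothness of the inverse at one point only. Restricting to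
  -- points where the derivative of `φ` is invertible gives it on the whole target.
  set S : Set X := O ∩ fderiv ℝ φ ⁻¹' {L | IsUnit L} with hS
  have hSo : IsOpen S := hcont.isOpen_inter_preimage hO Units.isOpen
  have hS₀ : u₀ ∈ S := by
    refine ⟨h₀, ?_⟩
    rw [mem_preimage, hφd.fderiv]
    exact isUnit_one
  let e := e₀.restrOpen S hSo
  refine ⟨A, e, hA, ⟨hu₀, hS₀⟩, fun u hu => hu.2.1, ?_, fun u => rfl⟩
  intro v hv
  have hs := e.map_target hv
  obtain ⟨U, hU⟩ := hs.2.2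
  have hd : HasFDerivAt φ (fderiv ℝ φ (e.symm v)) (e.symm v) :=
    ((hφ.contDiffAt (hO.mem_nhds hs.2.1)).differentiableAt (by simp)).hasFDerivAt
  rw [← hU] at hd
  exact (e.contDiffAt_symm (f₀' := ContinuousLinearEquiv.unitsEquiv ℝ X U) hv hd
    (hφ.contDiffAt (hO.mem_nhds hs.2.1))).contDiffWithinAt

/-! ### Uniform limits of differentiable functions on convex sets -/

/-- The mean value inequality applied to `f m - f n` on the convex set bounds its increments by a
small multiple of `‖y - x‖`, uniformly in `m`; let `m` tend to infinity. Convexity replaces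
openness, so the result also serves at boundary points of `D`. -/
theorem Convex.hasFDerivWithinAt_of_tendstoUniformlyOn {X Y : Type*} [NormedAddCommGroup X]
    [NormedSpace ℝ X] [NormedAddCommGroup Y] [NormedSpace ℝ Y] {C : Set X} (hC : Convex ℝ C)
    {f : ℕ → X → Y} {f' : ℕ → X → X →L[ℝ] Y} {g : X → Y} {g' : X → X →L[ℝ] Y}
    (hf : ∀ n, ∀ x ∈ C, HasFDerivWithinAt (f n) (f' n x) C x)
    (hfg : ∀ x ∈ C, Tendsto (fun n => f n x) atTop (𝓝 (g x)))
    (hfg' : TendstoUniformlyOn f' g' atTop C) {x : X} (hx : x ∈ C) :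
    HasFDerivWithinAt g (g' x) C x := by
  rw [hasFDerivWithinAt_iff_isLittleO, Asymptotics.isLittleO_iff]
  intro ε hε
  -- With `ε / 6`, the derivatives of two members of the tail differ by at most `ε / 3`; the
  -- increments, the remainder of `f n` and the error of its derivative then contribute at most `ε /
  -- 3` each.
  obtain ⟨n, hn⟩ := eventually_atTop.1 (Metric.tendstoUniformlyOn_iff.1 hfg' (ε / 6) (by positivity))
  have h1 : ∀ y ∈ C, ‖(g y - g x) - (f n y - f n x)‖ ≤ ε / 3 * ‖y - x‖ := by
    intro y hy
    have hlim : Tendsto (fun m => ‖(f m y - f m x) - (f n y - f n x)‖) atTop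
        (𝓝 ‖(g y - g x) - (f n y - f n x)‖) :=
      ((((hfg y hy).sub (hfg x hx)).sub_const _)).norm
    refine le_of_tendsto hlim (eventually_atTop.2 ⟨n, fun m hm => ?_⟩)
    have := hC.norm_image_sub_le_of_norm_hasFDerivWithin_le (f := fun z => f m z - f n z)
      (f' := fun z => f' m z - f' n z) (C := ε / 3) (x := x) (y := y)
      (fun z hz => (hf m z hz).sub (hf n z hz)) (fun z hz => ?_) hx hy
    · refine le_trans (le_of_eq ?_) this
      congr 1
      abel
    · have a1 := hn m hm z hz
      have a2 := hn n le_rfl z hz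
      rw [← dist_eq_norm]
      have a3 := dist_triangle_left (f' m z) (f' n z) (g' z)
      linarith
  have h2 := (Asymptotics.isLittleO_iff.1 (hasFDerivWithinAt_iff_isLittleO.1 (hf n x hx)))
    (show 0 < ε / 3 by positivity)
  filter_upwards [h2, self_mem_nhdsWithin] with y hy hyC
  have h3 : ‖(f' n x - g' x) (y - x)‖ ≤ ε / 3 * ‖y - x‖ := by
    refine (ContinuousLinearMap.le_opNorm _ _).trans ?_
    gcongr
    have := hn n le_rfl x hx
    rw [dist_comm, dist_eq_norm] at this
    linarith
  have e : g y - g x - g' x (y - x) = ((g y - g x) - (f n y - f n x)) +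
      (f n y - f n x - f' n x (y - x)) + (f' n x - g' x) (y - x) := by
    simp only [sub_apply]
    abel
  rw [e]
  refine (norm_add₃_le).trans ?_
  have := h1 y hyC
  linarith

/-! ### The Banach space `C^k(D, W)` -/

section CkSpace

universe uD

/-- A map of class `C^k`, as an element of `C^k(D, N)`. -/
def CkMap.mk {ED : Type*} [NormedAddCommGroup ED] [NormedSpace ℝ ED]
    {HD : Type*} [TopologicalSpace HD] {I : ModelWithCorners ℝ ED HD}
    {EN : Type*} [NormedAddCommGroup EN] [NormedSpace ℝ EN]
    {HN : Type*} [TopologicalSpace HN] {J : ModelWithCorners ℝ EN HN}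
    {D : Type*} [TopologicalSpace D] [ChartedSpace HD D]
    {N : Type*} [TopologicalSpace N] [ChartedSpace HN N] {k : ℕ} (f : D → N)
    (hf : ContMDiff I J k f) : CkMap I J D N k := ⟨f, hf⟩

variable {ED : Type*} [NormedAddCommGroup ED] [NormedSpace ℝ ED] [FiniteDimensional ℝ ED]
  {HD : Type*} [TopologicalSpace HD] {I : ModelWithCorners ℝ ED HD}
  {D : Type uD} [TopologicalSpace D] [ChartedSpace HD D] [CompactSpace D]
  [IsManifold I ∞ D] {k : ℕ} {W : Type*} [NormedAddCommGroup W] [NormedSpace ℝ W]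

variable (I D k W) in
/-- The isometric embedding of `C^k(D, W)` into the space of jets. -/
def ckJetIsometry : CkMap I 𝓘(ℝ, W) D W k →ₗᵢ[ℝ]
    (∀ (x : coverIndex I D) (l : Fin (k + 1)), C(coverSet I D x.1, ED [×(l : ℕ)]→L[ℝ] W)) where
  toLinearMap := ckJet I D k W
  norm_map' _ := rfl

theorem ckJetIsometry_apply (f : CkMap I 𝓘(ℝ, W) D W k) (x : coverIndex I D) (l : Fin (k + 1))
    (y : coverSet I D x.1) : ckJetIsometry I D k W f x l y =
      iteratedFDerivWithin ℝ l (fun z => f ((extChartAt I x.1).symm z))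
        (extChartAt I x.1).target (extChartAt I x.1 y.1) := rfl

theorem norm_ckJetIsometry_apply_le (f : CkMap I 𝓘(ℝ, W) D W k) (x : coverIndex I D)
    (l : Fin (k + 1)) : ‖ckJetIsometry I D k W f x l‖ ≤ ‖f‖ := by
  rw [← (ckJetIsometry I D k W).norm_map f]
  exact (norm_le_pi_norm _ l).trans (norm_le_pi_norm (ckJetIsometry I D k W f) x)

theorem CkMap.norm_apply_le (f : CkMap I 𝓘(ℝ, W) D W k) (p : D) : ‖f p‖ ≤ ‖f‖ := by
  obtain ⟨x, hx, hp⟩ := exists_mem_coverSet I D p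
  have h1 := (ContinuousMap.norm_coe_le_norm (ckJetIsometry I D k W f ⟨x, hx⟩ 0) ⟨p, hp⟩).trans
    (norm_ckJetIsometry_apply_le f _ _)
  rw [ckJetIsometry_apply] at h1
  have h2 := (extChartAt I x).left_inv (coverSet_subset I D x hp)
  have h3 := norm_iteratedFDerivWithin_zero (𝕜 := ℝ) (f := fun z => f ((extChartAt I x).symm z))
    (s := (extChartAt I x).target) (x := extChartAt I x p)
  rw [h2] at h3
  exact h3.symm.le.trans h1

variable (I k W) in
/-- Evaluation at a point, as a continuous linear map. -/
def ckEval (p : D) : CkMap I 𝓘(ℝ, W) D W k →L[ℝ] W :=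
  LinearMap.mkContinuous
    { toFun := fun f => f p
      map_add' := fun _ _ => rfl
      map_smul' := fun _ _ => rfl } 1 fun f => by
    rw [one_mul]
    exact CkMap.norm_apply_le f p

theorem exists_mem_interior_coverSet (y : D) :
    ∃ x ∈ coverIndex I D, y ∈ interior (coverSet I D x) :=
  (exists_chartCover I D).choose_spec.2 y

variable (T : ∀ (x : coverIndex I D) (l : Fin (k + 1)), C(coverSet I D x.1, ED [×(l : ℕ)]→L[ℝ] W))
  (F : ℕ → CkMap I 𝓘(ℝ, W) D W k) (f : D → W)

/-- The derivatives of `F n` in the chart converge uniformly on the cover set, so their limits form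
a Taylor series of the pointwise limit. Interior points are needed because the argument takes place
on a relative neighbourhood that stays in the cover set. -/
theorem contDiffWithinAt_of_tendsto_ckJet
    (hT : Tendsto (fun n => ckJetIsometry I D k W (F n)) atTop (𝓝 T))
    (hf : ∀ p, Tendsto (fun n => F n p) atTop (𝓝 (f p))) (x : coverIndex I D) {p : D}
    (hp : p ∈ interior (coverSet I D x.1)) :
    ContDiffWithinAt ℝ k (fun z => f ((extChartAt I x.1).symm z)) (range I)
      (extChartAt I x.1 p) ∧
    ∀ l : Fin (k + 1), iteratedFDerivWithin ℝ l (fun z => f ((extChartAt I x.1).symm z))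
      (extChartAt I x.1).target (extChartAt I x.1 p) = T x l ⟨p, interior_subset hp⟩ := by
  classical
  set φ := extChartAt I x.1
  have hpK : p ∈ coverSet I D x.1 := interior_subset hp
  have hps : p ∈ φ.source := coverSet_subset I D x.1 hpK
  have hnear : ∀ᶠ z in 𝓝[range I] (φ p), z ∈ φ.target ∧ φ.symm z ∈ coverSet I D x.1 := by
    refine Eventually.and (extChartAt_target_mem_nhdsWithin_of_mem (φ.map_source hps)) ?_
    have hc := (continuousAt_extChartAt_symm'' (φ.map_source hps)).continuousWithinAt
      (s := range I)
    refine hc.eventually ?_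
    rw [φ.left_inv hps]
    exact mem_interior_iff_mem_nhds.1 hp
  obtain ⟨r, hr, hball⟩ := Metric.mem_nhdsWithin_iff.1 hnear
  -- The range of a model with corners is convex, so cutting a small ball with it gives a convex
  -- relative neighbourhood, also at the boundary.
  set C := Metric.ball (φ p) r ∩ range I with hCdef
  have hCt : ∀ z ∈ C, z ∈ φ.target := fun z hz => (hball hz).1
  have hCK : ∀ z ∈ C, φ.symm z ∈ coverSet I D x.1 := fun z hz => (hball hz).2
  have hCc : Convex ℝ C := (convex_ball _ _).inter I.convex_range
  have hCu : UniqueDiffOn ℝ C := by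
    rw [hCdef, inter_comm]
    exact I.uniqueDiffOn.inter Metric.isOpen_ball
  have hpC : φ p ∈ C := ⟨Metric.mem_ball_self hr, extChartAt_target_subset_range x.1 (φ.map_source hps)⟩
  have hCnear : ∀ z ∈ C, C =ᶠ[𝓝 z] φ.target := by
    intro z hz
    have h1 : C =ᶠ[𝓝 z] range I := by
      filter_upwards [Metric.isOpen_ball.mem_nhds hz.1] with w hw
      exact propext ⟨fun h => h.2, fun h => ⟨hw, h⟩⟩
    exact h1.trans ((extChartAt_target_eventuallyEq_of_mem (hCt z hz))).symm
  let G : ℕ → ED → W := fun n z => F n (φ.symm z)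
  let g : ED → W := fun z => f (φ.symm z)
  have hG : ∀ n, ContDiffOn ℝ k (G n) φ.target := fun n => contDiffOn_coord I D k W (F n).contMDiff x.1
  -- The candidate Taylor series: the limit jets, read in the chart. The value `0` for orders above
  -- `k` or points outside `C` plays no role.
  let q : ED → FormalMultilinearSeries ℝ ED W := fun z l =>
    if h : l < k + 1 ∧ z ∈ C then T x ⟨l, h.1⟩ ⟨φ.symm z, hCK z h.2⟩ else 0
  have hq : ∀ (l : ℕ) (hl : l < k + 1) z (hz : z ∈ C),
      q z l = T x ⟨l, hl⟩ ⟨φ.symm z, hCK z hz⟩ := fun l hl z hz => dif_pos ⟨hl, hz⟩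
  have hGT : ∀ n (l : ℕ) (hl : l < k + 1) z (hz : z ∈ C),
      iteratedFDerivWithin ℝ l (G n) φ.target z =
        ckJetIsometry I D k W (F n) x ⟨l, hl⟩ ⟨φ.symm z, hCK z hz⟩ := by
    intro n l hl z hz
    rw [ckJetIsometry_apply]
    simp only [G]
    rw [φ.right_inv (hCt z hz)]
  have hunif : ∀ l : ℕ, l < k + 1 → TendstoUniformlyOn
      (fun n z => iteratedFDerivWithin ℝ l (G n) φ.target z) (fun z => q z l) atTop C := by
    intro l hl
    rw [Metric.tendstoUniformlyOn_iff]
    intro ε hε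
    filter_upwards [Metric.tendsto_nhds.1 hT ε hε] with n hn z hz
    rw [hq l hl z hz, hGT n l hl z hz, dist_comm]
    refine (ContinuousMap.dist_apply_le_dist _).trans_lt (lt_of_le_of_lt ?_ hn)
    exact (dist_le_pi_dist _ _ _).trans
      (dist_le_pi_dist (ckJetIsometry I D k W (F n)) T x)
  have hcont : ∀ n (l : ℕ), l < k + 1 →
      ContinuousOn (fun z => iteratedFDerivWithin ℝ l (G n) φ.target z) C := by
    intro n l hl
    exact ((hG n).continuousOn_iteratedFDerivWithin (by exact_mod_cast Nat.lt_succ_iff.1 hl)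
      (uniqueDiffOn_extChartAt_target x.1)).mono hCt
  have hser : HasFTaylorSeriesUpToOn k g q C := by
    refine ⟨fun z hz => ?_, fun l hl z hz => ?_, fun l hl => ?_⟩
    · have h1 : Tendsto (fun n => (iteratedFDerivWithin ℝ 0 (G n) φ.target z).curry0) atTop
          (𝓝 (q z 0).curry0) := by
        have := (hunif 0 (Nat.succ_pos k)).tendsto_at hz
        exact ((ContinuousMultilinearMap.apply ℝ (fun _ : Fin 0 => ED) W 0).continuous.tendsto _).comp
          this
      exact tendsto_nhds_unique h1 (hf _)
    · have hl' : l < k := by exact_mod_cast hl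
      refine hCc.hasFDerivWithinAt_of_tendstoUniformlyOn
        (f := fun n z => iteratedFDerivWithin ℝ l (G n) φ.target z)
        (f' := fun n z => (iteratedFDerivWithin ℝ (l + 1) (G n) φ.target z).curryLeft)
        (g' := fun z => (q z (l + 1)).curryLeft) ?_ ?_ ?_ hz
      · intro n w hw
        exact (((hG n).ftaylorSeriesWithin (uniqueDiffOn_extChartAt_target x.1)).fderivWithin
          l (by exact_mod_cast hl') w (hCt w hw)).mono hCt
      · exact fun w hw => (hunif l (by omega)).tendsto_at hw
      · have := hunif (l + 1) (by omega)
        rw [Metric.tendstoUniformlyOn_iff] at this ⊢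
        intro ε hε
        filter_upwards [this ε hε] with n hn w hw
        have h1 := hn w hw
        rw [dist_eq_norm] at h1 ⊢
        have : (q w (l + 1)).curryLeft - (iteratedFDerivWithin ℝ (l + 1) (G n) φ.target w).curryLeft
            = (q w (l + 1) - iteratedFDerivWithin ℝ (l + 1) (G n) φ.target w).curryLeft := rfl
        rw [this, ContinuousMultilinearMap.curryLeft_norm]
        exact h1
    · have hl' : l < k + 1 := Nat.lt_succ_iff.2 (by exact_mod_cast hl)
      exact (hunif l hl').continuousOn (Frequently.of_forall fun n => hcont n l hl')
  have hCD : ContDiffOn ℝ k g C := by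
    exact_mod_cast hser.contDiffOn (n := (k : ℕ∞))
  refine ⟨(hCD _ hpC).congr_set ((hCnear _ hpC).trans
    (extChartAt_target_eventuallyEq_of_mem (φ.map_source hps))), fun l => ?_⟩
  have h1 := hser.eq_iteratedFDerivWithin_of_uniqueDiffOn (m := l)
    (by exact_mod_cast Nat.lt_succ_iff.1 l.2) hCu hpC
  have h2 := iteratedFDerivWithin_congr_set (𝕜 := ℝ) (f := g) (hCnear _ hpC) l
  rw [← h2, ← h1, hq l l.2 _ hpC]
  congr 2
  exact φ.left_inv hps

theorem contMDiff_of_tendsto_ckJet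
    (hT : Tendsto (fun n => ckJetIsometry I D k W (F n)) atTop (𝓝 T))
    (hf : ∀ p, Tendsto (fun n => F n p) atTop (𝓝 (f p))) : ContMDiff I 𝓘(ℝ, W) k f := by
  have : IsManifold I (k : WithTop ℕ∞) D := IsManifold.of_le (n := ∞) (by exact_mod_cast le_top)
  intro p
  obtain ⟨x, hx, hp⟩ := exists_mem_interior_coverSet (I := I) p
  have hs := coverSet_subset I D x (interior_subset hp)
  rw [extChartAt_source] at hs
  rw [contMDiffAt_iff_source_of_mem_source hs, contMDiffWithinAt_iff_contDiffWithinAt]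
  exact (contDiffWithinAt_of_tendsto_ckJet T F f hT hf ⟨x, hx⟩ hp).1

/-- A cover set may contain boundary points of itself, where the previous convergence result says
nothing. Such a point is interior to another cover set, and Faà di Bruno's formula for the change of
charts expresses the jet in the first chart continuously in terms of the jet in the second. -/
theorem ckJet_eq_of_tendsto
    (hT : Tendsto (fun n => ckJetIsometry I D k W (F n)) atTop (𝓝 T))
    (hf : ∀ p, Tendsto (fun n => F n p) atTop (𝓝 (f p))) (hfs : ContMDiff I 𝓘(ℝ, W) k f) :
    ckJetIsometry I D k W (CkMap.mk f hfs) = T := by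
  have : IsManifold I (k : WithTop ℕ∞) D := IsManifold.of_le (n := ∞) (by exact_mod_cast le_top)
  funext x l
  ext1 ⟨p, hpx⟩
  obtain ⟨x', hx', hp⟩ := exists_mem_interior_coverSet (I := I) p
  set φ := extChartAt I x.1
  set ψ := extChartAt I x'
  have hps : p ∈ φ.source := coverSet_subset I D x.1 hpx
  have hps' : p ∈ ψ.source := coverSet_subset I D x' (interior_subset hp)
  set z := φ p
  have hz : z ∈ φ.target := φ.map_source hps
  have hl : ((l : ℕ) : WithTop ℕ∞) ≤ k := by exact_mod_cast Nat.lt_succ_iff.1 l.2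
  let τ : ED → ED := fun w => ψ (φ.symm w)
  have hτz : τ z = ψ p := by simp only [τ, z]; rw [φ.left_inv hps]
  have hsrc : ∀ᶠ w in 𝓝 z, φ.symm w ∈ ψ.source := by
    have hc := continuousAt_extChartAt_symm'' hz
    refine hc.eventually ?_
    rw [φ.left_inv hps]
    exact extChartAt_source_mem_nhds' hps'
  have hτ : ContDiffWithinAt ℝ k τ φ.target z := by
    refine (contDiffWithinAt_ext_coord_change (I := I) x' x.1 ?_).mono
      (extChartAt_target_subset_range x.1)
    rw [PartialEquiv.trans_source, PartialEquiv.symm_source]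
    exact ⟨hz, by rw [mem_preimage, φ.left_inv hps]; exact hps'⟩
  have key : ∀ h : D → W, ContMDiff I 𝓘(ℝ, W) k h →
      iteratedFDerivWithin ℝ l (fun w => h (φ.symm w)) φ.target z =
        ∑ c : OrderedFinpartition l, c.compAlongOrderedFinpartition
          (iteratedFDerivWithin ℝ c.length (fun w => h (ψ.symm w)) ψ.target (ψ p))
          (fun m => iteratedFDerivWithin ℝ (c.partSize m) τ φ.target z) := by
    intro h hh
    have heq : (fun w => h (φ.symm w)) =ᶠ[𝓝[φ.target] z] (fun w => h (ψ.symm w)) ∘ τ := by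
      filter_upwards [hsrc.filter_mono nhdsWithin_le_nhds] with w hw
      simp only [Function.comp, τ]
      rw [ψ.left_inv hw]
    rw [heq.iteratedFDerivWithin_eq (heq.self_of_nhdsWithin hz)]
    have hg := contDiffOn_coord I D k W hh x' (ψ p) (ψ.map_source hps')
    rw [iteratedFDerivWithin_comp_of_eventually_mem (by rw [hτz]; exact hg) hτ
      (uniqueDiffOn_extChartAt_target x') (uniqueDiffOn_extChartAt_target x.1) hz ?_ hl]
    · rw [hτz]
      rfl
    · filter_upwards [hsrc.filter_mono nhdsWithin_le_nhds] with w hw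
      exact ψ.map_source hw
  have hlim1 : Tendsto (fun n => ckJetIsometry I D k W (F n) x l ⟨p, hpx⟩) atTop
      (𝓝 (T x l ⟨p, hpx⟩)) := by
    have h1 := (tendsto_pi_nhds.1 (tendsto_pi_nhds.1 hT x) l)
    exact ((ContinuousEvalConst.continuous_eval_const (⟨p, hpx⟩ : coverSet I D x.1)).tendsto _).comp h1
  refine tendsto_nhds_unique ?_ hlim1
  simp only [ckJetIsometry_apply]
  change Tendsto (fun n => iteratedFDerivWithin ℝ l (fun w => F n (φ.symm w)) φ.target z) atTop
    (𝓝 (iteratedFDerivWithin ℝ l (fun w => f (φ.symm w)) φ.target z))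
  rw [key f hfs]
  simp only [fun n => key (F n) (F n).contMDiff]
  refine tendsto_finsetSum _ fun c _ => ?_
  have hcl : c.length < k + 1 := lt_of_le_of_lt c.length_le l.2
  have h2 : Tendsto (fun n => iteratedFDerivWithin ℝ c.length (fun w => F n (ψ.symm w)) ψ.target
      (ψ p)) atTop (𝓝 (iteratedFDerivWithin ℝ c.length (fun w => f (ψ.symm w)) ψ.target
      (ψ p))) := by
    have h3 := (contDiffWithinAt_of_tendsto_ckJet T F f hT hf ⟨x', hx'⟩ hp).2 ⟨c.length, hcl⟩
    have h4 := (tendsto_pi_nhds.1 (tendsto_pi_nhds.1 hT ⟨x', hx'⟩) ⟨c.length, hcl⟩)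
    rw [h3]
    exact ((ContinuousEvalConst.continuous_eval_const
      (⟨p, interior_subset hp⟩ : coverSet I D x')).tendsto _).comp h4
  have h5 := (((c.compAlongOrderedFinpartitionL ℝ ED ED W).flipMultilinear
    (fun m => iteratedFDerivWithin ℝ (c.partSize m) τ φ.target z)).continuous.tendsto _).comp h2
  exact h5

/-- Jets of a Cauchy sequence converge uniformly, and the limit is the jet of the pointwise limit.
Completeness is what permits the inverse function theorem and the descent of smoothness along the
jet embedding. -/
instance ckCompleteSpace [CompleteSpace W] : CompleteSpace (CkMap I 𝓘(ℝ, W) D W k) := by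
  refine Metric.complete_of_cauchySeq_tendsto fun F hF => ?_
  have h1 : CauchySeq fun n => ckJetIsometry I D k W (F n) :=
    hF.map (ckJetIsometry I D k W).isometry.uniformContinuous
  obtain ⟨T, hT⟩ := cauchySeq_tendsto_of_complete h1
  have h2 : ∀ p, ∃ w, Tendsto (fun n => F n p) atTop (𝓝 w) := fun p =>
    cauchySeq_tendsto_of_complete (hF.map (ckEval I k W p).uniformContinuous)
  choose f hf using h2
  have hfs := contMDiff_of_tendsto_ckJet T F f hT hf
  refine ⟨CkMap.mk f hfs, ?_⟩
  rw [(ckJetIsometry I D k W).isometry.isUniformInducing.isInducing.tendsto_nhds_iff,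
    ckJet_eq_of_tendsto T F f hT hf hfs]
  exact hT

/-! ### Left-composition with smooth maps between normed spaces -/

open Classical in
/-- The left-composition `u ↦ φ ∘ u` (zero if `φ ∘ u` is not of class `C^k`). -/
def ckComp {V W : Type*} [NormedAddCommGroup V] [NormedSpace ℝ V] [NormedAddCommGroup W]
    [NormedSpace ℝ W] (φ : V → W) (u : CkMap I 𝓘(ℝ, V) D V k) : CkMap I 𝓘(ℝ, W) D W k :=
  if h : ContMDiff I 𝓘(ℝ, W) k (φ ∘ u) then CkMap.mk (φ ∘ u) h else 0

variable {V : Type*} [NormedAddCommGroup V] [NormedSpace ℝ V]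

theorem contMDiff_comp_of_contDiffOn {φ : V → W} {O : Set V} (hO : IsOpen O)
    (hφ : ContDiffOn ℝ ∞ φ O) {u : CkMap I 𝓘(ℝ, V) D V k} (hu : ∀ p, u p ∈ O) :
    ContMDiff I 𝓘(ℝ, W) k (φ ∘ u) := fun p =>
  ((hφ.contDiffAt (hO.mem_nhds (hu p))).of_le (by exact_mod_cast le_top)).contMDiffAt.comp p
    (u.contMDiff p)

theorem ckComp_apply {φ : V → W} {O : Set V} (hO : IsOpen O)
    (hφ : ContDiffOn ℝ ∞ φ O) {u : CkMap I 𝓘(ℝ, V) D V k} (hu : ∀ p, u p ∈ O) (p : D) :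
    ckComp φ u p = φ (u p) := by
  rw [ckComp, dif_pos (contMDiff_comp_of_contDiffOn hO hφ hu)]
  rfl

theorem isOpen_ck_forall_mem {O : Set V} (hO : IsOpen O) :
    IsOpen {u : CkMap I 𝓘(ℝ, V) D V k | ∀ p, u p ∈ O} := by
  rw [Metric.isOpen_iff]
  intro u hu
  have hcpt : IsCompact (range u) := isCompact_range u.contMDiff.continuous
  obtain ⟨δ, hδ, h1⟩ := hcpt.exists_thickening_subset_open hO
    (by rintro _ ⟨y, rfl⟩; exact hu y)
  refine ⟨δ, hδ, fun v hv p => h1 (Metric.mem_thickening_iff.2 ⟨u p, mem_range_self p, ?_⟩)⟩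
  rw [dist_eq_norm]
  refine (CkMap.norm_apply_le (v - u) p).trans_lt ?_
  rwa [← dist_eq_norm]

end CkSpace

/-! ### Smoothness of left-composition by Faà di Bruno's formula -/

section CkSuperposition

universe uE uD v

variable {ED : Type uE} [NormedAddCommGroup ED] [NormedSpace ℝ ED] [FiniteDimensional ℝ ED]
  {HD : Type*} [TopologicalSpace HD] {I : ModelWithCorners ℝ ED HD}
  {D : Type uD} [TopologicalSpace D] [ChartedSpace HD D] [CompactSpace D]
  [IsManifold I ∞ D] {k : ℕ}
  {V : Type v} [NormedAddCommGroup V] [NormedSpace ℝ V]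

variable (I D k V) in
/-- The jets of order `k` in a chart, as a linear map. -/
def ckJetAtLinear (x : coverIndex I D) : CkMap I 𝓘(ℝ, V) D V k →ₗ[ℝ]
    C(coverSet I D x.1, ∀ j : Fin (k + 1), ED [×(j : ℕ)]→L[ℝ] V) where
  toFun f := ContinuousMap.pi fun j => ckJetIsometry I D k V f x j
  map_add' f g := by
    ext1 y
    funext j
    simp [ContinuousMap.pi]
  map_smul' r f := by
    ext1 y
    funext j
    simp [ContinuousMap.pi]

variable (I D k V) in
/-- The jets of order `k` in a chart, as a continuous linear map. -/
def ckJetAt (x : coverIndex I D) : CkMap I 𝓘(ℝ, V) D V k →L[ℝ]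
    C(coverSet I D x.1, ∀ j : Fin (k + 1), ED [×(j : ℕ)]→L[ℝ] V) :=
  (ckJetAtLinear I D k V x).mkContinuous 1 fun f => by
    rw [one_mul]
    refine (ContinuousMap.norm_le _ (norm_nonneg f)).2 fun y => ?_
    refine (pi_norm_le_iff_of_nonneg (norm_nonneg f)).2 fun j => ?_
    exact (ContinuousMap.norm_coe_le_norm (ckJetIsometry I D k V f x j) y).trans
      (norm_ckJetIsometry_apply_le f x j)

theorem ckJetAt_apply (x : coverIndex I D) (f : CkMap I 𝓘(ℝ, V) D V k) (y : coverSet I D x.1)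
    (j : Fin (k + 1)) : ckJetAt I D k V x f y j =
      iteratedFDerivWithin ℝ j (fun z => f ((extChartAt I x.1).symm z))
        (extChartAt I x.1).target (extChartAt I x.1 y.1) := rfl

/-- The derivative of order `l` of `φ ∘ u`, in terms of the jet of `u` (Faà di Bruno). -/
def jetComp {W : Type*} [NormedAddCommGroup W] [NormedSpace ℝ W] (φ : V → W) (O : Set V)
    (l : Fin (k + 1)) (ξ : ∀ j : Fin (k + 1), ED [×(j : ℕ)]→L[ℝ] V) : ED [×(l : ℕ)]→L[ℝ] W :=
  ∑ c : OrderedFinpartition l, c.compAlongOrderedFinpartition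
    (iteratedFDerivWithin ℝ c.length φ O (ξ 0 0))
    (fun m => ξ ⟨c.partSize m, lt_of_le_of_lt (c.partSize_le m) l.2⟩)

/-- Each term is linear in a derivative of `φ` at the zeroth component of the jet and multilinear in
the other components. Flipping the composition map separates these two dependences, each of which is
smooth. -/
theorem contDiffOn_jetComp {W : Type*} [NormedAddCommGroup W] [NormedSpace ℝ W] {φ : V → W}
    {O : Set V} (hO : IsOpen O) (hφ : ContDiffOn ℝ ∞ φ O) (l : Fin (k + 1)) :
    ContDiffOn ℝ ∞ (jetComp (ED := ED) φ O l) {ξ | ξ 0 0 ∈ O} := by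
  unfold jetComp
  refine ContDiffOn.sum fun c _ => ?_
  have h0 : ContDiff ℝ ∞ fun ξ : ∀ j : Fin (k + 1), ED [×(j : ℕ)]→L[ℝ] V => ξ 0 0 := by
    have h1 : ContDiff ℝ ∞ fun ξ : ∀ j : Fin (k + 1), ED [×(j : ℕ)]→L[ℝ] V => ξ 0 :=
      (ContinuousLinearMap.proj (R := ℝ) (φ := fun j : Fin (k + 1) => ED [×(j : ℕ)]→L[ℝ] V) 0).contDiff
    exact (ContinuousMultilinearMap.apply ℝ (fun _ : Fin ((0 : Fin (k + 1)) : ℕ) => ED) V 0).contDiff.comp h1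
  have h1 : ContDiffOn ℝ ∞ (fun v => iteratedFDerivWithin ℝ c.length φ O v) O := fun v hv =>
    (hφ v hv).iteratedFDerivWithin_right hO.uniqueDiffOn (by exact_mod_cast le_top) hv
  have h2 : ContDiffOn ℝ ∞ (fun ξ : ∀ j : Fin (k + 1), ED [×(j : ℕ)]→L[ℝ] V =>
      iteratedFDerivWithin ℝ c.length φ O (ξ 0 0)) {ξ | ξ 0 0 ∈ O} :=
    h1.comp h0.contDiffOn fun ξ hξ => hξ
  have h3 : ContDiff ℝ ∞ fun ξ : ∀ j : Fin (k + 1), ED [×(j : ℕ)]→L[ℝ] V =>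
      (c.compAlongOrderedFinpartitionL ℝ ED V W).flipMultilinear
        (fun m => ξ ⟨c.partSize m, lt_of_le_of_lt (c.partSize_le m) l.2⟩) :=
    (ContinuousMultilinearMap.contDiff _).comp
      (contDiff_pi.2 fun m => (ContinuousLinearMap.proj (R := ℝ) (φ := fun j : Fin (k + 1) => ED [×(j : ℕ)]→L[ℝ] V) _).contDiff)
  exact h3.contDiffOn.clm_apply h2

/-- This exhibits left-composition on `C^k(D, V)` as a superposition operator on continuous jets,
with no further derivatives of `u` involved. -/
theorem ckJetIsometry_ckComp {W : Type*} [NormedAddCommGroup W] [NormedSpace ℝ W] {φ : V → W}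
    {O : Set V} (hO : IsOpen O) (hφ : ContDiffOn ℝ ∞ φ O) {u : CkMap I 𝓘(ℝ, V) D V k}
    (hu : ∀ p, u p ∈ O) (x : coverIndex I D) (l : Fin (k + 1)) :
    ckJetIsometry I D k W (ckComp φ u) x l =
      ContinuousMap.superpose (jetComp φ O l) (ckJetAt I D k V x u) := by
  ext1 y
  have hmem : ∀ y, ckJetAt I D k V x u y ∈
      {ξ : ∀ j : Fin (k + 1), ED [×(j : ℕ)]→L[ℝ] V | ξ 0 0 ∈ O} := by
    intro y
    have : ckJetAt I D k V x u y 0 0 = u y.1 := by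
      rw [ckJetAt_apply]
      exact congrArg u ((extChartAt I x.1).left_inv (coverSet_subset I D x y.2))
    rw [mem_ofPred_eq, this]
    exact hu y.1
  rw [ContinuousMap.superpose_apply (contDiffOn_jetComp hO hφ l).continuousOn hmem,
    ckJetIsometry_apply]
  have hy := (extChartAt I x.1).map_source (coverSet_subset I D x.1 y.2)
  have hl : ((l : ℕ) : WithTop ℕ∞) ≤ k := by exact_mod_cast Nat.lt_succ_iff.1 l.2
  have hcomp : (fun z => ckComp φ u ((extChartAt I x.1).symm z)) =
      φ ∘ fun z => u ((extChartAt I x.1).symm z) := by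
    funext z
    exact ckComp_apply hO hφ hu _
  rw [hcomp, iteratedFDerivWithin_comp (n := (k : WithTop ℕ∞)) (t := O)
    (f := fun z => u ((extChartAt I x.1).symm z))
    ((hφ _ (hu _)).of_le (by exact_mod_cast le_top))
    (contDiffOn_coord I D k V u.contMDiff x.1 _ hy) hO.uniqueDiffOn
    (uniqueDiffOn_extChartAt_target x.1) hy (fun z _ => hu _) hl]
  rfl

/-- Left-composition with a smooth map is smooth. -/
theorem contDiffOn_ckComp {W : Type v} [NormedAddCommGroup W] [NormedSpace ℝ W] [CompleteSpace W]
    {φ : V → W} {O : Set V} (hO : IsOpen O) (hφ : ContDiffOn ℝ ∞ φ O) :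
    ContDiffOn ℝ ∞ (ckComp (I := I) (D := D) (k := k) φ) {u | ∀ p, u p ∈ O} := by
  -- Smoothness is tested on jets, in a larger space that also involves the universe of `ED`; the
  -- universe levels are given since they cannot be inferred from `max`.
  refine LinearIsometry.contDiffOn_of_comp.{max uD v, max uD v, max uD uE v}
    (ckJetIsometry I D k W) (isOpen_ck_forall_mem hO) ?_
  refine contDiffOn_pi.2 fun x => contDiffOn_pi.2 fun l => ?_
  have hOξ : IsOpen {ξ : ∀ j : Fin (k + 1), ED [×(j : ℕ)]→L[ℝ] V | ξ 0 0 ∈ O} := by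
    have h1 : Continuous fun ξ : ∀ j : Fin (k + 1), ED [×(j : ℕ)]→L[ℝ] V => ξ 0 0 :=
      (ContinuousMultilinearMap.apply ℝ (fun _ : Fin ((0 : Fin (k + 1)) : ℕ) => ED) V 0).continuous.comp
        (continuous_apply 0)
    exact hO.preimage h1
  have h1 := (ContinuousMap.contDiffOn_superpose (K := coverSet I D x.1) hOξ
    (contDiffOn_jetComp (ED := ED) hO hφ l)).comp (ckJetAt I D k V x).contDiff.contDiffOn
      (s := {u | ∀ p, u p ∈ O}) (fun u hu y => by
        have : ckJetAt I D k V x u y 0 0 = u y.1 := by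
          rw [ckJetAt_apply]
          exact congrArg u ((extChartAt I x.1).left_inv (coverSet_subset I D x y.2))
        rw [mem_ofPred_eq, this]
        exact hu y.1)
  exact h1.congr fun u hu => ckJetIsometry_ckComp hO hφ hu x l

end CkSuperposition

/-! ### Smooth left inverses of embeddings near compact sets -/

section Retraction

variable {EN : Type*} [NormedAddCommGroup EN] [NormedSpace ℝ EN]
  {HN : Type*} [TopologicalSpace HN] (J : ModelWithCorners ℝ EN HN)
  {N : Type*} [TopologicalSpace N] [ChartedSpace HN N]
  {Y : Type*} [NormedAddCommGroup Y] [NormedSpace ℝ Y]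

/-- The map `r` is smooth on the open set `Ω`, and a left inverse of `h` there. -/
structure IsSmoothLeftInverse (h : N → Y) (r : Y → N) (Ω : Set Y) : Prop where
  isOpen : IsOpen Ω
  contMDiffOn : ContMDiffOn 𝓘(ℝ, Y) J ∞ r Ω
  left_inv : ∀ x, h x ∈ Ω → r (h x) = x

variable {J}

/-- Two left inverses are interpolated in the coordinates of one chart by a cutoff function `χ`. At
a point `h x` both equal `x`, so every interpolation there equals `x` too and the result is still a
left inverse. -/
theorem IsSmoothLeftInverse.glue [FiniteDimensional ℝ Y] [IsManifold J ∞ N] [J.Boundaryless]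
    {h : N → Y} {r s : Y → N} {Ω O : Set Y}
    (hr : IsSmoothLeftInverse J h r Ω) (hs : IsSmoothLeftInverse J h s O) (c : N)
    (hc : MapsTo s O (chartAt HN c).source) {L : Set Y} (hL : IsCompact L) (hLΩ : L ⊆ Ω) :
    ∃ (r' : Y → N) (Ω' : Set Y), IsSmoothLeftInverse J h r' Ω' ∧ L ⊆ Ω' ∧
      ∀ x, h x ∈ O → h x ∈ Ω' := by
  classical
  -- The cutoff `χ` is `1` near `L` and `0` off `t`. Three open sets arise: `A`, where `χ = 1` and
  -- `r` is kept; `B`, off `t`, where `s` is kept; and `C`, where both are defined and the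
  -- interpolation stays in the range of the chart.
  obtain ⟨t, ht, hLt, htΩ⟩ := exists_compact_between hL hr.isOpen hLΩ
  obtain ⟨χ, hχ1, hχ0, -⟩ := exists_contMDiffMap_one_nhds_of_subset_interior 𝓘(ℝ, Y) (n := (⊤ : ℕ∞))
    hL.isClosed hLt
  set φ := extChartAt J c with hφ
  have hcs : MapsTo s O φ.source := fun y hy => by rw [hφ, extChartAt_source]; exact hc hy
  have hχs : ContMDiff 𝓘(ℝ, Y) 𝓘(ℝ, ℝ) ∞ χ := χ.contMDiff
  let comb : Y → EN := fun y => χ y • φ (r y) + (1 - χ y) • φ (s y)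
  let A : Set Y := interior {y | y ∈ Ω ∧ χ y = 1}
  let S : Set Y := O ∩ (Ω ∩ r ⁻¹' φ.source)
  have hS : IsOpen S := hs.isOpen.inter
    (hr.contMDiffOn.continuousOn.isOpen_inter_preimage hr.isOpen (isOpen_extChartAt_source c))
  have hφs : ContMDiffOn J 𝓘(ℝ, EN) ∞ φ φ.source := by
    rw [hφ, extChartAt_source]
    exact contMDiffOn_extChartAt
  have hcomb : ContMDiffOn 𝓘(ℝ, Y) 𝓘(ℝ, EN) ∞ comb S := by
    have h1 : ContMDiffOn 𝓘(ℝ, Y) 𝓘(ℝ, EN) ∞ (fun y => φ (r y)) S :=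
      hφs.comp (hr.contMDiffOn.mono fun y hy => hy.2.1) fun y hy => hy.2.2
    have h2 : ContMDiffOn 𝓘(ℝ, Y) 𝓘(ℝ, EN) ∞ (fun y => φ (s y)) S :=
      hφs.comp (hs.contMDiffOn.mono fun y hy => hy.1) fun y hy => hcs hy.1
    exact (hχs.contMDiffOn.smul h1).add ((contMDiffOn_const.sub hχs.contMDiffOn).smul h2)
  let C : Set Y := S ∩ comb ⁻¹' φ.target
  have hC : IsOpen C := hcomb.continuousOn.isOpen_inter_preimage hS (isOpen_extChartAt_target c)
  let B : Set Y := O \ t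
  have hB : IsOpen B := hs.isOpen.sdiff ht.isClosed
  have hA : IsOpen A := isOpen_interior
  have hAΩ : ∀ y ∈ A, y ∈ Ω ∧ χ y = 1 := fun y hy =>
    interior_subset (s := {y | y ∈ Ω ∧ χ y = 1}) hy
  have hB0 : ∀ y ∈ B, χ y = 0 := fun y hy => hχ0 y hy.2
  let r' : Y → N := fun y => if y ∈ A then r y else φ.symm (comb y)
  have hr'A : ∀ y ∈ A, r' y = r y := fun y hy => if_pos hy
  have hr'C : ∀ y ∈ C, r' y = φ.symm (comb y) := by
    intro y hy
    by_cases hyA : y ∈ A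
    · rw [hr'A y hyA]
      simp only [comb]
      rw [(hAΩ y hyA).2]
      simp [φ.left_inv hy.1.2.2]
    · exact if_neg hyA
  have hr'B : ∀ y ∈ B, r' y = s y := by
    intro y hy
    have hyA : y ∉ A := fun h1 => by
      have := (hAΩ y h1).2
      rw [hB0 y hy] at this
      exact zero_ne_one this
    have : r' y = φ.symm (comb y) := if_neg hyA
    rw [this]
    simp only [comb]
    rw [hB0 y hy]
    simp [φ.left_inv (hcs hy.1)]
  have hleftC : ∀ x, h x ∈ S → comb (h x) = φ x := by
    intro x hx
    simp only [comb]
    rw [hr.left_inv x hx.2.1, hs.left_inv x hx.1, ← add_smul]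
    simp
  refine ⟨r', A ∪ C ∪ B, ⟨(hA.union hC).union hB, ?_, ?_⟩, ?_, ?_⟩
  · rintro y ((hy | hy) | hy)
    · exact (((hr.contMDiffOn y (hAΩ y hy).1).contMDiffAt
        (hr.isOpen.mem_nhds (hAΩ y hy).1)).congr_of_eventuallyEq
        (eventually_of_mem (hA.mem_nhds hy) hr'A)).contMDiffWithinAt
    · have h1 : ContMDiffOn 𝓘(ℝ, Y) J ∞ (fun y => φ.symm (comb y)) C :=
        (contMDiffOn_extChartAt_symm c).comp (hcomb.mono inter_subset_left) fun y hy => hy.2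
      exact ((h1 y hy).contMDiffAt (hC.mem_nhds hy)).congr_of_eventuallyEq
        (eventually_of_mem (hC.mem_nhds hy) hr'C) |>.contMDiffWithinAt
    · exact (((hs.contMDiffOn y hy.1).contMDiffAt
        (hs.isOpen.mem_nhds hy.1)).congr_of_eventuallyEq
        (eventually_of_mem (hB.mem_nhds hy) hr'B)).contMDiffWithinAt
  · rintro x ((hx | hx) | hx)
    · rw [hr'A _ hx, hr.left_inv x (hAΩ _ hx).1]
    · rw [hr'C _ hx, hleftC x hx.1]
      refine φ.left_inv ?_
      have := hx.1.2.2
      rwa [mem_preimage, hr.left_inv x hx.1.2.1] at this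
    · rw [hr'B _ hx, hs.left_inv x hx.1]
  · intro y hy
    refine Or.inl (Or.inl (mem_interior_iff_mem_nhds.2 ?_))
    filter_upwards [hr.isOpen.mem_nhds (hLΩ hy), hχ1.filter_mono (nhds_le_nhdsSet hy)] with z h1 h2
    exact ⟨h1, h2⟩
  · intro x hx
    -- If `h x` lies in `t ⊆ Ω`, both left inverses send it to `x`, so the interpolation is the
    -- coordinate of `x` and `h x` is in `C`. Otherwise `h x` is in `B`.
    by_cases hxt : h x ∈ t
    · have hxΩ := htΩ hxt
      have hxs : x ∈ φ.source := by
        have := hcs hx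
        rwa [hs.left_inv x hx] at this
      have hxS : h x ∈ S := ⟨hx, hxΩ, by rwa [mem_preimage, hr.left_inv x hxΩ]⟩
      refine Or.inl (Or.inr ⟨hxS, ?_⟩)
      rw [mem_preimage, hleftC x hxS]
      exact φ.map_source hxs
    · exact Or.inr ⟨hx, hxt⟩

variable (J) in
/-- A smooth map into a Euclidean space that has a smooth left inverse near the image of a given
compact set. -/
theorem exists_isSmoothLeftInverse [FiniteDimensional ℝ EN] [IsManifold J ∞ N] [J.Boundaryless]
    [T2Space N] [Nonempty N] {K : Set N} (hK : IsCompact K) :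
    ∃ (m : ℕ) (h : C^∞⟮J, N; 𝓘(ℝ, EuclideanSpace ℝ (Fin m)), EuclideanSpace ℝ (Fin m)⟯)
      (r : EuclideanSpace ℝ (Fin m) → N) (Ω : Set (EuclideanSpace ℝ (Fin m))),
      IsSmoothLeftInverse J h r Ω ∧ ∀ x ∈ K, h x ∈ Ω := by
  classical
  let ρ : ∀ c : N, SmoothBumpFunction J c := fun c => Classical.choice inferInstance
  have hρc : ∀ c, Continuous (ρ c) := fun c => (ρ c).contMDiff.continuous
  obtain ⟨t, ht⟩ := hK.elim_nhds_subcover (fun c => {x | 1 / 2 < ρ c x}) (fun c _ => by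
    refine (isOpen_lt continuous_const (hρc c)).mem_nhds ?_
    rw [mem_ofPred_eq, (ρ c).eq_one]
    norm_num)
  -- Coordinates multiplied by a bump function extend smoothly by zero; recording the bump function
  -- as well allows division by it, which yields a left inverse `s i` where the bump function is
  -- positive.
  let h₀ : N → (t → EN × ℝ) := fun x i => (ρ i x • extChartAt J i.1 x, ρ i x)
  have hh₀ : ContMDiff J 𝓘(ℝ, t → EN × ℝ) ∞ h₀ := by
    refine contMDiff_pi_space.2 fun i => ?_
    refine ContMDiff.prodMk_space ?_ (ρ i).contMDiff
    exact (ρ i.1).contMDiff_smul (contMDiffOn_extChartAt)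
  let e : (t → EN × ℝ) ≃L[ℝ] EuclideanSpace ℝ (Fin (Module.finrank ℝ (t → EN × ℝ))) := toEuclidean
  let O : t → Set (t → EN × ℝ) := fun i =>
    {y | 0 < (y i).2} ∩ (fun y => (y i).2⁻¹ • (y i).1) ⁻¹' (extChartAt J i.1).target
  let s : t → (t → EN × ℝ) → N := fun i y => (extChartAt J i.1).symm ((y i).2⁻¹ • (y i).1)
  have hq : ∀ i : t, ContDiffOn ℝ ∞ (fun y : t → EN × ℝ => (y i).2⁻¹ • (y i).1) {y | 0 < (y i).2} := by
    intro i
    have h1 : ContDiff ℝ ∞ fun y : t → EN × ℝ => y i := contDiff_apply ℝ _ i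
    refine ContDiffOn.smul (h1.snd.contDiffOn.inv fun y hy => ne_of_gt hy) h1.fst.contDiffOn
  have hs : ∀ i, IsSmoothLeftInverse J h₀ (s i) (O i) := by
    intro i
    refine ⟨?_, ?_, ?_⟩
    · refine (hq i).continuousOn.isOpen_inter_preimage ?_ (isOpen_extChartAt_target i.1)
      exact isOpen_lt continuous_const (continuous_snd.comp (continuous_apply i))
    · exact (contMDiffOn_extChartAt_symm i.1).comp
        ((hq i).contMDiffOn.mono inter_subset_left) fun y hy => hy.2
    · intro x hx
      have hpos : 0 < ρ i.1 x := hx.1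
      have hx' : x ∈ (extChartAt J i.1).source := by
        rw [extChartAt_source]
        exact (ρ i.1).support_subset_source (ne_of_gt hpos)
      simp only [s, h₀]
      rw [inv_smul_smul₀ hpos.ne', (extChartAt J i.1).left_inv hx']
  have hO : ∀ (i : t) x, 1 / 2 ≤ ρ i.1 x → h₀ x ∈ O i := by
    intro i x hx
    have hpos : 0 < ρ i.1 x := lt_of_lt_of_le (by norm_num) hx
    refine ⟨hpos, ?_⟩
    have hx' : x ∈ (extChartAt J i.1).source := by
      rw [extChartAt_source]
      exact (ρ i.1).support_subset_source (ne_of_gt hpos)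
    simp only [h₀, mem_preimage]
    rw [inv_smul_smul₀ hpos.ne']
    exact (extChartAt J i.1).map_source hx'
  -- Charts are added one at a time. The strict inequality `1 / 2 < ρ` gives the open cover of `K`,
  -- whereas `1 / 2 ≤ ρ` makes the part already treated compact, as the gluing requires.
  have key : ∀ T : Finset t, ∃ (r : (t → EN × ℝ) → N) (Ω : Set (t → EN × ℝ)),
      IsSmoothLeftInverse J h₀ r Ω ∧ ∀ x ∈ K, (∃ i ∈ T, 1 / 2 ≤ ρ i.1 x) → h₀ x ∈ Ω := by
    intro T
    induction T using Finset.induction_on with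
    | empty =>
      exact ⟨fun _ => Classical.arbitrary N, ∅, ⟨isOpen_empty, contMDiffOn_const, by simp⟩, by simp⟩
    | insert i T _ ih =>
      obtain ⟨r, Ω, hr, hΩ⟩ := ih
      have hLc : IsCompact (K ∩ ⋃ j ∈ T, {x | 1 / 2 ≤ ρ j.1 x}) :=
        hK.inter_right (T.finite_toSet.isClosed_biUnion fun j _ =>
          isClosed_le continuous_const (hρc j))
      have hmem : ∀ x ∈ K, (∃ i ∈ T, 1 / 2 ≤ ρ i.1 x) →
          x ∈ K ∩ ⋃ j ∈ T, {x | 1 / 2 ≤ ρ j.1 x} := by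
        rintro x hx ⟨j, hj, hjx⟩
        exact ⟨hx, mem_iUnion₂.2 ⟨j, hj, hjx⟩⟩
      obtain ⟨r', Ω', hr', hL', hO'⟩ := hr.glue (hs i) i.1
        (fun y hy => by
          rw [← extChartAt_source J]
          exact (extChartAt J i.1).map_target hy.2)
        (hLc.image hh₀.continuous) (by
          rintro _ ⟨x, ⟨hxK, hx⟩, rfl⟩
          obtain ⟨j, hj, hjx⟩ := mem_iUnion₂.1 hx
          exact hΩ x hxK ⟨j, hj, hjx⟩)
      refine ⟨r', Ω', hr', ?_⟩
      rintro x hx ⟨j, hj, hjx⟩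
      rcases Finset.mem_insert.1 hj with rfl | hj
      · exact hO' x (hO _ x hjx)
      · exact hL' ⟨x, hmem x hx ⟨j, hj, hjx⟩, rfl⟩
  obtain ⟨r, Ω, hr, hΩ⟩ := key Finset.univ
  refine ⟨_, ⟨fun x => e (h₀ x), e.contDiff.contMDiff.comp hh₀⟩, fun y => r (e.symm y),
    e.symm ⁻¹' Ω, ⟨hr.isOpen.preimage e.symm.continuous,
      hr.contMDiffOn.comp e.symm.contDiff.contMDiff.contMDiffOn fun y hy => hy, ?_⟩, ?_⟩
  · intro x hx
    have hx' : e.symm (e (h₀ x)) ∈ Ω := hx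
    rw [e.symm_apply_apply] at hx'
    change r (e.symm (e (h₀ x))) = x
    rw [e.symm_apply_apply, hr.left_inv x hx']
  · intro x hx
    change e.symm (e (h₀ x)) ∈ Ω
    rw [e.symm_apply_apply]
    obtain ⟨i, hi, hix⟩ := mem_iUnion₂.1 (ht.2 hx)
    exact hΩ x hx ⟨⟨i, hi⟩, Finset.mem_univ _, le_of_lt hix⟩

end Retraction

/-! ### Independence of the charts -/

namespace BanachAtlas

variable {X : Type u} {Y : Type u'} {A : BanachAtlas.{u, w} X} {B : BanachAtlas.{u', w} Y}

theorem eventually_symm_mem_source {c c' : BanachChart.{u, w} X} (hc : c ∈ A.charts)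
    (hc' : c' ∈ A.charts) {x : X} (hx : x ∈ c.toEquiv.source) (hx' : x ∈ c'.toEquiv.source) :
    ∀ᶠ v in 𝓝 (c.toEquiv x), c.toEquiv.symm v ∈ c'.toEquiv.source :=
  (A.compat c hc c' hc' x hx hx').1

theorem contDiffAt_transition {c c' : BanachChart.{u, w} X} (hc : c ∈ A.charts)
    (hc' : c' ∈ A.charts) {x : X} (hx : x ∈ c.toEquiv.source) (hx' : x ∈ c'.toEquiv.source) :
    ContDiffAt ℝ ∞ (fun v => c'.toEquiv (c.toEquiv.symm v)) (c.toEquiv x) :=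
  (A.compat c hc c' hc' x hx hx').2

/-- Smoothness is defined by the existence of a pair of charts; smooth transition maps carry it to
every pair. -/
theorem SmoothAt.contDiffAt {f : X → Y} {x : X} (hf : A.SmoothAt B f x) {c : BanachChart.{u, w} X}
    {c' : BanachChart.{u', w} Y} (hc : c ∈ A.charts) (hc' : c' ∈ B.charts)
    (hx : x ∈ c.toEquiv.source) (hx' : f x ∈ c'.toEquiv.source) :
    (∀ᶠ v in 𝓝 (c.toEquiv x), f (c.toEquiv.symm v) ∈ c'.toEquiv.source) ∧
      ContDiffAt ℝ ∞ (fun v => c'.toEquiv (f (c.toEquiv.symm v))) (c.toEquiv x) := by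
  obtain ⟨a, ha, a', ha', hxa, hxa', hev, hd⟩ := hf
  have h1 := eventually_symm_mem_source hc ha hx hxa
  have h2 := contDiffAt_transition hc ha hx hxa
  have e0 : a.toEquiv (c.toEquiv.symm (c.toEquiv x)) = a.toEquiv x := by
    rw [c.toEquiv.left_inv hx]
  have h3 := contDiffAt_transition ha' hc' hxa' hx'
  have h4 := eventually_symm_mem_source ha' hc' hxa' hx'
  have t2 : Tendsto (fun v => a.toEquiv (c.toEquiv.symm v)) (𝓝 (c.toEquiv x))
      (𝓝 (a.toEquiv x)) := by
    have := h2.continuousAt.tendsto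
    rwa [e0] at this
  have td : Tendsto (fun v => a'.toEquiv (f (a.toEquiv.symm v))) (𝓝 (a.toEquiv x))
      (𝓝 (a'.toEquiv (f x))) := by
    have := hd.continuousAt.tendsto
    rwa [a.toEquiv.left_inv hxa] at this
  have hev' := t2.eventually (hev.and (td.eventually h4))
  constructor
  · filter_upwards [h1, hev'] with v hv hv'
    have h5 := hv'.2
    rw [a.toEquiv.left_inv hv] at h5 hv'
    rwa [a'.toEquiv.left_inv hv'.1] at h5
  · have hd' : ContDiffAt ℝ ∞ (fun v => a'.toEquiv (f (a.toEquiv.symm v)))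
        (a.toEquiv (c.toEquiv.symm (c.toEquiv x))) := by rwa [e0]
    have h3' : ContDiffAt ℝ ∞ (fun v => c'.toEquiv (a'.toEquiv.symm v))
        (a'.toEquiv (f (a.toEquiv.symm (a.toEquiv (c.toEquiv.symm (c.toEquiv x)))))) := by
      rwa [e0, a.toEquiv.left_inv hxa]
    have := ContDiffAt.comp (c.toEquiv x) h3' (ContDiffAt.comp (c.toEquiv x) hd' h2)
    refine this.congr_of_eventuallyEq ?_
    filter_upwards [h1, hev'] with v hv hv'
    simp only [Function.comp]
    rw [a.toEquiv.left_inv hv] at hv' ⊢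
    rw [a'.toEquiv.left_inv hv'.1]

theorem mem_charts_ofSpace (V : Type w) [NormedAddCommGroup V] [NormedSpace ℝ V]
    [CompleteSpace V] : (⟨V, PartialEquiv.refl V, isOpen_univ⟩ : BanachChart V) ∈
      (ofSpace V).charts := rfl

theorem mem_charts_prod {c : BanachChart.{u, w} X} {c' : BanachChart.{u', w} Y}
    (hc : c ∈ A.charts) (hc' : c' ∈ B.charts) :
    (⟨c.V × c'.V, c.toEquiv.prod c'.toEquiv, c.open_target.prod c'.open_target⟩ :
      BanachChart (X × Y)) ∈ (A.prod B).charts := ⟨c, hc, c', hc', rfl⟩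

theorem coord_of_mem {c : BanachChart.{u, w} X} (hc : c ∈ A.charts) {x : X}
    (hx : x ∈ c.toEquiv.source) (η : A.TangentSp x) : A.coord c ⟨x, η⟩ = η.1 ⟨c, hc, hx⟩ :=
  dif_pos ⟨hc, hx⟩

theorem ofCoord_of_mem {c : BanachChart.{u, w} X} (hc : c ∈ A.charts) {z : c.V × c.V}
    (hz : z.1 ∈ c.toEquiv.target) : A.ofCoord c z =
      ⟨c.toEquiv.symm z.1, A.mkTangent ⟨c, hc, c.toEquiv.map_target hz⟩ z.2⟩ := by
  unfold ofCoord
  rw [dif_pos ⟨hc, c.toEquiv.map_target hz⟩]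

theorem mkTangent_add {x : X} (c : A.ChartAt x) (v v' : c.1.V) :
    A.mkTangent c (v + v') = A.mkTangent c v + A.mkTangent c v' := by
  apply Subtype.ext
  funext c'
  exact map_add _ v v'

theorem mkTangent_smul {x : X} (c : A.ChartAt x) (r : ℝ) (v : c.1.V) :
    A.mkTangent c (r • v) = r • A.mkTangent c v := by
  apply Subtype.ext
  funext c'
  exact map_smul _ r v

theorem tangentSp_ext {x : X} (c : A.ChartAt x) {η η' : A.TangentSp x} (h : η.1 c = η'.1 c) :
    η = η' := by
  rw [← A.mkTangent_coord c η, ← A.mkTangent_coord c η', h]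

theorem tangentMap_apply {f : X → Y} {x : X} (hf : A.SmoothAt B f x) (c : A.ChartAt x)
    (c' : B.ChartAt (f x)) (η : A.TangentSp x) :
    (A.tangentMap B f x η).1 c' =
      fderiv ℝ (fun v => c'.1.toEquiv (f (c.1.toEquiv.symm v))) (c.1.toEquiv x) (η.1 c) := by
  have h : Nonempty (A.ChartAt x) ∧ Nonempty (B.ChartAt (f x)) := ⟨⟨c⟩, ⟨c'⟩⟩
  unfold tangentMap
  rw [dif_pos h, mkTangent_apply]
  set a := h.1.some
  set a' := h.2.some
  obtain ⟨hev, hd⟩ := hf.contDiffAt a.2.1 a'.2.1 a.2.2 a'.2.2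
  have h1 := eventually_symm_mem_source c.2.1 a.2.1 c.2.2 a.2.2
  have h2 := ((contDiffAt_transition c.2.1 a.2.1 c.2.2 a.2.2).differentiableAt
    (by simp)).hasFDerivAt
  have h3 := ((contDiffAt_transition a'.2.1 c'.2.1 a'.2.2 c'.2.2).differentiableAt
    (by simp)).hasFDerivAt
  have hd' := (hd.differentiableAt (by simp)).hasFDerivAt
  have e0 : a.1.toEquiv (c.1.toEquiv.symm (c.1.toEquiv x)) = a.1.toEquiv x := by
    rw [c.1.toEquiv.left_inv c.2.2]
  have e1 : a'.1.toEquiv (f (a.1.toEquiv.symm (a.1.toEquiv x))) = a'.1.toEquiv (f x) := by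
    rw [a.1.toEquiv.left_inv a.2.2]
  have g1 := HasFDerivAt.comp (f := fun v => a.1.toEquiv (c.1.toEquiv.symm v))
    (g := fun v => a'.1.toEquiv (f (a.1.toEquiv.symm v))) (c.1.toEquiv x) (e0.symm ▸ hd') h2
  have g2 := HasFDerivAt.comp
    (f := (fun v => a'.1.toEquiv (f (a.1.toEquiv.symm v))) ∘
      fun v => a.1.toEquiv (c.1.toEquiv.symm v))
    (g := fun v => c'.1.toEquiv (a'.1.toEquiv.symm v)) (c.1.toEquiv x) (by
      simp only [Function.comp]
      rw [e0, e1]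
      exact h3) g1
  have t2 : Tendsto (fun v => a.1.toEquiv (c.1.toEquiv.symm v)) (𝓝 (c.1.toEquiv x))
      (𝓝 (a.1.toEquiv x)) := by
    have := h2.continuousAt.tendsto
    rwa [e0] at this
  have heq : (fun v => c'.1.toEquiv (f (c.1.toEquiv.symm v))) =ᶠ[𝓝 (c.1.toEquiv x)]
      (fun v => c'.1.toEquiv (a'.1.toEquiv.symm v)) ∘
        ((fun v => a'.1.toEquiv (f (a.1.toEquiv.symm v))) ∘
          fun v => a.1.toEquiv (c.1.toEquiv.symm v)) := by
    filter_upwards [h1, t2.eventually hev] with v hv hv'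
    simp only [Function.comp]
    rw [a.1.toEquiv.left_inv hv] at hv' ⊢
    rw [a'.1.toEquiv.left_inv hv']
  rw [(g2.congr_of_eventuallyEq heq).fderiv, ← η.2 c a]
  simp only [ContinuousLinearMap.comp_apply, e0]

section IntoManifold

variable {EN : Type*} [NormedAddCommGroup EN] [NormedSpace ℝ EN] {HN : Type*} [TopologicalSpace HN]
  {J : ModelWithCorners ℝ EN HN} {N : Type*} [TopologicalSpace N] [ChartedSpace HN N]

theorem SmoothInto.contMDiffAt {f : X → N} (hf : A.SmoothInto J f) {c : BanachChart.{u, w} X}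
    (hc : c ∈ A.charts) {x : X} (hx : x ∈ c.toEquiv.source) :
    ContMDiffAt 𝓘(ℝ, c.V) J ∞ (fun v => f (c.toEquiv.symm v)) (c.toEquiv x) := by
  obtain ⟨a, ha, hxa, hd⟩ := hf x
  have h1 := eventually_symm_mem_source hc ha hx hxa
  have h2 := contDiffAt_transition hc ha hx hxa
  have e0 : a.toEquiv (c.toEquiv.symm (c.toEquiv x)) = a.toEquiv x := by
    rw [c.toEquiv.left_inv hx]
  have := ContMDiffAt.comp (g := fun v => f (a.toEquiv.symm v)) (c.toEquiv x)
    (e0.symm ▸ hd) h2.contMDiffAt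
  refine this.congr_of_eventuallyEq ?_
  filter_upwards [h1] with v hv
  simp only [Function.comp]
  rw [a.toEquiv.left_inv hv]

/-- The chain rule with the transition map from the arbitrarily chosen chart, together with the
compatibility of the components of `η`, removes the choice made in `mderiv`. -/
theorem mderiv_apply_of_mdifferentiableAt {f : X → N} {x : X} (c : A.ChartAt x)
    (hf : MDifferentiableAt 𝓘(ℝ, c.1.V) J (fun v => f (c.1.toEquiv.symm v)) (c.1.toEquiv x))
    (η : A.TangentSp x) : A.mderiv J f x η =
      (mfderiv 𝓘(ℝ, c.1.V) J (fun v => f (c.1.toEquiv.symm v)) (c.1.toEquiv x) (η.1 c) : EN) := by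
  have h : Nonempty (A.ChartAt x) := ⟨c⟩
  refine (dif_pos h).trans ?_
  set a := h.some
  have h1 := eventually_symm_mem_source a.2.1 c.2.1 a.2.2 c.2.2
  have h2 := (contDiffAt_transition a.2.1 c.2.1 a.2.2 c.2.2).differentiableAt (by simp)
  have e0 : c.1.toEquiv (a.1.toEquiv.symm (a.1.toEquiv x)) = c.1.toEquiv x := by
    rw [a.1.toEquiv.left_inv a.2.2]
  have heq : (fun v => f (a.1.toEquiv.symm v)) =ᶠ[𝓝 (a.1.toEquiv x)]
      (fun v => f (c.1.toEquiv.symm v)) ∘ fun v => c.1.toEquiv (a.1.toEquiv.symm v) := by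
    filter_upwards [h1] with v hv
    simp only [Function.comp]
    rw [c.1.toEquiv.left_inv hv]
  have hd : MDifferentiableAt 𝓘(ℝ, c.1.V) J (fun v => f (c.1.toEquiv.symm v))
      ((fun v => c.1.toEquiv (a.1.toEquiv.symm v)) (a.1.toEquiv x)) := by
    simp only [e0]
    exact hf
  have hk := (hd.hasMFDerivAt.comp (a.1.toEquiv x) h2.mdifferentiableAt.hasMFDerivAt)
  have hk' := (hk.congr_of_eventuallyEq heq).mfderiv
  have key : ∀ y, y = c.1.toEquiv x → ∀ v : c.1.V,
      (mfderiv 𝓘(ℝ, c.1.V) J (fun v => f (c.1.toEquiv.symm v)) y v : EN) =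
        (mfderiv 𝓘(ℝ, c.1.V) J (fun v => f (c.1.toEquiv.symm v)) (c.1.toEquiv x) v : EN) := by
    rintro _ rfl v
    rfl
  rw [hk', ← η.2 a c]
  refine Eq.trans ?_ (key _ e0 _)
  rw [mfderiv_eq_fderiv]
  rfl

theorem mderiv_apply {f : X → N} (hf : A.SmoothInto J f) {x : X} (c : A.ChartAt x)
    (η : A.TangentSp x) : A.mderiv J f x η =
      (mfderiv 𝓘(ℝ, c.1.V) J (fun v => f (c.1.toEquiv.symm v)) (c.1.toEquiv x) (η.1 c) : EN) :=
  mderiv_apply_of_mdifferentiableAt c ((hf.contMDiffAt c.2.1 c.2.2).mdifferentiableAt (by simp)) η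

end IntoManifold

end BanachAtlas

/-! ### The Banach manifold `C^k(D, N)` -/

section CkManifold

universe uD uN

local notation "𝔼" m:max => EuclideanSpace ℝ (Fin m)

variable {ED : Type*} [NormedAddCommGroup ED] [NormedSpace ℝ ED] [FiniteDimensional ℝ ED]
  {HD : Type*} [TopologicalSpace HD] {I : ModelWithCorners ℝ ED HD}
  {D : Type uD} [TopologicalSpace D] [ChartedSpace HD D] [CompactSpace D]
  [IsManifold I ∞ D] {k : ℕ}
  {EN : Type*} [NormedAddCommGroup EN] [NormedSpace ℝ EN]
  {HN : Type*} [TopologicalSpace HN] {J : ModelWithCorners ℝ EN HN}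
  {N : Type uN} [TopologicalSpace N] [ChartedSpace HN N]

@[simp]
theorem leftComp_apply {W : Type*} [NormedAddCommGroup W] [NormedSpace ℝ W]
    (h : C^∞⟮J, N; 𝓘(ℝ, W), W⟯) (g : CkMap I J D N k) (p : D) :
    leftComp I J h g p = h (g p) := rfl

/-- The maps `r ∘ u`, as elements of `C^k(D, N)` (and some `g` if `r ∘ u` is not of class
`C^k`). -/
def ckLift {Y : Type*} [NormedAddCommGroup Y] [NormedSpace ℝ Y] (r : Y → N)
    (g : CkMap I J D N k) (u : CkMap I 𝓘(ℝ, Y) D Y k) : CkMap I J D N k :=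
  open Classical in if h : ContMDiff I J k (r ∘ u) then CkMap.mk (r ∘ u) h else g

theorem ckLift_apply {Y : Type*} [NormedAddCommGroup Y] [NormedSpace ℝ Y] {h : N → Y} {r : Y → N}
    {Ω : Set Y} (hr : IsSmoothLeftInverse J h r Ω) (g : CkMap I J D N k)
    {u : CkMap I 𝓘(ℝ, Y) D Y k} (hu : ∀ p, u p ∈ Ω) (p : D) : ckLift r g u p = r (u p) := by
  have h : ContMDiff I J k (r ∘ u) := fun p =>
    (((hr.contMDiffOn _ (hu p)).contMDiffAt (hr.isOpen.mem_nhds (hu p))).of_le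
      (by exact_mod_cast le_top)).comp p (u.contMDiff p)
  rw [ckLift, dif_pos h]
  rfl

theorem contDiffOn_leftComp_ckLift {Y W : Type} [NormedAddCommGroup Y] [NormedSpace ℝ Y]
    [NormedAddCommGroup W] [NormedSpace ℝ W] [CompleteSpace W] {h : N → Y} {r : Y → N}
    {Ω : Set Y} (hr : IsSmoothLeftInverse J h r Ω) (g : CkMap I J D N k)
    (h' : C^∞⟮J, N; 𝓘(ℝ, W), W⟯) :
    ContDiffOn ℝ ∞ (fun u : CkMap I 𝓘(ℝ, Y) D Y k => leftComp I J h' (ckLift r g u))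
      {u | ∀ p, u p ∈ Ω} := by
  have h1 : ContDiffOn ℝ ∞ (h' ∘ r) Ω :=
    (h'.contMDiff.comp_contMDiffOn hr.contMDiffOn).contDiffOn
  refine (contDiffOn_ckComp hr.isOpen h1).congr fun u hu => ?_
  ext p
  rw [leftComp_apply, ckLift_apply hr g hu, ckComp_apply hr.isOpen h1 hu]
  rfl

/-- Near each of its points, `C^k(D, N)` is a smooth retract of an open subset of some
`C^k(D, ℝ^m)`. -/
theorem exists_smooth_retraction [FiniteDimensional ℝ EN] [IsManifold J ∞ N] [J.Boundaryless]
    [T2Space N] (f : CkMap I J D N k) :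
    ∃ (m : ℕ) (h : C^∞⟮J, N; 𝓘(ℝ, 𝔼 m), 𝔼 m⟯) (O : Set (CkMap I 𝓘(ℝ, 𝔼 m) D (𝔼 m) k))
      (ρ : CkMap I 𝓘(ℝ, 𝔼 m) D (𝔼 m) k → CkMap I J D N k),
      IsOpen O ∧ leftComp I J h f ∈ O ∧ (∀ g, leftComp I J h g ∈ O → ρ (leftComp I J h g) = g) ∧
      ∀ (m' : ℕ) (h' : C^∞⟮J, N; 𝓘(ℝ, 𝔼 m'), 𝔼 m'⟯),
        ContDiffOn ℝ ∞ (fun u => leftComp I J h' (ρ u)) O := by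
  -- If `D` is empty there is a single map, while `N` may be empty and then offers no default value
  -- for a left inverse.
  rcases isEmpty_or_nonempty D with hD | ⟨⟨p⟩⟩
  · refine ⟨0, ⟨fun _ => 0, contMDiff_const⟩, univ, fun _ => f, isOpen_univ, mem_univ _,
      fun g _ => ?_, fun m' h' => contDiffOn_const⟩
    ext p
    exact hD.elim p
  · have : Nonempty N := ⟨f p⟩
    obtain ⟨m, h, r, Ω, hr, hΩ⟩ :=
      exists_isSmoothLeftInverse J (isCompact_range f.contMDiff.continuous)
    refine ⟨m, h, {u | ∀ p, u p ∈ Ω}, ckLift r f, isOpen_ck_forall_mem hr.isOpen,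
      fun p => hΩ _ (mem_range_self p), fun g hg => ?_,
      fun m' h' => contDiffOn_leftComp_ckLift hr f h'⟩
    ext p
    rw [ckLift_apply hr f hg]
    exact hr.left_inv _ (hg p)

/-- The idempotent `R = h_* ∘ ρ` is linearized near `h_* f`: in the new coordinates its fixed points
near there form an open part of the fixed space `V` of `A`. On fixed points the linearizing map is
`A`, so the chart is `g ↦ A (h_* g)`, the restriction of a bounded linear map. -/
theorem exists_isCkChart [FiniteDimensional ℝ EN] [IsManifold J ∞ N] [J.Boundaryless]
    [T2Space N] (f : CkMap I J D N k) :
    ∃ c : BanachChart.{max uD uN, uD} (CkMap I J D N k), IsCkChart I J c ∧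
      f ∈ c.toEquiv.source := by
  obtain ⟨m, h, O, ρ, hO, hfO, hρ, hsm⟩ := exists_smooth_retraction (I := I) (J := J) f
  set R : CkMap I 𝓘(ℝ, 𝔼 m) D (𝔼 m) k → CkMap I 𝓘(ℝ, 𝔼 m) D (𝔼 m) k :=
    fun u => leftComp I J h (ρ u) with hR
  have hRs : ContDiffOn ℝ ∞ R O := hsm m h
  have hO' : IsOpen (O ∩ R ⁻¹' O) := hRs.continuousOn.isOpen_inter_preimage hO hO
  have hRR : ∀ u, R u ∈ O → R (R u) = R u := fun u hu => congrArg (leftComp I J h) (hρ _ hu)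
  have hfR : R (leftComp I J h f) = leftComp I J h f := congrArg (leftComp I J h) (hρ f hfO)
  obtain ⟨A, e, hA, hfe, heO, hes, he⟩ := exists_linearization_of_idempotent (R := R) hO'
    (hRs.mono inter_subset_left) (fun u hu => hRR u hu.2)
    (u₀ := leftComp I J h f) ⟨hfO, by rw [mem_preimage, hfR]; exact hfO⟩ hfR
  let V : Submodule ℝ (CkMap I 𝓘(ℝ, 𝔼 m) D (𝔼 m) k) :=
    LinearMap.ker (A - ContinuousLinearMap.id ℝ _ :
      CkMap I 𝓘(ℝ, 𝔼 m) D (𝔼 m) k →L[ℝ] CkMap I 𝓘(ℝ, 𝔼 m) D (𝔼 m) k).toLinearMap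
  have hV : ∀ u, u ∈ V ↔ A u = u := by
    intro u
    simp only [V, LinearMap.mem_ker, ContinuousLinearMap.coe_coe, sub_apply,
      ContinuousLinearMap.id_apply, sub_eq_zero]
  have hVc : IsClosed (V : Set (CkMap I 𝓘(ℝ, 𝔼 m) D (𝔼 m) k)) :=
    (A - ContinuousLinearMap.id ℝ _).isClosed_ker
  have : CompleteSpace V := hVc.completeSpace_coe
  let A' : CkMap I 𝓘(ℝ, 𝔼 m) D (𝔼 m) k →L[ℝ] V := A.codRestrict V fun u => (hV _).2 (hA u)
  have hfix : ∀ g, leftComp I J h g ∈ e.source → R (leftComp I J h g) = leftComp I J h g :=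
    fun g hg => congrArg (leftComp I J h) (hρ g (heO hg).1)
  have heA : ∀ u, R u = u → e u = A u := by
    intro u hu
    rw [he, hu]
    simp
  -- The second condition forces `e.symm v` to be a fixed point of `R`: applying `A` to `e (e.symm
  -- v) = v` gives `e (R (e.symm v)) = v`, and `e` is injective on its source.
  let target : Set V := {v | (v : CkMap I 𝓘(ℝ, 𝔼 m) D (𝔼 m) k) ∈ e.target ∧
    R (e.symm v) ∈ e.source}
  have htgt : ∀ v ∈ target, R (e.symm v.1) = e.symm v.1 := by
    intro v hv
    have h1 := e.map_target hv.1
    have h2 : e (R (e.symm v.1)) = v.1 := by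
      rw [heA _ (hRR _ (heO h1).2)]
      have h3 := e.right_inv hv.1
      rw [he] at h3
      have h4 : A v.1 = v.1 := (hV _).1 v.2
      have h5 := congrArg A h3
      simp only [map_add, map_sub, hA, sub_self, add_zero] at h5
      rw [h5, h4]
    have h3 := e.left_inv hv.2
    rw [h2] at h3
    exact h3.symm
  have htopen : IsOpen target := by
    have h1 : IsOpen (e.target ∩ (fun v => R (e.symm v)) ⁻¹' e.source) :=
      ContinuousOn.isOpen_inter_preimage (hRs.continuousOn.comp hes.continuousOn
        fun v hv => (heO (e.map_target hv)).1) e.open_target e.open_source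
    exact h1.preimage continuous_subtype_val
  let c : BanachChart.{max uD uN, uD} (CkMap I J D N k) :=
    { V := V
      toEquiv :=
        { toFun := fun g => A' (leftComp I J h g)
          invFun := fun v => ρ (e.symm v.1)
          source := {g | leftComp I J h g ∈ e.source}
          target := target
          map_source' := by
            intro g hg
            have h1 : (A' (leftComp I J h g) : CkMap I 𝓘(ℝ, 𝔼 m) D (𝔼 m) k) =
              e (leftComp I J h g) := (heA _ (hfix g hg)).symm
            change _ ∈ e.target ∧ R (e.symm _) ∈ e.source
            rw [h1, e.left_inv hg, hfix g hg]
            exact ⟨e.map_source hg, hg⟩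
          map_target' := fun v hv => hv.2
          left_inv' := by
            intro g hg
            have h1 : (A' (leftComp I J h g) : CkMap I 𝓘(ℝ, 𝔼 m) D (𝔼 m) k) =
              e (leftComp I J h g) := (heA _ (hfix g hg)).symm
            change ρ (e.symm (A' (leftComp I J h g))) = g
            rw [h1, e.left_inv hg, hρ g (heO hg).1]
          right_inv' := by
            intro v hv
            apply Subtype.ext
            change A (R (e.symm v.1)) = v.1
            rw [htgt v hv, ← heA _ (htgt v hv), e.right_inv hv.1] }
      open_target := htopen }
  refine ⟨c, ⟨fun m' h' => ?_, fun g hg => ?_⟩, hfe⟩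
  · exact (hsm m' h').comp (hes.comp V.subtypeL.contDiff.contDiffOn fun v hv => hv.1)
      fun v hv => (heO (e.map_target hv.1)).1
  · exact ⟨m, h, e.source, A', e.open_source, hg, A'.contDiff.contDiffOn, fun g' hg' => ⟨hg', rfl⟩⟩

theorem IsCkChart.contDiffAt_leftComp {c : BanachChart.{max uD uN, uD} (CkMap I J D N k)}
    (hc : IsCkChart I J c) {g : CkMap I J D N k} (hg : g ∈ c.toEquiv.source) {m : ℕ}
    (h : C^∞⟮J, N; 𝓘(ℝ, 𝔼 m), 𝔼 m⟯) :
    ContDiffAt ℝ ∞ (fun v => leftComp I J h (c.toEquiv.symm v)) (c.toEquiv g) :=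
  (hc.1 m h).contDiffAt (c.open_target.mem_nhds (c.toEquiv.map_source hg))

/-- A map into `C^k(D, N)` is smooth if its left-compositions with smooth maps are smooth. -/
theorem IsCkChart.contDiffAt_of_leftComp {c : BanachChart.{max uD uN, uD} (CkMap I J D N k)}
    (hc : IsCkChart I J c) {Z : Type*} [NormedAddCommGroup Z] [NormedSpace ℝ Z]
    {θ : Z → CkMap I J D N k} {z : Z} (hz : θ z ∈ c.toEquiv.source)
    (hθ : ∀ (m : ℕ) (h : C^∞⟮J, N; 𝓘(ℝ, 𝔼 m), 𝔼 m⟯),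
      ContDiffAt ℝ ∞ (fun w => leftComp I J h (θ w)) z) :
    (∀ᶠ w in 𝓝 z, θ w ∈ c.toEquiv.source) ∧ ContDiffAt ℝ ∞ (fun w => c.toEquiv (θ w)) z := by
  obtain ⟨m, h, O, G, hO, hzO, hG, hsub⟩ := hc.2 _ hz
  have hev : ∀ᶠ w in 𝓝 z, leftComp I J h (θ w) ∈ O :=
    (hθ m h).continuousAt.eventually (hO.mem_nhds hzO)
  refine ⟨hev.mono fun w hw => (hsub _ hw).1, ?_⟩
  exact ((hG.contDiffAt (hO.mem_nhds hzO)).comp z (hθ m h)).congr_of_eventuallyEq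
    (hev.mono fun w hw => (hsub _ hw).2)

end CkManifold

section CkSmoothness

universe uD uN

local notation "𝔼" m:max => EuclideanSpace ℝ (Fin m)

variable {ED : Type*} [NormedAddCommGroup ED] [NormedSpace ℝ ED] [FiniteDimensional ℝ ED]
  {HD : Type*} [TopologicalSpace HD] {I : ModelWithCorners ℝ ED HD}
  {D : Type uD} [TopologicalSpace D] [ChartedSpace HD D] [CompactSpace D]
  [IsManifold I ∞ D] {k : ℕ}

/-! ### Pairs of maps of class `C^k` -/

/-- The map with the two given components. -/
def ckPair {Y Y' : Type*} [NormedAddCommGroup Y] [NormedSpace ℝ Y] [NormedAddCommGroup Y']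
    [NormedSpace ℝ Y'] (u : CkMap I 𝓘(ℝ, Y) D Y k) (v : CkMap I 𝓘(ℝ, Y') D Y' k) :
    CkMap I 𝓘(ℝ, Y × Y') D (Y × Y') k :=
  CkMap.mk (fun p => (u p, v p)) (u.contMDiff.prodMk_space v.contMDiff)

@[simp]
theorem ckPair_apply {Y Y' : Type*} [NormedAddCommGroup Y] [NormedSpace ℝ Y]
    [NormedAddCommGroup Y'] [NormedSpace ℝ Y'] (u : CkMap I 𝓘(ℝ, Y) D Y k)
    (v : CkMap I 𝓘(ℝ, Y') D Y' k) (p : D) : ckPair u v p = (u p, v p) := rfl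

theorem ckComp_clm_apply {Y W : Type*} [NormedAddCommGroup Y] [NormedSpace ℝ Y]
    [NormedAddCommGroup W] [NormedSpace ℝ W] (L : Y →L[ℝ] W) (u : CkMap I 𝓘(ℝ, Y) D Y k) (p : D) :
    ckComp L u p = L (u p) :=
  ckComp_apply isOpen_univ L.contDiff.contDiffOn (fun _ => mem_univ _) p

theorem contDiff_ckComp_clm {Y W : Type} [NormedAddCommGroup Y] [NormedSpace ℝ Y]
    [NormedAddCommGroup W] [NormedSpace ℝ W] [CompleteSpace W] (L : Y →L[ℝ] W) :
    ContDiff ℝ ∞ (ckComp (I := I) (D := D) (k := k) L) := by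
  rw [← contDiffOn_univ]
  exact (contDiffOn_ckComp isOpen_univ L.contDiff.contDiffOn).mono fun u _ p => mem_univ _

theorem contDiff_ckPair {Y Y' : Type} [NormedAddCommGroup Y] [NormedSpace ℝ Y] [CompleteSpace Y]
    [NormedAddCommGroup Y'] [NormedSpace ℝ Y'] [CompleteSpace Y'] :
    ContDiff ℝ ∞ (fun q : CkMap I 𝓘(ℝ, Y) D Y k × CkMap I 𝓘(ℝ, Y') D Y' k =>
      ckPair q.1 q.2) := by
  have h : (fun q : CkMap I 𝓘(ℝ, Y) D Y k × CkMap I 𝓘(ℝ, Y') D Y' k => ckPair q.1 q.2) =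
      fun q => ckComp (ContinuousLinearMap.inl ℝ Y Y') q.1 +
        ckComp (ContinuousLinearMap.inr ℝ Y Y') q.2 := by
    funext q
    ext1 p
    rw [ckPair_apply, ContMDiffMap.coe_add, Pi.add_apply, ckComp_clm_apply, ckComp_clm_apply]
    simp
  rw [h]
  exact ((contDiff_ckComp_clm _).comp contDiff_fst).add ((contDiff_ckComp_clm _).comp contDiff_snd)

/-! ### Smoothness of compositions -/

variable {EN : Type*} [NormedAddCommGroup EN] [NormedSpace ℝ EN]
  {HN : Type*} [TopologicalSpace HN] {J : ModelWithCorners ℝ EN HN}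
  {N : Type uN} [TopologicalSpace N] [ChartedSpace HN N]

open Classical in
/-- The map `p ↦ β (g p, u p)` (zero if it is not of class `C^k`). -/
def ckComp₂ {Y W : Type*} [NormedAddCommGroup Y] [NormedSpace ℝ Y] [NormedAddCommGroup W]
    [NormedSpace ℝ W] (β : N × Y → W) (g : CkMap I J D N k) (u : CkMap I 𝓘(ℝ, Y) D Y k) :
    CkMap I 𝓘(ℝ, W) D W k :=
  if h : ContMDiff I 𝓘(ℝ, W) k (fun p => β (g p, u p)) then CkMap.mk _ h else 0

theorem ckComp₂_apply {Y W : Type*} [NormedAddCommGroup Y] [NormedSpace ℝ Y]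
    [NormedAddCommGroup W] [NormedSpace ℝ W] {β : N × Y → W} {U : Set (N × Y)} (hU : IsOpen U)
    (hβ : ContMDiffOn (J.prod 𝓘(ℝ, Y)) 𝓘(ℝ, W) ∞ β U) {g : CkMap I J D N k}
    {u : CkMap I 𝓘(ℝ, Y) D Y k} (hgu : ∀ p, (g p, u p) ∈ U) (p : D) :
    ckComp₂ β g u p = β (g p, u p) := by
  have h : ContMDiff I 𝓘(ℝ, W) k (fun p => β (g p, u p)) := fun p =>
    (((hβ _ (hgu p)).contMDiffAt (hU.mem_nhds (hgu p))).of_le (by exact_mod_cast le_top)).comp p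
      ((g.contMDiff p).prodMk (u.contMDiff p))
  rw [ckComp₂, dif_pos h]
  rfl

/-- If the left-compositions of a map `θ` into `C^k(D, N)` with smooth maps are smooth, then so is
its composition with a smooth map that is defined on an open set only and depends on a second map
of class `C^k`. -/
theorem contDiffAt_ckComp₂ [FiniteDimensional ℝ EN] [IsManifold J ∞ N] [J.Boundaryless]
    [T2Space N] {Y W : Type} [NormedAddCommGroup Y] [NormedSpace ℝ Y] [CompleteSpace Y]
    [NormedAddCommGroup W] [NormedSpace ℝ W] [CompleteSpace W] {β : N × Y → W} {U : Set (N × Y)}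
    (hU : IsOpen U) (hβ : ContMDiffOn (J.prod 𝓘(ℝ, Y)) 𝓘(ℝ, W) ∞ β U)
    {Z : Type*} [NormedAddCommGroup Z] [NormedSpace ℝ Z] {θ : Z → CkMap I J D N k}
    {u : Z → CkMap I 𝓘(ℝ, Y) D Y k} {z : Z}
    (hθ : ∀ (m : ℕ) (h : C^∞⟮J, N; 𝓘(ℝ, 𝔼 m), 𝔼 m⟯),
      ContDiffAt ℝ ∞ (fun w => leftComp I J h (θ w)) z)
    (hu : ContDiffAt ℝ ∞ u z) (hz : ∀ p, (θ z p, u z p) ∈ U) :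
    (∀ᶠ w in 𝓝 z, ∀ p, (θ w p, u w p) ∈ U) ∧
      ContDiffAt ℝ ∞ (fun w => ckComp₂ β (θ w) (u w)) z := by
  rcases isEmpty_or_nonempty D with hD | ⟨⟨p₀⟩⟩
  · refine ⟨Eventually.of_forall fun w p => hD.elim p, ?_⟩
    have : (fun w => ckComp₂ β (θ w) (u w)) = fun _ => 0 := by
      funext w
      ext p
      exact hD.elim p
    rw [this]
    exact contDiffAt_const
  have : Nonempty N := ⟨θ z p₀⟩
  obtain ⟨m, h, r, Ω, hr, hΩ⟩ :=
    exists_isSmoothLeftInverse J (isCompact_range (θ z).contMDiff.continuous)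
  have hrid : ContMDiffOn 𝓘(ℝ, 𝔼 m × Y) (J.prod 𝓘(ℝ, Y)) ∞
      (fun y : 𝔼 m × Y => (r y.1, y.2)) (Ω ×ˢ univ) :=
    (hr.contMDiffOn.comp contDiff_fst.contMDiff.contMDiffOn fun y hy => hy.1).prodMk
      contDiff_snd.contMDiff.contMDiffOn
  -- Replacing the point of `N` by `r y` turns `β` into a smooth map on an open set of a normed
  -- space, to which `contDiffOn_ckComp` applies. Composing with `h` afterwards gives `β` back,
  -- because `r` is a left inverse.
  set Ω' : Set (𝔼 m × Y) := Ω ×ˢ univ ∩ (fun y : 𝔼 m × Y => (r y.1, y.2)) ⁻¹' U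
  have hΩ' : IsOpen Ω' :=
    hrid.continuousOn.isOpen_inter_preimage (hr.isOpen.prod isOpen_univ) hU
  have hβr : ContDiffOn ℝ ∞ (fun y : 𝔼 m × Y => β (r y.1, y.2)) Ω' :=
    (hβ.comp (hrid.mono inter_subset_left) fun y hy => hy.2).contDiffOn
  have hP : ContDiffAt ℝ ∞ (fun w => ckPair (leftComp I J h (θ w)) (u w)) z :=
    contDiff_ckPair.contDiffAt.comp z ((hθ m h).prodMk hu)
  have hzΩ : ∀ p, ckPair (leftComp I J h (θ z)) (u z) p ∈ Ω' := by
    intro p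
    have h1 : h (θ z p) ∈ Ω := hΩ _ (mem_range_self p)
    refine ⟨⟨h1, mem_univ _⟩, ?_⟩
    change (r (h (θ z p)), u z p) ∈ U
    rw [hr.left_inv _ h1]
    exact hz p
  have hev : ∀ᶠ w in 𝓝 z, ∀ p, ckPair (leftComp I J h (θ w)) (u w) p ∈ Ω' :=
    hP.continuousAt.eventually ((isOpen_ck_forall_mem hΩ').mem_nhds hzΩ)
  have hev' : ∀ᶠ w in 𝓝 z, ∀ p, (θ w p, u w p) ∈ U := by
    filter_upwards [hev] with w hw p
    have h1 : (r (h (θ w p)), u w p) ∈ U := (hw p).2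
    rwa [hr.left_inv _ (hw p).1.1] at h1
  refine ⟨hev', ?_⟩
  have h1 := ((contDiffOn_ckComp (I := I) (D := D) (k := k) hΩ' hβr).contDiffAt
    ((isOpen_ck_forall_mem hΩ').mem_nhds hzΩ)).comp z hP
  refine h1.congr_of_eventuallyEq ?_
  filter_upwards [hev, hev'] with w hw hw'
  ext p
  rw [ckComp₂_apply hU hβ hw', Function.comp, ckComp_apply hΩ' hβr hw, ckPair_apply,
    leftComp_apply, hr.left_inv _ (hw p).1.1]

/-! ### Smooth maps into `C^k(D, N)` -/

variable [FiniteDimensional ℝ EN] [IsManifold J ∞ N] [J.Boundaryless] [T2Space N]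

/-- The universal property used for all maps into `C^k(D, N)`: no chart of the target has to be
known, only the left-compositions with smooth maps to Euclidean spaces. -/
theorem smoothAt_ckAtlas_of_leftComp {X : Type u} {A : BanachAtlas.{u, uD} X}
    {θ : X → CkMap I J D N k} {x : X} {c : BanachChart.{u, uD} X} (hc : c ∈ A.charts)
    (hx : x ∈ c.toEquiv.source)
    (hθ : ∀ (m : ℕ) (h : C^∞⟮J, N; 𝓘(ℝ, 𝔼 m), 𝔼 m⟯),
      ContDiffAt ℝ ∞ (fun v => leftComp I J h (θ (c.toEquiv.symm v))) (c.toEquiv x)) :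
    A.SmoothAt (ckAtlas I D k J N) θ x := by
  obtain ⟨c', hc', hx'⟩ := exists_isCkChart (I := I) (J := J) (θ x)
  obtain ⟨h1, h2⟩ := hc'.contDiffAt_of_leftComp (θ := fun v => θ (c.toEquiv.symm v))
    (z := c.toEquiv x) (by rwa [c.toEquiv.left_inv hx]) hθ
  exact ⟨c, hc, c', hc', hx, hx', h1, h2⟩

/-! ### Evaluation maps -/

/-- Near `f`, evaluation at `p` is `r` applied to the value at `p` of `h_*`, and evaluation on
`C^k(D, ℝ^m)` is bounded and linear. -/
theorem smoothInto_eval (p : D) : (ckAtlas I D k J N).SmoothInto J (fun g => g p) := by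
  intro f
  obtain ⟨c, hc, hf⟩ := exists_isCkChart (I := I) (J := J) f
  refine ⟨c, hc, hf, ?_⟩
  have : Nonempty N := ⟨f p⟩
  obtain ⟨m, h, r, Ω, hr, hΩ⟩ := exists_isSmoothLeftInverse J (isCompact_singleton (x := f p))
  have h1 : ContDiffAt ℝ ∞ (fun v => h (c.toEquiv.symm v p)) (c.toEquiv f) :=
    (ckEval I k (𝔼 m) p).contDiff.contDiffAt.comp (c.toEquiv f) (hc.contDiffAt_leftComp hf h)
  have h2 : h (c.toEquiv.symm (c.toEquiv f) p) ∈ Ω := by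
    rw [c.toEquiv.left_inv hf]
    exact hΩ _ rfl
  have h3 := ((hr.contMDiffOn _ h2).contMDiffAt (hr.isOpen.mem_nhds h2)).comp (c.toEquiv f)
    h1.contMDiffAt
  refine h3.congr_of_eventuallyEq ?_
  filter_upwards [h1.continuousAt.eventually (hr.isOpen.mem_nhds h2)] with v hv
  exact (hr.left_inv _ hv).symm

/-- `C^k(D, N)` is a Banach manifold. -/
theorem isBanachManifold_ckAtlas : (ckAtlas I D k J N).IsBanachManifold where
  cover f := exists_isCkChart f
  separated f g hfg := by
    -- Evaluation at a point where the maps differ pulls disjoint neighbourhoods in `N` back to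
    -- disjoint neighbourhoods of the two maps.
    obtain ⟨p, hp⟩ : ∃ p, f p ≠ g p := by
      by_contra! h
      exact hfg (ContMDiffMap.ext h)
    obtain ⟨U, U', hU, hU', hfU, hgU', hd⟩ := t2_separation hp
    obtain ⟨c, hc, hf⟩ := exists_isCkChart (I := I) (J := J) f
    obtain ⟨c', hc', hg⟩ := exists_isCkChart (I := I) (J := J) g
    have h1 := ((smoothInto_eval (J := J) p).contMDiffAt hc hf).continuousAt
    have h2 := ((smoothInto_eval (J := J) p).contMDiffAt hc' hg).continuousAt
    refine ⟨c, hc, c', hc', hf, hg, _, h1 (hU.mem_nhds (by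
        change c.toEquiv.symm (c.toEquiv f) p ∈ U
        rwa [c.toEquiv.left_inv hf])),
      _, h2 (hU'.mem_nhds (by
        change c'.toEquiv.symm (c'.toEquiv g) p ∈ U'
        rwa [c'.toEquiv.left_inv hg])), ?_⟩
    rw [Set.disjoint_left]
    rintro _ ⟨v, ⟨hv, -⟩, rfl⟩ ⟨v', ⟨hv', -⟩, he⟩
    refine Set.disjoint_left.1 hd hv ?_
    change c'.toEquiv.symm v' p ∈ U' at hv'
    rwa [he] at hv'

end CkSmoothness

/-! ### The tangent bundle of `C^k(D, N)` -/

section CkTangent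

universe uD uN

local notation "𝔼" m:max => EuclideanSpace ℝ (Fin m)

variable {EN : Type*} [NormedAddCommGroup EN] [NormedSpace ℝ EN]
  {HN : Type*} [TopologicalSpace HN] {J : ModelWithCorners ℝ EN HN}
  {N : Type uN} [TopologicalSpace N] [ChartedSpace HN N] [IsManifold J ∞ N]

theorem contMDiff_totalSpace_mk_modelSpace {Y : Type*} [NormedAddCommGroup Y] [NormedSpace ℝ Y] :
    ContMDiff 𝓘(ℝ, Y × Y) 𝓘(ℝ, Y).tangent ∞
      (fun q : Y × Y => (⟨q.1, q.2⟩ : TangentBundle 𝓘(ℝ, Y) Y)) := by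
  intro q
  rw [contMDiffAt_totalSpace]
  refine ⟨contDiff_fst.contMDiff q, ?_⟩
  refine (contDiff_snd.contMDiff q).congr_of_eventuallyEq (Eventually.of_forall fun z => ?_)
  simp

/-- The differential of `r`, written on pairs of vectors, recovers points of `TN` smoothly from
their images under `h` and `dh`. It plays for `TN` the part of `r` for `N`. -/
theorem IsSmoothLeftInverse.contMDiffOn_tangent {Y : Type*} [NormedAddCommGroup Y]
    [NormedSpace ℝ Y] {h : N → Y} {r : Y → N} {Ω : Set Y} (hr : IsSmoothLeftInverse J h r Ω) :
    ContMDiffOn 𝓘(ℝ, Y × Y) J.tangent ∞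
      (fun q : Y × Y => (⟨r q.1, mfderiv 𝓘(ℝ, Y) J r q.1 q.2⟩ : TangentBundle J N))
      (Ω ×ˢ univ) := by
  have h1 := hr.contMDiffOn.contMDiffOn_tangentMapWithin (m := ∞) (by simp)
    hr.isOpen.uniqueMDiffOn
  have h2 := contMDiff_tangentBundleModelSpaceHomeomorph_symm (I := 𝓘(ℝ, Y)) (n := ∞)
  have h3 : ContMDiff 𝓘(ℝ, Y × Y) 𝓘(ℝ, Y).tangent ∞
      (fun q : Y × Y => (⟨q.1, q.2⟩ : TangentBundle 𝓘(ℝ, Y) Y)) :=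
    contMDiff_totalSpace_mk_modelSpace
  have hmaps : MapsTo (fun q : Y × Y => (⟨q.1, q.2⟩ : TangentBundle 𝓘(ℝ, Y) Y)) (Ω ×ˢ univ)
      (TotalSpace.proj ⁻¹' Ω) := fun q hq => hq.1
  refine (h1.comp h3.contMDiffOn hmaps).congr fun q hq => ?_
  change _ = (⟨r q.1, mfderivWithin 𝓘(ℝ, Y) J r Ω q.1 q.2⟩ : TangentBundle J N)
  rw [mfderivWithin_of_isOpen hr.isOpen hq.1]

variable {ED : Type*} [NormedAddCommGroup ED] [NormedSpace ℝ ED] [FiniteDimensional ℝ ED]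
  {HD : Type*} [TopologicalSpace HD] {I : ModelWithCorners ℝ ED HD}
  {D : Type uD} [TopologicalSpace D] [ChartedSpace HD D] [CompactSpace D]
  [IsManifold I ∞ D] {k : ℕ}
variable [FiniteDimensional ℝ EN] [J.Boundaryless] [T2Space N]

/-- Chain rule for the two factorizations of `g ↦ h (g p)`: through evaluation in `N`, or through
`h_*` followed by evaluation of vector-valued maps. -/
theorem mfderiv_mderiv_eval {m : ℕ} (h : C^∞⟮J, N; 𝓘(ℝ, 𝔼 m), 𝔼 m⟯) {f : CkMap I J D N k}
    (c : (ckAtlas I D k J N).ChartAt f) (η : (ckAtlas I D k J N).TangentSp f) (p : D) :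
    mfderiv J 𝓘(ℝ, 𝔼 m) h (f p)
        ((ckAtlas I D k J N).mderiv J (fun g : CkMap I J D N k => g p) f η) =
      fderiv ℝ (fun v => leftComp I J h (c.1.toEquiv.symm v)) (c.1.toEquiv f) (η.1 c) p := by
  have e0 : c.1.toEquiv.symm (c.1.toEquiv f) = f := c.1.toEquiv.left_inv c.2.2
  have h1 := ((smoothInto_eval (J := J) p).contMDiffAt c.2.1 c.2.2).mdifferentiableAt (by simp)
  have h2 : MDifferentiableAt J 𝓘(ℝ, 𝔼 m) h (c.1.toEquiv.symm (c.1.toEquiv f) p) :=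
    h.contMDiff.contMDiffAt.mdifferentiableAt (by simp)
  have h3 := HasMFDerivAt.comp (f := fun v => c.1.toEquiv.symm v p) (c.1.toEquiv f)
    h2.hasMFDerivAt h1.hasMFDerivAt
  have h4 : HasFDerivAt (fun v => leftComp I J h (c.1.toEquiv.symm v)) _ (c.1.toEquiv f) :=
    ((IsCkChart.contDiffAt_leftComp c.2.1 c.2.2 h).differentiableAt (by simp)).hasFDerivAt
  have h5 := (ckEval I k (𝔼 m) p).hasFDerivAt.comp (c.1.toEquiv f) h4
  have h6 := hasMFDerivAt_unique h3 h5.hasMFDerivAt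
  have h7 := DFunLike.congr_fun h6 (η.1 c)
  refine Eq.trans ?_ h7
  rw [BanachAtlas.mderiv_apply (smoothInto_eval p) c η]
  have key : ∀ (g : CkMap I J D N k), g = f → ∀ v : EN,
      (mfderiv J 𝓘(ℝ, 𝔼 m) h (f p) v : 𝔼 m) = (mfderiv J 𝓘(ℝ, 𝔼 m) h (g p) v : 𝔼 m) := by
    rintro _ rfl v
    rfl
  exact key _ e0 _

/-- As `dr ∘ dh` is the identity, the tangent vector at `f p` is read off from the value at `p` of
the differential of `h_*`. The equality is between points of `TN` because `r (h (f p))` and `f p`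
agree only propositionally. -/
theorem mderiv_eval_eq {m : ℕ} {h : C^∞⟮J, N; 𝓘(ℝ, 𝔼 m), 𝔼 m⟯} {r : 𝔼 m → N} {Ω : Set (𝔼 m)}
    (hr : IsSmoothLeftInverse J h r Ω) {f : CkMap I J D N k}
    (c : (ckAtlas I D k J N).ChartAt f) (η : (ckAtlas I D k J N).TangentSp f) {p : D}
    (hp : h (f p) ∈ Ω) :
    (⟨f p, (ckAtlas I D k J N).mderiv J (fun g : CkMap I J D N k => g p) f η⟩ :
        TangentBundle J N) =
      ⟨r (h (f p)), mfderiv 𝓘(ℝ, 𝔼 m) J r (h (f p))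
        (fderiv ℝ (fun v => leftComp I J h (c.1.toEquiv.symm v)) (c.1.toEquiv f) (η.1 c) p)⟩ := by
  rw [← mfderiv_mderiv_eval h c η p]
  have h1 : MDifferentiableAt J 𝓘(ℝ, 𝔼 m) h (f p) :=
    h.contMDiff.contMDiffAt.mdifferentiableAt (by simp)
  have h2 : MDifferentiableAt 𝓘(ℝ, 𝔼 m) J r (h (f p)) :=
    ((hr.contMDiffOn _ hp).contMDiffAt (hr.isOpen.mem_nhds hp)).mdifferentiableAt (by simp)
  have h3 := h2.hasMFDerivAt.comp (f p) h1.hasMFDerivAt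
  have h4 : r ∘ h =ᶠ[𝓝 (f p)] id := by
    filter_upwards [h.contMDiff.continuous.continuousAt.eventually (hr.isOpen.mem_nhds hp)]
      with x hx using hr.left_inv x hx
  have h5 := hasMFDerivAt_unique h3 ((hasMFDerivAt_id (f p)).congr_of_eventuallyEq h4)
  have key : ∀ (x : N), x = f p → ∀ (v w : EN), v = w →
      (⟨f p, v⟩ : TangentBundle J N) = ⟨x, w⟩ := by
    rintro _ rfl v _ rfl
    rfl
  refine key _ (hr.left_inv _ hp) _ _ ?_
  exact (DFunLike.congr_fun h5 _).symm

/-- A tangent vector of `C^k(D, N)` is a map of class `C^k` from `D` to the tangent bundle. -/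
theorem contMDiff_mderiv_eval {f : CkMap I J D N k} (η : (ckAtlas I D k J N).TangentSp f) :
    ContMDiff I J.tangent k (fun p : D => (⟨f p, (ckAtlas I D k J N).mderiv J
      (fun g : CkMap I J D N k => g p) f η⟩ : TangentBundle J N)) := by
  rcases isEmpty_or_nonempty D with hD | ⟨⟨p₀⟩⟩
  · exact fun p => hD.elim p
  have : Nonempty N := ⟨f p₀⟩
  obtain ⟨m, h, r, Ω, hr, hΩ⟩ :=
    exists_isSmoothLeftInverse J (isCompact_range f.contMDiff.continuous)
  obtain ⟨c, hc, hf⟩ := exists_isCkChart (I := I) (J := J) f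
  set ζ := fderiv ℝ (fun v => leftComp I J h (c.toEquiv.symm v)) (c.toEquiv f) (η.1 ⟨c, hc, hf⟩)
  have h1 := (hr.contMDiffOn_tangent.of_le (m := k) (by exact_mod_cast le_top)).comp_contMDiff
    (ckPair (leftComp I J h f) ζ).contMDiff fun p => ⟨hΩ _ (mem_range_self p), mem_univ _⟩
  refine h1.congr fun p => ?_
  exact mderiv_eval_eq hr ⟨c, hc, hf⟩ η (hΩ _ (mem_range_self p))

/-- Near `f` the chart is `G ∘ l_*`, so the differential of `l_*` in the chart has the left inverse
`dG` and is injective. Its values are maps, determined by their values at the points `p`, which are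
`dl (d ev_p η)`. -/
theorem tangentSp_ext_of_eval {f : CkMap I J D N k} {η η' : (ckAtlas I D k J N).TangentSp f}
    (h : ∀ p, (ckAtlas I D k J N).mderiv J (fun g : CkMap I J D N k => g p) f η =
      (ckAtlas I D k J N).mderiv J (fun g : CkMap I J D N k => g p) f η') : η = η' := by
  obtain ⟨c, hc, hf⟩ := exists_isCkChart (I := I) (J := J) f
  refine BanachAtlas.tangentSp_ext (A := ckAtlas I D k J N) ⟨c, hc, hf⟩ ?_
  obtain ⟨m, l, O, G, hO, hfO, hG, hsub⟩ := hc.2 f hf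
  have e0 : c.toEquiv.symm (c.toEquiv f) = f := c.toEquiv.left_inv hf
  have h1 := hc.contDiffAt_leftComp hf l
  have hζ : fderiv ℝ (fun v => leftComp I J l (c.toEquiv.symm v)) (c.toEquiv f)
        (η.1 ⟨c, hc, hf⟩) =
      fderiv ℝ (fun v => leftComp I J l (c.toEquiv.symm v)) (c.toEquiv f)
        (η'.1 ⟨c, hc, hf⟩) := by
    ext1 p
    rw [← mfderiv_mderiv_eval l ⟨c, hc, hf⟩ η p, ← mfderiv_mderiv_eval l ⟨c, hc, hf⟩ η' p, h p]
  have hG' : HasFDerivAt G (fderiv ℝ G (leftComp I J l (c.toEquiv.symm (c.toEquiv f))))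
      (leftComp I J l (c.toEquiv.symm (c.toEquiv f))) := by
    rw [e0]
    exact ((hG.contDiffAt (hO.mem_nhds hfO)).differentiableAt (by simp)).hasFDerivAt
  have h2 := hG'.comp (c.toEquiv f) (h1.differentiableAt (by simp)).hasFDerivAt
  have h3 : (G ∘ fun v => leftComp I J l (c.toEquiv.symm v)) =ᶠ[𝓝 (c.toEquiv f)] id := by
    filter_upwards [h1.continuousAt.eventually (hO.mem_nhds (by
      change leftComp I J l (c.toEquiv.symm (c.toEquiv f)) ∈ O
      rwa [e0])),
      c.open_target.mem_nhds (c.toEquiv.map_source hf)] with v hv hv'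
    rw [Function.comp, ← (hsub _ hv).2, c.toEquiv.right_inv hv']
    rfl
  have h4 := h2.unique ((hasFDerivAt_id _).congr_of_eventuallyEq h3)
  have h5 := DFunLike.congr_fun h4 (η.1 ⟨c, hc, hf⟩)
  have h6 := DFunLike.congr_fun h4 (η'.1 ⟨c, hc, hf⟩)
  rw [ContinuousLinearMap.comp_apply] at h5 h6
  rw [hζ] at h5
  exact h5.symm.trans h6

/-- The field `ξ` is the velocity at `0` of the curve `t ↦ r ∘ (h ∘ f + t dh ξ)` in `C^k(D, N)`,
since `dr ∘ dh` is the identity. -/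
theorem exists_mderiv_eval_eq (f : CkMap I J D N k) (ξ : ∀ p, TangentSpace J (f p))
    (hξ : ContMDiff I J.tangent k (fun p => (⟨f p, ξ p⟩ : TangentBundle J N))) :
    ∃ η : (ckAtlas I D k J N).TangentSp f, ∀ p,
      (ckAtlas I D k J N).mderiv J (fun g : CkMap I J D N k => g p) f η = ξ p := by
  rcases isEmpty_or_nonempty D with hD | ⟨⟨p₀⟩⟩
  · exact ⟨0, fun p => hD.elim p⟩
  have : Nonempty N := ⟨f p₀⟩
  obtain ⟨m, h, r, Ω, hr, hΩ⟩ :=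
    exists_isSmoothLeftInverse J (isCompact_range f.contMDiff.continuous)
  obtain ⟨c, hc, hf⟩ := exists_isCkChart (I := I) (J := J) f
  have hfΩ : ∀ p, h (f p) ∈ Ω := fun p => hΩ _ (mem_range_self p)
  let ζ : CkMap I 𝓘(ℝ, 𝔼 m) D (𝔼 m) k := CkMap.mk (fun p => mfderiv J 𝓘(ℝ, 𝔼 m) h (f p) (ξ p)) (by
    have h1 := (h.contMDiff.contMDiff_tangentMap (m := ∞) (by simp)).of_le (m := (k : WithTop ℕ∞))
      (by exact_mod_cast le_top)
    exact (contMDiff_snd_tangentBundle_modelSpace (𝔼 m) 𝓘(ℝ, 𝔼 m)).comp (h1.comp hξ))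
  let a : ℝ → CkMap I 𝓘(ℝ, 𝔼 m) D (𝔼 m) k := fun t => leftComp I J h f + t • ζ
  have ha : ContDiff ℝ ∞ a := contDiff_const.add (contDiff_id.smul contDiff_const)
  have ha0 : a 0 = leftComp I J h f := by simp [a]
  let θ : ℝ → CkMap I J D N k := fun t => ckLift r f (a t)
  have hopen := isOpen_ck_forall_mem (I := I) (D := D) (k := k) hr.isOpen
  have hamem : a 0 ∈ {u : CkMap I 𝓘(ℝ, 𝔼 m) D (𝔼 m) k | ∀ p, u p ∈ Ω} := by
    rw [ha0]
    exact hfΩ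
  have hθ0 : θ 0 = f := by
    ext p
    simp only [θ]
    rw [ckLift_apply hr f hamem, ha0]
    exact hr.left_inv _ (hfΩ p)
  have hθ : ∀ (m' : ℕ) (h' : C^∞⟮J, N; 𝓘(ℝ, 𝔼 m'), 𝔼 m'⟯),
      ContDiffAt ℝ ∞ (fun t => leftComp I J h' (θ t)) 0 := fun m' h' =>
    ((contDiffOn_leftComp_ckLift hr f h').contDiffAt (hopen.mem_nhds hamem)).comp 0
      ha.contDiffAt
  obtain ⟨hev, hcθ⟩ := hc.contDiffAt_of_leftComp (θ := θ) (z := 0) (by rwa [hθ0]) hθ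
  refine ⟨(ckAtlas I D k J N).mkTangent ⟨c, hc, hf⟩ (fderiv ℝ (fun t => c.toEquiv (θ t)) 0 1),
    fun p => ?_⟩
  rw [BanachAtlas.mderiv_apply (smoothInto_eval p) ⟨c, hc, hf⟩, BanachAtlas.mkTangent_self]
  have h1 := (((smoothInto_eval (J := J) p).contMDiffAt hc hf).mdifferentiableAt
    (by simp)).hasMFDerivAt
  have h2 := (hcθ.differentiableAt (by simp)).hasFDerivAt.hasMFDerivAt
  have h3 := HasMFDerivAt.comp (f := fun t => c.toEquiv (θ t)) (0 : ℝ) (by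
    rw [hθ0]
    exact h1) h2
  have h4 : ((fun v => c.toEquiv.symm v p) ∘ fun t => c.toEquiv (θ t)) =ᶠ[𝓝 (0 : ℝ)]
      r ∘ fun t : ℝ => h (f p) + t • ζ p := by
    filter_upwards [hev, ha.continuous.continuousAt.eventually (hopen.mem_nhds hamem)] with t ht ht'
    simp only [Function.comp]
    rw [c.toEquiv.left_inv ht]
    simp only [θ]
    rw [ckLift_apply hr f ht']
    rfl
  have h5 : HasFDerivAt (fun t : ℝ => h (f p) + t • ζ p)
      ((ContinuousLinearMap.id ℝ ℝ).smulRight (ζ p)) 0 :=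
    ((hasFDerivAt_id (𝕜 := ℝ) (0 : ℝ)).smul_const (ζ p)).const_add _
  have h6 : MDifferentiableAt 𝓘(ℝ, 𝔼 m) J r (h (f p)) :=
    ((hr.contMDiffOn _ (hfΩ p)).contMDiffAt (hr.isOpen.mem_nhds (hfΩ p))).mdifferentiableAt
      (by simp)
  have h7 := HasMFDerivAt.comp (f := fun t : ℝ => h (f p) + t • ζ p) (0 : ℝ) (by
    rw [zero_smul, add_zero]
    exact h6.hasMFDerivAt) h5.hasMFDerivAt
  have h8 := hasMFDerivAt_unique h3 (h7.congr_of_eventuallyEq h4)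
  have h9 : MDifferentiableAt J 𝓘(ℝ, 𝔼 m) h (f p) :=
    h.contMDiff.contMDiffAt.mdifferentiableAt (by simp)
  have h10 := h6.hasMFDerivAt.comp (f p) h9.hasMFDerivAt
  have h11 : r ∘ h =ᶠ[𝓝 (f p)] id := by
    filter_upwards [h.contMDiff.continuous.continuousAt.eventually (hr.isOpen.mem_nhds (hfΩ p))]
      with x hx using hr.left_inv x hx
  have h12 := hasMFDerivAt_unique h10 ((hasMFDerivAt_id (f p)).congr_of_eventuallyEq h11)
  have h13 := DFunLike.congr_fun h8 (1 : ℝ)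
  have h14 := DFunLike.congr_fun h12 (ξ p)
  refine Eq.trans h13 (Eq.trans ?_ h14)
  change mfderiv 𝓘(ℝ, 𝔼 m) J r (h (f p)) ((1 : ℝ) • ζ p) = _
  rw [one_smul]
  rfl

variable (I D k J N) in
/-- The tangent bundle of `C^k(D, N)` is `C^k(D, TN)`. -/
theorem bijOn_mderiv_eval :
    BijOn (fun (η : (ckAtlas I D k J N).TangentTotal) (p : D) =>
        (⟨η.1 p, (ckAtlas I D k J N).mderiv J (fun G : CkMap I J D N k => G p) η.1 η.2⟩ :
          TangentBundle J N))
      univ {ζ | ContMDiff I J.tangent k ζ} := by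
  refine ⟨fun η _ => contMDiff_mderiv_eval η.2, ?_, ?_⟩
  · rintro ⟨f, η⟩ - ⟨f', η'⟩ - heq
    have hff' : f = f' := by
      ext p
      exact congrArg TotalSpace.proj (congrFun heq p)
    subst hff'
    congr 1
    refine tangentSp_ext_of_eval fun p => ?_
    have := congrFun heq p
    exact eq_of_heq (TotalSpace.mk.inj this).2
  · intro ξ hξ
    have hp : ContMDiff I J k (fun p => (ξ p).proj) :=
      (contMDiff_proj (TangentSpace J)).comp hξ
    obtain ⟨η, hη⟩ := exists_mderiv_eval_eq (CkMap.mk _ hp) (fun p => (ξ p).2) hξ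
    refine ⟨⟨CkMap.mk _ hp, η⟩, mem_univ _, ?_⟩
    funext p
    change (⟨(ξ p).proj, _⟩ : TangentBundle J N) = ξ p
    exact congrArg (TotalSpace.mk (ξ p).proj) (hη p)

/-- Left-composition with a smooth function on the tangent bundle `TN` is a smooth function of the
tangent vectors of `C^k(D, N)`. -/
theorem contDiffAt_comp_mderiv_eval {W : Type} [NormedAddCommGroup W] [NormedSpace ℝ W]
    [CompleteSpace W] {α : TangentBundle J N → W} (hα : ContMDiff J.tangent 𝓘(ℝ, W) ∞ α)
    {c : BanachChart.{max uD uN, uD} (CkMap I J D N k)} (hc : c ∈ (ckAtlas I D k J N).charts)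
    {Θ : (ckAtlas I D k J N).TangentTotal → CkMap I 𝓘(ℝ, W) D W k}
    (hΘ : ∀ η p, Θ η p = α ⟨η.1 p, (ckAtlas I D k J N).mderiv J
      (fun g : CkMap I J D N k => g p) η.1 η.2⟩) {z : c.V × c.V} (hz : z.1 ∈ c.toEquiv.target) :
    ContDiffAt ℝ ∞ (fun z => Θ ((ckAtlas I D k J N).ofCoord c z)) z := by
  rcases isEmpty_or_nonempty D with hD | ⟨⟨p₀⟩⟩
  · have : (fun z => Θ ((ckAtlas I D k J N).ofCoord c z)) = fun _ => 0 := by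
      funext w
      ext p
      exact hD.elim p
    rw [this]
    exact contDiffAt_const
  have : Nonempty N := ⟨c.toEquiv.symm z.1 p₀⟩
  obtain ⟨m, h, r, Ω, hr, hΩ⟩ :=
    exists_isSmoothLeftInverse J (isCompact_range (c.toEquiv.symm z.1).contMDiff.continuous)
  -- A tangent vector of `C^k(D, N)` is represented by its base map and by the derivative of `h_*`,
  -- which varies smoothly in the chart. `β` expresses `α` in terms of these data, as `dr` recovers
  -- the tangent vectors of `N`.
  let β : N × 𝔼 m → W := fun q =>
    α ⟨r (h q.1), mfderiv 𝓘(ℝ, 𝔼 m) J r (h q.1) q.2⟩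
  have hU : IsOpen ((h ⁻¹' Ω) ×ˢ (univ : Set (𝔼 m))) :=
    (hr.isOpen.preimage h.contMDiff.continuous).prod isOpen_univ
  have hβ : ContMDiffOn (J.prod 𝓘(ℝ, 𝔼 m)) 𝓘(ℝ, W) ∞ β ((h ⁻¹' Ω) ×ˢ (univ : Set (𝔼 m))) := by
    have h1 : ContMDiff (J.prod 𝓘(ℝ, 𝔼 m)) 𝓘(ℝ, 𝔼 m × 𝔼 m) ∞
        (fun q : N × 𝔼 m => (h q.1, q.2)) :=
      (h.contMDiff.comp contMDiff_fst).prodMk_space contMDiff_snd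
    exact hα.comp_contMDiffOn (hr.contMDiffOn_tangent.comp h1.contMDiffOn
      fun q hq => ⟨hq.1, mem_univ _⟩)
  have hθ : ∀ (m' : ℕ) (h' : C^∞⟮J, N; 𝓘(ℝ, 𝔼 m'), 𝔼 m'⟯),
      ContDiffAt ℝ ∞ (fun v => leftComp I J h' (c.toEquiv.symm v)) z.1 := by
    intro m' h'
    have := IsCkChart.contDiffAt_leftComp hc (c.toEquiv.map_target hz) h'
    rwa [c.toEquiv.right_inv hz] at this
  have hu : ContDiffAt ℝ ∞ (fun z : c.V × c.V =>
      fderiv ℝ (fun v => leftComp I J h (c.toEquiv.symm v)) z.1 z.2) z :=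
    (((hθ m h).fderiv_right (m := ∞) (by simp)).comp z contDiffAt_fst).clm_apply contDiffAt_snd
  have hzU : ∀ p, (c.toEquiv.symm z.1 p,
      fderiv ℝ (fun v => leftComp I J h (c.toEquiv.symm v)) z.1 z.2 p) ∈
        (h ⁻¹' Ω) ×ˢ (univ : Set (𝔼 m)) := fun p => ⟨hΩ _ (mem_range_self p), mem_univ _⟩
  obtain ⟨hev, hd⟩ := contDiffAt_ckComp₂ hU hβ (θ := fun z : c.V × c.V => c.toEquiv.symm z.1)
    (fun m' h' => (hθ m' h').comp z contDiffAt_fst) hu hzU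
  refine hd.congr_of_eventuallyEq ?_
  have ht : ∀ᶠ w : c.V × c.V in 𝓝 z, w.1 ∈ c.toEquiv.target :=
    continuousAt_fst.eventually (c.open_target.mem_nhds hz)
  filter_upwards [hev, ht] with w hw hwt
  ext p
  rw [hΘ, ckComp₂_apply hU hβ hw, BanachAtlas.ofCoord_of_mem hc hwt]
  simp only [β]
  congr 1
  have h1 := mderiv_eval_eq hr ⟨c, hc, c.toEquiv.map_target hwt⟩
    ((ckAtlas I D k J N).mkTangent ⟨c, hc, c.toEquiv.map_target hwt⟩ w.2) (p := p) (hw p).1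
  rw [BanachAtlas.mkTangent_self] at h1
  simp only [c.toEquiv.right_inv hwt] at h1
  exact h1

end CkTangent

/-- The map is not known to be bounded beforehand; its line derivatives are computed from linearity
alone. -/
theorem IsLinearMap.fderiv_apply {V W : Type*} [NormedAddCommGroup V] [NormedSpace ℝ V]
    [NormedAddCommGroup W] [NormedSpace ℝ W] {φ : V → W} (hφ : IsLinearMap ℝ φ) {z : V}
    (hd : DifferentiableAt ℝ φ z) (v : V) : fderiv ℝ φ z v = φ v := by
  rw [← (hd.hasFDerivAt.hasLineDerivAt v).lineDeriv]
  have h1 : HasDerivAt (fun t : ℝ => φ (z + t • v)) (φ v) 0 := by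
    have : (fun t : ℝ => φ (z + t • v)) = fun t : ℝ => φ z + t • φ v := by
      funext t
      rw [hφ.map_add, hφ.map_smul]
    rw [this]
    simpa using ((hasDerivAt_id (0 : ℝ)).smul_const (φ v)).const_add (φ z)
  exact h1.deriv

/-! ### Derivatives along maps into a finite-dimensional vector bundle -/

section FiniteDimensionalBundle

/-- Needed to apply the construction of charts to `C^k(D, E)`. Points over different base points are
separated by the projection, points of the same fibre by a trivialization. -/
instance Bundle.TotalSpace.t2Space {M : Type*} [TopologicalSpace M] [T2Space M]
    {F : Type*} [TopologicalSpace F] [T2Space F] {E : M → Type*} [∀ x, TopologicalSpace (E x)]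
    [TopologicalSpace (TotalSpace F E)] [FiberBundle F E] : T2Space (TotalSpace F E) := by
  refine ⟨fun e e' hne => ?_⟩
  by_cases h : e.proj = e'.proj
  · have he := FiberBundle.mem_trivializationAt_proj_source (F := F) (E := E) (x := e)
    have he' : e' ∈ (trivializationAt F E e.proj).source := by
      rw [h]
      exact FiberBundle.mem_trivializationAt_proj_source
    set τ := trivializationAt F E e.proj
    obtain ⟨a, b, ha, hb, hea, heb, hab⟩ := t2_separation (fun h => hne (τ.injOn he he' h))
    exact ⟨_, _, τ.continuousOn_toFun.isOpen_inter_preimage τ.open_source ha,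
      τ.continuousOn_toFun.isOpen_inter_preimage τ.open_source hb, ⟨he, hea⟩, ⟨he', heb⟩,
      (hab.preimage τ).mono inter_subset_right inter_subset_right⟩
  · obtain ⟨a, b, ha, hb, hea, heb, hab⟩ := t2_separation h
    exact ⟨_, _, ha.preimage (FiberBundle.continuous_proj F E),
      hb.preimage (FiberBundle.continuous_proj F E), hea, heb, hab.preimage _⟩

variable {EM : Type*} [NormedAddCommGroup EM] [NormedSpace ℝ EM] {HM : Type*} [TopologicalSpace HM]
  {IM : ModelWithCorners ℝ EM HM} {M : Type*} [TopologicalSpace M] [ChartedSpace HM M]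
  [IsManifold IM ∞ M]
  {F : Type*} [NormedAddCommGroup F] [NormedSpace ℝ F]
  {E : M → Type*} [∀ x, AddCommGroup (E x)] [∀ x, Module ℝ (E x)]
  [∀ x, TopologicalSpace (E x)] [∀ x, IsTopologicalAddGroup (E x)]
  [∀ x, ContinuousSMul ℝ (E x)]
  [TopologicalSpace (TotalSpace F E)] [FiberBundle F E] [VectorBundle ℝ F E]
  [ContMDiffVectorBundle ∞ F E IM]
  {PE : ∀ e : TotalSpace F E, TangentSpace (IM.prod 𝓘(ℝ, F)) e →ₗ[ℝ] E e.proj}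
  {Z : Type*} [NormedAddCommGroup Z] [NormedSpace ℝ Z]

theorem mdifferentiableAt_trivialization_snd (τ : Trivialization F (π F E))
    [MemTrivializationAtlas τ] {e : TotalSpace F E} (he : e.proj ∈ τ.baseSet) :
    MDifferentiableAt (IM.prod 𝓘(ℝ, F)) 𝓘(ℝ, F) (fun z : TotalSpace F E => (τ z).2) e := by
  have h : ContMDiffAt (IM.prod 𝓘(ℝ, F)) (IM.prod 𝓘(ℝ, F)) ∞ τ e :=
    (Trivialization.contMDiffOn (n := ∞) (IB := IM) τ).contMDiffAt
      (τ.open_source.mem_nhds (τ.mem_source.2 he))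
  exact ((contMDiff_snd.contMDiffAt).comp e h).mdifferentiableAt (by simp)

/-- The Christoffel formula pulled back along a map by the chain rule. One `Γ` serves for all maps
`B`, which makes it possible to compare different sections along the same map. -/
theorem IsBundleConnection.exists_mfderiv_eq (hPE : IsBundleConnection IM F PE)
    (τ : Trivialization F (π F E)) [MemTrivializationAtlas τ] :
    ∃ Γ : ∀ x, TangentSpace IM x →L[ℝ] E x →L[ℝ] E x,
      ∀ {B : Z → TotalSpace F E} {z : Z}, MDifferentiableAt 𝓘(ℝ, Z) (IM.prod 𝓘(ℝ, F)) B z →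
        (B z).proj ∈ τ.baseSet → ∀ v : Z,
          PE (B z) (mfderiv 𝓘(ℝ, Z) (IM.prod 𝓘(ℝ, F)) B z v) =
            τ.symm (B z).proj (fderiv ℝ (fun z => (τ (B z)).2) z v) +
              Γ (B z).proj (mfderiv 𝓘(ℝ, Z) IM (fun z => (B z).proj) z v) (B z).2 := by
  obtain ⟨Γ, -, hΓ⟩ := hPE.christoffel τ
  refine ⟨Γ, fun {B z} hB hz v => ?_⟩
  rw [hΓ (B z) hz]
  have h1 := (mdifferentiableAt_trivialization_snd (IM := IM) τ hz).hasMFDerivAt.comp z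
    hB.hasMFDerivAt
  have h2 := ((mdifferentiableAt_proj E (IB := IM) (p := B z))).hasMFDerivAt.comp z
    hB.hasMFDerivAt
  congr 2
  · rw [← mfderiv_eq_fderiv]
    exact (DFunLike.congr_fun h1.mfderiv v).symm
  · exact congrArg (Γ (B z).proj) (DFunLike.congr_fun h2.mfderiv v).symm

/-- The covariant derivative of a linear family of sections along a map is linear. -/
theorem IsBundleConnection.isLinearMap_mfderiv (hPE : IsBundleConnection IM F PE)
    {G : Type*} [AddCommGroup G] [Module ℝ G] {b : Z → M} (σ : ∀ z, G →ₗ[ℝ] E (b z)) {z : Z}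
    (hσ : ∀ g, MDifferentiableAt 𝓘(ℝ, Z) (IM.prod 𝓘(ℝ, F))
      (fun z => (⟨b z, σ z g⟩ : TotalSpace F E)) z) (v : Z) :
    IsLinearMap ℝ (M := G) (M₂ := E (b z)) (fun g => PE ⟨b z, σ z g⟩
      (mfderiv 𝓘(ℝ, Z) (IM.prod 𝓘(ℝ, F)) (fun z => (⟨b z, σ z g⟩ : TotalSpace F E)) z v)) := by
  set τ := trivializationAt F E (b z)
  have hz : b z ∈ τ.baseSet := FiberBundle.mem_baseSet_trivializationAt' (b z)
  obtain ⟨Γ, hΓ⟩ := hPE.exists_mfderiv_eq (Z := Z) τ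
  have hb : ContinuousAt b z :=
    (FiberBundle.continuous_proj F E).continuousAt.comp (hσ 0).continuousAt
  have hev : ∀ᶠ y in 𝓝 z, b y ∈ τ.baseSet := hb.eventually (τ.open_baseSet.mem_nhds hz)
  have hd : ∀ g, DifferentiableAt ℝ (fun y => (τ ⟨b y, σ y g⟩).2) z := fun g =>
    (MDifferentiableAt.comp (g := fun q : TotalSpace F E => (τ q).2) z
      (mdifferentiableAt_trivialization_snd (IM := IM) τ hz) (hσ g)).differentiableAt
  have h1 : ∀ g, PE ⟨b z, σ z g⟩ (mfderiv 𝓘(ℝ, Z) (IM.prod 𝓘(ℝ, F))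
      (fun z => (⟨b z, σ z g⟩ : TotalSpace F E)) z v) =
        τ.symm (b z) (fderiv ℝ (fun y => (τ ⟨b y, σ y g⟩).2) z v) +
          Γ (b z) (mfderiv 𝓘(ℝ, Z) IM b z v) (σ z g) := fun g => hΓ (hσ g) hz v
  have hs : ∀ w, τ.symm (b z) w = τ.symmL ℝ (b z) w := fun w => (τ.symmL_apply (R := ℝ) hz w).symm
  constructor
  · intro g g'
    rw [h1, h1, h1]
    have h2 : (fun y => (τ ⟨b y, σ y (g + g')⟩).2) =ᶠ[𝓝 z]
        fun y => (τ ⟨b y, σ y g⟩).2 + (τ ⟨b y, σ y g'⟩).2 := by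
      filter_upwards [hev] with y hy
      rw [map_add]
      exact (τ.linear ℝ hy).map_add _ _
    rw [h2.fderiv_eq, fderiv_fun_add (hd g) (hd g'), map_add, map_add, hs, hs, hs, add_apply,
      map_add]
    abel
  · intro r g
    rw [h1, h1]
    have h2 : (fun y => (τ ⟨b y, σ y (r • g)⟩).2) =ᶠ[𝓝 z] fun y => r • (τ ⟨b y, σ y g⟩).2 := by
      filter_upwards [hev] with y hy
      rw [map_smul]
      exact (τ.linear ℝ hy).map_smul _ _
    rw [h2.fderiv_eq, fderiv_fun_const_smul (hd g), map_smul, map_smul, hs, hs, smul_apply, map_smul,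
      smul_add]

/-- A connection is the identity on vertical vectors. -/
theorem IsBundleConnection.mfderiv_vertical (hPE : IsBundleConnection IM F PE)
    {x : M} (σ : Z →ₗ[ℝ] E x) {z : Z}
    (hσ : MDifferentiableAt 𝓘(ℝ, Z) (IM.prod 𝓘(ℝ, F))
      (fun z => (⟨x, σ z⟩ : TotalSpace F E)) z) (v : Z) :
    PE ⟨x, σ z⟩ (mfderiv 𝓘(ℝ, Z) (IM.prod 𝓘(ℝ, F))
      (fun z => (⟨x, σ z⟩ : TotalSpace F E)) z v) = σ v := by
  set τ := trivializationAt F E x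
  have hx : x ∈ τ.baseSet := FiberBundle.mem_baseSet_trivializationAt' x
  obtain ⟨Γ, hΓ⟩ := hPE.exists_mfderiv_eq (Z := Z) τ
  refine (hΓ hσ hx v).trans ?_
  have h0 : mfderiv 𝓘(ℝ, Z) IM (fun _ : Z => x) z v = 0 := by
    rw [mfderiv_const]
    rfl
  have h1 : Γ x (mfderiv 𝓘(ℝ, Z) IM (fun _ : Z => x) z v) (σ z) = 0 := by
    rw [h0]
    simp
  refine (congrArg (_ + ·) h1).trans ?_
  rw [add_zero]
  have hd : DifferentiableAt ℝ (fun y => (τ ⟨x, σ y⟩).2) z :=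
    (MDifferentiableAt.comp (g := fun q : TotalSpace F E => (τ q).2) z
      (mdifferentiableAt_trivialization_snd (IM := IM) τ hx) hσ).differentiableAt
  have hl : IsLinearMap ℝ (fun y => (τ ⟨x, σ y⟩).2) := by
    constructor
    · intro a b
      rw [map_add]
      exact (τ.linear ℝ hx).map_add _ _
    · intro r a
      rw [map_smul]
      exact (τ.linear ℝ hx).map_smul _ _
  change τ.symm x (fderiv ℝ (fun y => (τ ⟨x, σ y⟩).2) z v) = σ v
  rw [hl.fderiv_apply hd]
  exact τ.symm_apply_apply_mk hx (σ v)

end FiniteDimensionalBundle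

/-! ### A vector bundle as a direct summand of a trivial bundle near a compact set -/

section BundleEmbedding

local notation "𝔼" m:max => EuclideanSpace ℝ (Fin m)

variable {EM : Type*} [NormedAddCommGroup EM] [NormedSpace ℝ EM] {HM : Type*} [TopologicalSpace HM]
  {IM : ModelWithCorners ℝ EM HM} {M : Type*} [TopologicalSpace M] [ChartedSpace HM M]
  {F : Type*} [NormedAddCommGroup F] [NormedSpace ℝ F]
  {E : M → Type*} [∀ x, AddCommGroup (E x)] [∀ x, Module ℝ (E x)]
  [∀ x, TopologicalSpace (E x)]
  [TopologicalSpace (TotalSpace F E)] [FiberBundle F E] [VectorBundle ℝ F E]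

theorem contMDiff_smul_linearMapAt [IsManifold IM ∞ M] [ContMDiffVectorBundle ∞ F E IM]
    (τ : Trivialization F (π F E)) [MemTrivializationAtlas τ] {ρ : M → ℝ}
    (hρ : ContMDiff IM 𝓘(ℝ) ∞ ρ) (hτ : tsupport ρ ⊆ τ.baseSet) :
    ContMDiff (IM.prod 𝓘(ℝ, F)) 𝓘(ℝ, F) ∞
      (fun e : TotalSpace F E => ρ e.proj • τ.linearMapAt ℝ e.proj e.2) := by
  intro e
  by_cases he : e.proj ∈ tsupport ρ
  · have hev : ∀ᶠ z : TotalSpace F E in 𝓝 e, z.proj ∈ τ.baseSet :=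
      (FiberBundle.continuous_proj F E).continuousAt.eventually
        (τ.open_baseSet.mem_nhds (hτ he))
    have h1 : ContMDiffAt (IM.prod 𝓘(ℝ, F)) (IM.prod 𝓘(ℝ, F)) ∞ τ e :=
      (Trivialization.contMDiffOn (n := ∞) (IB := IM) τ).contMDiffAt
        (τ.open_source.mem_nhds (τ.mem_source.2 (hτ he)))
    have h2 : ContMDiffAt (IM.prod 𝓘(ℝ, F)) 𝓘(ℝ) ∞ (fun z : TotalSpace F E => ρ z.proj) e :=
      (hρ _).comp e (contMDiffAt_proj E)
    refine (h2.smul ((contMDiff_snd.contMDiffAt).comp e h1)).congr_of_eventuallyEq ?_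
    filter_upwards [hev] with z hz
    rw [τ.coe_linearMapAt_of_mem hz]
    rfl
  · refine (contMDiffAt_const (c := (0 : F))).congr_of_eventuallyEq ?_
    filter_upwards [(FiberBundle.continuous_proj F E).continuousAt.eventually
      ((isClosed_tsupport ρ).isOpen_compl.mem_nhds he)] with z hz
    rw [image_eq_zero_of_notMem_tsupport hz, zero_smul]

/-- At a point of the support of `ρ i` the inverse of `τ i` is smooth; elsewhere the term vanishes
nearby, so the default values of `symmₗ` off the base set are harmless. Smoothness of the sum is
checked in a trivialization, where it is a sum of vectors of `F`. -/
theorem contMDiff_sum_smul_symm [IsManifold IM ∞ M] [ContMDiffVectorBundle ∞ F E IM]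
    {ι : Type*} [Fintype ι] (τ : ι → Trivialization F (π F E))
    [∀ i, MemTrivializationAtlas (τ i)] {ρ : ι → M → ℝ}
    (hρ : ∀ i, ContMDiff IM 𝓘(ℝ) ∞ (ρ i)) (hτ : ∀ i, tsupport (ρ i) ⊆ (τ i).baseSet) :
    ContMDiff (IM.prod 𝓘(ℝ, ι → F)) (IM.prod 𝓘(ℝ, F)) ∞
      (fun q : M × (ι → F) => (⟨q.1, ∑ i, ρ i q.1 • (τ i).symmₗ ℝ q.1 (q.2 i)⟩ :
        TotalSpace F E)) := by
  rintro ⟨x, v⟩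
  set τ₀ := trivializationAt F E x
  have hx : x ∈ τ₀.baseSet := FiberBundle.mem_baseSet_trivializationAt' x
  have hfst : ContMDiffAt (IM.prod 𝓘(ℝ, ι → F)) IM ∞ (Prod.fst : M × (ι → F) → M) (x, v) :=
    contMDiffAt_fst
  have hsnd : ∀ i, ContMDiffAt (IM.prod 𝓘(ℝ, ι → F)) 𝓘(ℝ, F) ∞
      (fun q : M × (ι → F) => q.2 i) (x, v) := fun i =>
    (ContinuousLinearMap.proj (R := ℝ) (φ := fun _ : ι => F) i).contMDiff.contMDiffAt.comp (x, v)
      contMDiffAt_snd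
  refine contMDiffAt_totalSpace.2 ⟨hfst, ?_⟩
  have hterm : ∀ i, ContMDiffAt (IM.prod 𝓘(ℝ, ι → F)) 𝓘(ℝ, F) ∞
      (fun q : M × (ι → F) => ρ i q.1 • (τ₀ ⟨q.1, (τ i).symmₗ ℝ q.1 (q.2 i)⟩).2) (x, v) := by
    intro i
    by_cases hi : x ∈ tsupport (ρ i)
    · have hxi := hτ i hi
      have h1 : ContMDiffAt (IM.prod 𝓘(ℝ, ι → F)) (IM.prod 𝓘(ℝ, F)) ∞
          (fun q : M × (ι → F) => (τ i).toOpenPartialHomeomorph.symm (q.1, q.2 i)) (x, v) :=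
        ContMDiffAt.comp (g := (τ i).toOpenPartialHomeomorph.symm) (x, v)
          (((τ i).contMDiffOn_symm (n := ∞) (IB := IM)).contMDiffAt
            ((τ i).open_target.mem_nhds ((τ i).mem_target.2 hxi))) (hfst.prodMk (hsnd i))
      have h2 : (τ i).toOpenPartialHomeomorph.symm (x, v i) ∈ τ₀.source := by
        rw [τ₀.mem_source, (τ i).proj_symm_apply' hxi]
        exact hx
      have h3 : ContMDiffAt (IM.prod 𝓘(ℝ, F)) (IM.prod 𝓘(ℝ, F)) ∞ τ₀
          ((τ i).toOpenPartialHomeomorph.symm (x, v i)) :=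
        (Trivialization.contMDiffOn (n := ∞) (IB := IM) τ₀).contMDiffAt
          (τ₀.open_source.mem_nhds h2)
      have h4 := (contMDiff_snd.contMDiffAt).comp (x, v) (ContMDiffAt.comp (x, v) h3 h1)
      refine (((hρ i _).comp (x, v) hfst).smul h4).congr_of_eventuallyEq ?_
      filter_upwards [continuousAt_fst.eventually ((τ i).open_baseSet.mem_nhds hxi)] with q hq
      rw [(τ i).symmₗ_apply hq, (τ i).mk_symm hq]
      rfl
    · refine (contMDiffAt_const (c := (0 : F))).congr_of_eventuallyEq ?_
      filter_upwards [continuousAt_fst.eventually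
        ((isClosed_tsupport (ρ i)).isOpen_compl.mem_nhds hi)] with q hq
      rw [image_eq_zero_of_notMem_tsupport hq, zero_smul]
  have hsum := ContMDiffAt.sum (t := Finset.univ) fun i _ => hterm i
  refine hsum.congr_of_eventuallyEq ?_
  filter_upwards [continuousAt_fst.eventually (τ₀.open_baseSet.mem_nhds hx)] with q hq
  change (τ₀ ⟨q.1, ∑ i, ρ i q.1 • (τ i).symmₗ ℝ q.1 (q.2 i)⟩).2 = _
  have h1 : ∀ e : E q.1, (τ₀ ⟨q.1, e⟩).2 = τ₀.linearMapAt ℝ q.1 e := fun e => by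
    rw [τ₀.coe_linearMapAt_of_mem hq]
  rw [h1, map_sum]
  refine Finset.sum_congr rfl fun i _ => ?_
  rw [map_smul, ← h1]

/-- With a partition of unity `ρ` over finitely many trivializations, `a` collects the fibre
coordinates with cutoffs `χ i` and `b` adds them up with weights `ρ i`, so `b ∘ a` is multiplication
by the sum of the `ρ i`. -/
theorem exists_bundle_embedding [FiniteDimensional ℝ EM] [IM.Boundaryless] [IsManifold IM ∞ M]
    [T2Space M] [SigmaCompactSpace M] [FiniteDimensional ℝ F] [ContMDiffVectorBundle ∞ F E IM]
    {K : Set M} (hK : IsCompact K) :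
    ∃ (r : ℕ) (a : ∀ x, E x →ₗ[ℝ] 𝔼 r) (b : ∀ x, 𝔼 r →ₗ[ℝ] E x) (ψ : M → ℝ),
      ContMDiff (IM.prod 𝓘(ℝ, F)) 𝓘(ℝ, 𝔼 r) ∞ (fun e : TotalSpace F E => a e.proj e.2) ∧
      ContMDiff (IM.prod 𝓘(ℝ, 𝔼 r)) (IM.prod 𝓘(ℝ, F)) ∞
        (fun q : M × 𝔼 r => (⟨q.1, b q.1 q.2⟩ : TotalSpace F E)) ∧
      ContMDiff IM 𝓘(ℝ) ∞ ψ ∧ (∀ x e, b x (a x e) = ψ x • e) ∧ ∀ x ∈ K, ψ x = 1 := by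
  obtain ⟨t, ht⟩ := hK.elim_nhds_subcover (fun x => (trivializationAt F E x).baseSet)
    fun x _ => (trivializationAt F E x).open_baseSet.mem_nhds
      (FiberBundle.mem_baseSet_trivializationAt' x)
  let τ : t → Trivialization F (π F E) := fun i => trivializationAt F E i.1
  obtain ⟨ρ, hρ⟩ := SmoothPartitionOfUnity.exists_isSubordinate IM hK.isClosed
    (fun i : t => (τ i).baseSet) (fun i => (τ i).open_baseSet) (by
      intro x hx
      obtain ⟨i, hi, hxi⟩ := mem_iUnion₂.1 (ht.2 hx)
      exact mem_iUnion.2 ⟨⟨i, hi⟩, hxi⟩)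
  have : LocallyCompactSpace M := Manifold.locallyCompact_of_finiteDimensional IM
  -- The cutoff equals `1` on the support of `ρ i`, so that `ρ i * χ i = ρ i` and the cutoffs
  -- disappear from `b ∘ a`.
  have hχ : ∀ i, ∃ χ : C^∞⟮IM, M; 𝓘(ℝ), ℝ⟯, tsupport χ ⊆ (τ i).baseSet ∧
      ∀ x ∈ tsupport (ρ i), χ x = 1 := by
    intro i
    obtain ⟨χ, h0, h1, -⟩ := exists_contMDiffMap_zero_one_nhds_of_isClosed (n := (⊤ : ℕ∞)) IM
      (τ i).open_baseSet.isClosed_compl (isClosed_tsupport (ρ i))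
      (disjoint_compl_left_iff_subset.2 (hρ i))
    refine ⟨χ, fun x hx => ?_, fun x hx => h1.self_of_nhdsSet x hx⟩
    by_contra hxb
    have h2 : ∀ᶠ y in 𝓝 x, χ y = 0 := (eventually_nhdsSet_iff_forall.1 h0) x hxb
    exact (notMem_tsupport_iff_eventuallyEq.2 h2) hx
  choose χ hχ hχ1 using hχ
  let φ := toEuclidean (E := t → F)
  have hφ : ContMDiff 𝓘(ℝ, t → F) 𝓘(ℝ, 𝔼 (Module.finrank ℝ (t → F))) ∞ φ :=
    φ.toContinuousLinearMap.contMDiff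
  have hφ' : ContMDiff 𝓘(ℝ, 𝔼 (Module.finrank ℝ (t → F))) 𝓘(ℝ, t → F) ∞ φ.symm :=
    φ.symm.toContinuousLinearMap.contMDiff
  refine ⟨Module.finrank ℝ (t → F),
    fun x => φ.toLinearMap ∘ₗ LinearMap.pi fun i => χ i x • (τ i).linearMapAt ℝ x,
    fun x => (∑ i, ρ i x • ((τ i).symmₗ ℝ x ∘ₗ LinearMap.proj i)) ∘ₗ φ.symm.toLinearMap,
    fun x => ∑ i, ρ i x, ?_, ?_, ?_, ?_, ?_⟩
  · refine hφ.comp (contMDiff_pi_space.2 fun i => ?_)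
    exact contMDiff_smul_linearMapAt (τ i) (χ i).contMDiff (hχ i)
  · have h1 := (contMDiff_sum_smul_symm (F := F) (E := E) (IM := IM) τ
      (fun i => (ρ i).contMDiff) hρ).comp
        ((contMDiff_fst (M := M) (I := IM)).prodMk (hφ'.comp contMDiff_snd))
    refine h1.congr fun q => ?_
    simp
  · exact ContMDiff.sum fun i _ => (ρ i).contMDiff
  · intro x e
    simp only [LinearMap.comp_apply, LinearMap.sum_apply, LinearMap.smul_apply,
      LinearMap.proj_apply, Finset.sum_smul]
    refine Finset.sum_congr rfl fun i _ => ?_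
    have h1 : φ.symm.toLinearMap (φ.toLinearMap
        ((LinearMap.pi fun i => χ i x • (τ i).linearMapAt ℝ x) e)) =
          (LinearMap.pi fun i => χ i x • (τ i).linearMapAt ℝ x) e := φ.symm_apply_apply _
    rw [h1, LinearMap.pi_apply, LinearMap.smul_apply]
    by_cases hx : x ∈ tsupport (ρ i)
    · rw [hχ1 i x hx, one_smul, (τ i).symmₗ_linearMapAt (hρ i hx)]
    · rw [image_eq_zero_of_notMem_tsupport hx, zero_smul, zero_smul]
  · intro x hx
    have := ρ.sum_eq_one hx
    rwa [finsum_eq_sum_of_fintype] at this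

end BundleEmbedding

/-! ### Local trivializations of `C^k(D, E) → C^k(D, M)` -/

section CkMulOp

universe uD uN

local notation "𝔼" m:max => EuclideanSpace ℝ (Fin m)

variable {ED : Type*} [NormedAddCommGroup ED] [NormedSpace ℝ ED] [FiniteDimensional ℝ ED]
  {HD : Type*} [TopologicalSpace HD] {I : ModelWithCorners ℝ ED HD}
  {D : Type uD} [TopologicalSpace D] [ChartedSpace HD D] [CompactSpace D]
  [IsManifold I ∞ D] {k : ℕ}
  {EN : Type*} [NormedAddCommGroup EN] [NormedSpace ℝ EN]
  {HN : Type*} [TopologicalSpace HN] {J : ModelWithCorners ℝ EN HN}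
  {N : Type uN} [TopologicalSpace N] [ChartedSpace HN N]
  [FiniteDimensional ℝ EN] [IsManifold J ∞ N] [J.Boundaryless] [T2Space N]
  {Y W : Type} [NormedAddCommGroup Y] [NormedSpace ℝ Y] [CompleteSpace Y]
  [NormedAddCommGroup W] [NormedSpace ℝ W] [CompleteSpace W]
  {Z : Type*} [NormedAddCommGroup Z] [NormedSpace ℝ Z]

theorem contDiffAt_ckComp₂_of_contMDiff {β : N × Y → W}
    (hβ : ContMDiff (J.prod 𝓘(ℝ, Y)) 𝓘(ℝ, W) ∞ β) {θ : Z → CkMap I J D N k}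
    {u : Z → CkMap I 𝓘(ℝ, Y) D Y k} {z : Z}
    (hθ : ∀ (m : ℕ) (h : C^∞⟮J, N; 𝓘(ℝ, 𝔼 m), 𝔼 m⟯),
      ContDiffAt ℝ ∞ (fun w => leftComp I J h (θ w)) z) (hu : ContDiffAt ℝ ∞ u z)
    {Θ : Z → CkMap I 𝓘(ℝ, W) D W k} (hΘ : ∀ w p, Θ w p = β (θ w p, u w p)) :
    ContDiffAt ℝ ∞ Θ z := by
  have h : Θ = fun w => ckComp₂ β (θ w) (u w) := by
    funext w
    ext p
    rw [hΘ, ckComp₂_apply isOpen_univ hβ.contMDiffOn fun _ => mem_univ _]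
  rw [h]
  exact (contDiffAt_ckComp₂ isOpen_univ hβ.contMDiffOn hθ hu fun _ => mem_univ _).2

/-- The operator from `C^k(D, Y)` to `C^k(D, W)` given by a family of linear maps that depends
smoothly on a point of `N`, along a map from `D` to `N`. -/
def ckMulOp {q : N → Y →ₗ[ℝ] W}
    (hq : ContMDiff (J.prod 𝓘(ℝ, Y)) 𝓘(ℝ, W) ∞ (fun z : N × Y => q z.1 z.2))
    (f : CkMap I J D N k) : CkMap I 𝓘(ℝ, Y) D Y k →L[ℝ] CkMap I 𝓘(ℝ, W) D W k where
  toFun u := CkMap.mk (fun p => q (f p) (u p))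
    ((hq.of_le (by exact_mod_cast le_top)).comp (f.contMDiff.prodMk u.contMDiff))
  map_add' u v := by
    ext p
    exact (q (f p)).map_add _ _
  map_smul' r u := by
    ext p
    exact (q (f p)).map_smul _ _
  cont := continuous_iff_continuousAt.2 fun _ => (contDiffAt_ckComp₂_of_contMDiff hq
    (θ := fun _ => f) (fun _ _ => contDiffAt_const) contDiffAt_id fun _ _ => rfl).continuousAt

/-- Smoothness in the operator norm, from joint smoothness in `w` and `u`: the operator is linear in
`u`, hence equals its own partial derivative at `u = 0`, which depends smoothly on `w`. -/
theorem contDiffAt_ckMulOp {q : N → Y →ₗ[ℝ] W}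
    (hq : ContMDiff (J.prod 𝓘(ℝ, Y)) 𝓘(ℝ, W) ∞ (fun z : N × Y => q z.1 z.2))
    {θ : Z → CkMap I J D N k} {z : Z}
    (hθ : ∀ (m : ℕ) (h : C^∞⟮J, N; 𝓘(ℝ, 𝔼 m), 𝔼 m⟯),
      ContDiffAt ℝ ∞ (fun w => leftComp I J h (θ w)) z) :
    ContDiffAt ℝ ∞ (fun w => ckMulOp hq (θ w)) z := by
  have h1 : ContDiffAt ℝ ∞ (Function.uncurry fun (w : Z) (u : CkMap I 𝓘(ℝ, Y) D Y k) =>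
      ckMulOp hq (θ w) u) (z, 0) :=
    contDiffAt_ckComp₂_of_contMDiff hq (θ := fun x : Z × _ => θ x.1) (u := Prod.snd)
      (fun m h => (hθ m h).comp (z, (0 : CkMap I 𝓘(ℝ, Y) D Y k)) contDiffAt_fst) contDiffAt_snd
      fun _ _ => rfl
  have h2 := ContDiffAt.fderiv (g := fun _ => 0) h1 contDiffAt_const (m := ∞) (by simp)
  refine h2.congr_of_eventuallyEq (Eventually.of_forall fun w => ?_)
  exact (ContinuousLinearMap.fderiv _).symm

end CkMulOp

/-! ### A trivialization around a given map -/

section CkLocalTriv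

universe uD uM

local notation "𝔼" m:max => EuclideanSpace ℝ (Fin m)

variable {ED : Type*} [NormedAddCommGroup ED] [NormedSpace ℝ ED] [FiniteDimensional ℝ ED]
  {HD : Type*} [TopologicalSpace HD] {I : ModelWithCorners ℝ ED HD}
  {D : Type uD} [TopologicalSpace D] [ChartedSpace HD D] [CompactSpace D]
  [IsManifold I ∞ D] {k : ℕ}
  {EM : Type*} [NormedAddCommGroup EM] [NormedSpace ℝ EM] [FiniteDimensional ℝ EM]
  {HM : Type*} [TopologicalSpace HM]
  {IM : ModelWithCorners ℝ EM HM} [IM.Boundaryless]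
  {M : Type uM} [TopologicalSpace M] [ChartedSpace HM M] [IsManifold IM ∞ M] [T2Space M]
  {F : Type*} [NormedAddCommGroup F] [NormedSpace ℝ F] [FiniteDimensional ℝ F]
  {E : M → Type*} [∀ x, AddCommGroup (E x)] [∀ x, Module ℝ (E x)]
  [∀ x, TopologicalSpace (E x)]
  [TopologicalSpace (TotalSpace F E)] [FiberBundle F E] [VectorBundle ℝ F E]
  [ContMDiffVectorBundle ∞ F E IM]

theorem contDiffAt_leftComp_ckProj
    {c : BanachChart (CkMap I (IM.prod 𝓘(ℝ, F)) D (TotalSpace F E) k)}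
    (hc : c ∈ (ckBundle I D k IM F E).total.charts)
    {G : CkMap I (IM.prod 𝓘(ℝ, F)) D (TotalSpace F E) k} (hG : G ∈ c.toEquiv.source) {m : ℕ}
    (h : C^∞⟮IM, M; 𝓘(ℝ, 𝔼 m), 𝔼 m⟯) :
    ContDiffAt ℝ ∞ (fun v => leftComp I IM h (ckProj I IM F E (c.toEquiv.symm v)))
      (c.toEquiv G) :=
  IsCkChart.contDiffAt_leftComp hc hG (h.comp ⟨TotalSpace.proj, contMDiff_proj E⟩)

/-- Let `Q f` be the multiplication by `a ∘ b` along `f`. Then `T = Q f₀` is a projection, as `ψ =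
1` along `f₀`, and its image `E₀` is a copy of the sections along `f₀`. The trivialization is `u ↦ b
u` on `E₀`; it is inverted by correcting `a σ` with the operator `A f`, which is the identity at
`f₀` and so invertible nearby. -/
theorem exists_localTriv [SigmaCompactSpace M] (f₀ : CkMap I IM D M k) :
    ∃ t : (ckBundle I D k IM F E).LocalTriv, f₀ ∈ t.U := by
  obtain ⟨r, a, b, ψ, ha, hb, hψ, hba, hψ1⟩ := exists_bundle_embedding (IM := IM) (F := F) (E := E)
    (isCompact_range f₀.contMDiff.continuous)
  let q : M → 𝔼 r →ₗ[ℝ] 𝔼 r := fun x => a x ∘ₗ b x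
  let q' : M → 𝔼 r →ₗ[ℝ] 𝔼 r := fun x => ψ x • LinearMap.id
  have hQ : ContMDiff (IM.prod 𝓘(ℝ, 𝔼 r)) 𝓘(ℝ, 𝔼 r) ∞ (fun z : M × 𝔼 r => q z.1 z.2) :=
    ha.comp hb
  have hΨ : ContMDiff (IM.prod 𝓘(ℝ, 𝔼 r)) 𝓘(ℝ, 𝔼 r) ∞ (fun z : M × 𝔼 r => q' z.1 z.2) :=
    (hψ.comp contMDiff_fst).smul contMDiff_snd
  set X := CkMap I 𝓘(ℝ, 𝔼 r) D (𝔼 r) k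
  set T : X →L[ℝ] X := ckMulOp (q := q) hQ f₀
  have hψ0 : ∀ p, ψ (f₀ p) = 1 := fun p => hψ1 _ (mem_range_self p)
  have hT : ∀ u, T (T u) = T u := by
    intro u
    ext1 p
    change a (f₀ p) (b (f₀ p) (a (f₀ p) (b (f₀ p) (u p)))) = a (f₀ p) (b (f₀ p) (u p))
    rw [hba, hψ0, one_smul]
  let E₀ : Submodule ℝ X := LinearMap.ker (T - 1 : X →L[ℝ] X).toLinearMap
  have hE₀ : ∀ u, u ∈ E₀ ↔ T u = u := fun u => by
    rw [LinearMap.mem_ker]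
    exact sub_eq_zero
  have hclosed : IsClosed (E₀ : Set X) := (T - 1 : X →L[ℝ] X).isClosed_ker
  have : CompleteSpace E₀ := hclosed.completeSpace_coe
  let P₀ : X →L[ℝ] E₀ := T.codRestrict E₀ fun u => (hE₀ _).2 (hT u)
  -- The standard operator that intertwines two nearby projections, with `ψ - a b` in place of `1 -
  -- a b`: since `b ∘ a = ψ` also where `ψ ≠ 1`, the map `b` annihilates `ψ - a b` along every `f`.
  let A : CkMap I IM D M k → X →L[ℝ] X := fun f =>
    ckMulOp (q := q) hQ f * T + (ckMulOp (q := q') hΨ f - ckMulOp (q := q) hQ f) * (1 - T)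
  have hA : ∀ f u p, A f u p = a (f p) (b (f p) (T u p)) +
      (ψ (f p) • (u p - T u p) - a (f p) (b (f p) (u p - T u p))) := fun f u p => rfl
  have hAsm : ∀ {Z : Type uD} [NormedAddCommGroup Z] [NormedSpace ℝ Z]
      {θ : Z → CkMap I IM D M k} {z : Z}, (∀ (m : ℕ) (h : C^∞⟮IM, M; 𝓘(ℝ, 𝔼 m), 𝔼 m⟯),
        ContDiffAt ℝ ∞ (fun w => leftComp I IM h (θ w)) z) →
      ContDiffAt ℝ ∞ (fun w => A (θ w)) z := fun hθ =>
    ((contDiffAt_ckMulOp (q := q) hQ hθ).mul contDiffAt_const).add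
      (((contDiffAt_ckMulOp (q := q') hΨ hθ).sub (contDiffAt_ckMulOp (q := q) hQ hθ)).mul contDiffAt_const)
  have hA0 : A f₀ = 1 := by
    ext1 u
    ext1 p
    have h1 : a (f₀ p) (b (f₀ p) (T u p)) = T u p := congrArg (fun u : X => u p) (hT u)
    rw [hA, map_sub, map_sub, h1, hψ0, one_smul]
    change T u p + (u p - T u p - (T u p - T u p)) = u p
    abel
  let aOp : ∀ f : CkMap I IM D M k, ckFiber I IM F E f →ₗ[ℝ] X := fun f =>
    { toFun := fun σ => CkMap.mk (fun p => a (f p) (σ.1 p))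
        ((ha.of_le (by exact_mod_cast le_top)).comp σ.2)
      map_add' := fun σ σ' => by
        ext1 p
        exact (a (f p)).map_add _ _
      map_smul' := fun r σ => by
        ext1 p
        exact (a (f p)).map_smul _ _ }
  let s : ∀ f : CkMap I IM D M k, E₀ →ₗ[ℝ] ckFiber I IM F E f := fun f =>
    { toFun := fun u => ⟨fun p => b (f p) (u.1 p),
        (hb.of_le (by exact_mod_cast le_top)).comp (f.contMDiff.prodMk u.1.contMDiff)⟩
      map_add' := fun u v => by
        ext p
        exact (b (f p)).map_add _ _
      map_smul' := fun r u => by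
        ext p
        exact (b (f p)).map_smul _ _ }
  refine ⟨{ E₀ := E₀
            U := {f | (∀ p, ψ (f p) ≠ 0) ∧ IsUnit (A f)}
            open_U := ?_
            s := s
            inv := fun f => P₀.toLinearMap ∘ₗ (Ring.inverse (A f)).toLinearMap ∘ₗ aOp f
            inv_s := ?_
            s_inv := ?_
            smooth_s := ?_
            smooth_inv := ?_ }, fun p => ?_, ?_⟩
  · intro c hc
    rw [isOpen_iff_mem_nhds]
    rintro v ⟨hv, hv1, hv2⟩
    have hθ : ∀ (m : ℕ) (h : C^∞⟮IM, M; 𝓘(ℝ, 𝔼 m), 𝔼 m⟯),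
        ContDiffAt ℝ ∞ (fun w => leftComp I IM h (c.toEquiv.symm w)) v := by
      intro m h
      have := IsCkChart.contDiffAt_leftComp hc (c.toEquiv.map_target hv) h
      rwa [c.toEquiv.right_inv hv] at this
    have hO : IsOpen ({x | ψ x ≠ 0} ×ˢ (univ : Set ℝ)) :=
      (isOpen_ne.preimage hψ.continuous).prod isOpen_univ
    -- The zero map serves as `β` because only the first conclusion is wanted: the condition `ψ (f
    -- p) ≠ 0` for all `p` persists under small changes of `f`.
    have h1 := (contDiffAt_ckComp₂ (I := I) (k := k) (W := ℝ) hO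
      (contMDiffOn_const (c := (0 : ℝ))) hθ (contDiffAt_const (c := 0))
      fun p => ⟨hv1 p, mem_univ _⟩).1
    have h2 := (hAsm hθ).continuousAt.eventually (Units.isOpen.mem_nhds hv2)
    filter_upwards [c.open_target.mem_nhds hv, h1, h2] with w hw hw1 hw2
    exact ⟨hw, fun p => (hw1 p).1, hw2⟩
  · rintro f ⟨-, hf⟩ u
    have hu : T u.1 = u.1 := (hE₀ _).1 u.2
    have h1 : aOp f (s f u) = A f u.1 := by
      ext1 p
      rw [hA, hu, sub_self, smul_zero, map_zero, map_zero, sub_zero, add_zero]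
      rfl
    have h2 : Ring.inverse (A f) (A f u.1) = u.1 :=
      DFunLike.congr_fun (Ring.inverse_mul_cancel _ hf) u.1
    apply Subtype.ext
    change T (Ring.inverse (A f) (aOp f (s f u))) = u.1
    rw [h1, h2, hu]
  · rintro f ⟨hf0, hf⟩ σ
    set w := Ring.inverse (A f) (aOp f σ)
    have hw : A f w = aOp f σ := DFunLike.congr_fun (Ring.mul_inverse_cancel _ hf) (aOp f σ)
    apply Subtype.ext
    funext p
    change b (f p) (T w p) = σ.1 p
    -- The left side is `ψ b (T w)`, as `b` annihilates the second summand of `A f w`; the right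
    -- side is `ψ σ`. The factor `ψ (f p)` is not zero and cancels.
    have h1 : b (f p) (A f w p) = b (f p) (a (f p) (σ.1 p)) := by
      rw [hw]
      rfl
    rw [hA, map_add, map_sub, hba, hba, hba, map_smul, sub_self, add_zero] at h1
    exact smul_right_injective _ (hf0 p) h1
  · rintro f - u
    obtain ⟨c, hc, hf⟩ := exists_isCkChart (I := I) (J := IM) f
    refine smoothAt_ckAtlas_of_leftComp
      (BanachAtlas.mem_charts_prod hc (BanachAtlas.mem_charts_ofSpace E₀)) ⟨hf, mem_univ _⟩
      fun m h => ?_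
    exact contDiffAt_ckComp₂_of_contMDiff (h.contMDiff.comp hb)
      (θ := fun v : c.V × E₀ => c.toEquiv.symm v.1) (u := fun v => v.2.1)
      (fun m' h' => ContDiffAt.comp (x := (c.toEquiv f, u))
        (IsCkChart.contDiffAt_leftComp hc hf h') contDiffAt_fst)
      (E₀.subtypeL.contDiff.contDiffAt.comp _ contDiffAt_snd) fun _ _ => rfl
  · rintro G ⟨-, hG⟩
    obtain ⟨c, hc, hGc⟩ := exists_isCkChart (I := I) (J := IM.prod 𝓘(ℝ, F)) G
    refine ⟨c, hc, _, BanachAtlas.mem_charts_ofSpace E₀, hGc, mem_univ _,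
      Eventually.of_forall fun _ => mem_univ _, ?_⟩
    have h1 := hAsm (θ := fun v => ckProj I IM F E (c.toEquiv.symm v)) (z := c.toEquiv G)
      fun m h => contDiffAt_leftComp_ckProj hc hGc h
    have h2 : IsUnit (A (ckProj I IM F E (c.toEquiv.symm (c.toEquiv G)))) := by
      rw [c.toEquiv.left_inv hGc]
      exact hG
    obtain ⟨y, hy⟩ := h2
    have h3 := ContDiffAt.comp (c.toEquiv G) (g := Ring.inverse) (by
      rw [← hy]
      exact contDiffAt_ringInverse ℝ y) h1
    exact P₀.contDiff.contDiffAt.comp _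
      (h3.clm_apply (IsCkChart.contDiffAt_leftComp hc hGc ⟨_, ha⟩))
  · rw [hψ0]
    exact one_ne_zero
  · rw [hA0]
    exact isUnit_one

variable (I D k IM F E) in
/-- `C^k(D, E) → C^k(D, M)` is a Banach vector bundle. -/
theorem isBanachVectorBundle_ckBundle [SigmaCompactSpace M] :
    (ckBundle I D k IM F E).IsBanachVectorBundle where
  base_manifold := isBanachManifold_ckAtlas
  total_manifold := isBanachManifold_ckAtlas
  trivial := exists_localTriv

end CkLocalTriv

/-! ### Families of bilinear maps -/

/-- A bilinear map is recovered by differentiating at `0` in `u` and then in `v`. Partial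
derivatives of a jointly smooth map are smooth with values in spaces of bounded operators, so
smoothness at `(z, 0, 0)` is enough and boundedness comes for free. -/
theorem exists_contDiffOn_bilinear {Z V U W : Type*} [NormedAddCommGroup Z] [NormedSpace ℝ Z]
    [NormedAddCommGroup V] [NormedSpace ℝ V] [NormedAddCommGroup U] [NormedSpace ℝ U]
    [NormedAddCommGroup W] [NormedSpace ℝ W] {Ψ : Z → V → U → W} {O : Set Z}
    (hΨ : ∀ z ∈ O, ContDiffAt ℝ ∞ (fun q : Z × V × U => Ψ q.1 q.2.1 q.2.2) (z, 0, 0))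
    (h1 : ∀ z ∈ O, ∀ u, IsLinearMap ℝ (fun v => Ψ z v u))
    (h2 : ∀ z ∈ O, ∀ v, IsLinearMap ℝ (Ψ z v)) :
    ∃ γ : Z → V →L[ℝ] U →L[ℝ] W, ContDiffOn ℝ ∞ γ O ∧ ∀ z ∈ O, ∀ v u, γ z v u = Ψ z v u := by
  have hA : ∀ z ∈ O, ContDiffAt ℝ ∞ (Function.uncurry fun (z : Z) (v : V) =>
      fderiv ℝ (Ψ z v) 0) (z, 0) := by
    intro z hz
    have h3 : ContDiffAt ℝ ∞ (Function.uncurry fun (q : Z × V) (u : U) => Ψ q.1 q.2 u)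
        ((z, 0), 0) :=
      ContDiffAt.comp (g := fun q : Z × V × U => Ψ q.1 q.2.1 q.2.2)
        (f := fun q : (Z × V) × U => (q.1.1, q.1.2, q.2)) ((z, (0 : V)), (0 : U)) (hΨ z hz)
        (contDiff_fst.fst.prodMk (contDiff_fst.snd.prodMk contDiff_snd)).contDiffAt
    exact ContDiffAt.fderiv (g := fun _ => 0) h3 contDiffAt_const (by simp)
  refine ⟨fun z => fderiv ℝ (fun v => fderiv ℝ (Ψ z v) 0) 0, fun z hz =>
    (ContDiffAt.fderiv (g := fun _ => 0) (hA z hz) contDiffAt_const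
      (by simp)).contDiffWithinAt, fun z hz v u => ?_⟩
  have h3 : DifferentiableAt ℝ (fun v => fderiv ℝ (Ψ z v) 0) 0 :=
    ((hA z hz).comp (0 : V) (contDiffAt_const.prodMk contDiffAt_id)).differentiableAt (by simp)
  have h4 : ∀ᶠ v in 𝓝 (0 : V), DifferentiableAt ℝ (Ψ z v) 0 := by
    -- The inner derivative must equal `Ψ z v` for all `v` near `0`, so differentiability at `(z, 0,
    -- 0)` is first spread to nearby points.
    have h5 := ((hΨ z hz).of_le (m := 1) (by exact_mod_cast le_top)).eventually (by simp)
    have h6 : Tendsto (fun v : V => (z, v, (0 : U))) (𝓝 0) (𝓝 (z, 0, 0)) :=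
      (by fun_prop : Continuous fun v : V => (z, v, (0 : U))).tendsto 0
    filter_upwards [h6.eventually h5] with v hv
    exact (hv.comp (0 : U) (contDiffAt_const.prodMk
      (contDiffAt_const.prodMk contDiffAt_id))).differentiableAt (by simp)
  have h5 := (h3.hasFDerivAt.hasLineDerivAt v)
  have h6 := (ContinuousLinearMap.apply ℝ W u).hasFDerivAt.comp_hasDerivAt (0 : ℝ) h5
  have h7 : HasDerivAt (fun t : ℝ => t • Ψ z v u) (Ψ z v u) 0 := by
    simpa using (hasDerivAt_id (0 : ℝ)).smul_const (Ψ z v u)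
  refine h6.unique (h7.congr_of_eventuallyEq ?_)
  have h8 : Tendsto (fun t : ℝ => (0 : V) + t • v) (𝓝 0) (𝓝 0) := by
    have : Continuous (fun t : ℝ => (0 : V) + t • v) := by fun_prop
    simpa using this.tendsto 0
  filter_upwards [h8.eventually h4] with t ht
  change fderiv ℝ (Ψ z (0 + t • v)) 0 u = _
  rw [(h2 z hz _).fderiv_apply ht, zero_add]
  exact (h1 z hz u).map_smul t v

/-! ### Tangent maps -/

namespace BanachAtlas

section TangentMaps

universe v

variable {X : Type u} {Y : Type u'} {A : BanachAtlas.{u, w} X} {B : BanachAtlas.{u', w} Y}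

theorem SmoothAt.comp {X' : Type v} {A' : BanachAtlas.{v, w} X'} {f : X → Y} {g : Y → X'} {x : X}
    (hg : B.SmoothAt A' g (f x)) (hf : A.SmoothAt B f x) : A.SmoothAt A' (fun x => g (f x)) x := by
  obtain ⟨a, ha, -, -, hxa, -⟩ := id hf
  obtain ⟨b, hb, c, hc, hxb, hxc, hev, hd⟩ := hg
  obtain ⟨hev', hd'⟩ := hf.contDiffAt ha hb hxa hxb
  have e0 : b.toEquiv (f (a.toEquiv.symm (a.toEquiv x))) = b.toEquiv (f x) := by
    rw [a.toEquiv.left_inv hxa]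
  have ht : Tendsto (fun v => b.toEquiv (f (a.toEquiv.symm v))) (𝓝 (a.toEquiv x))
      (𝓝 (b.toEquiv (f x))) := by
    have := hd'.continuousAt.tendsto
    rwa [e0] at this
  refine ⟨a, ha, c, hc, hxa, hxc, ?_, ?_⟩
  · filter_upwards [hev', ht.eventually hev] with v hv hv'
    rwa [b.toEquiv.left_inv hv] at hv'
  · refine (ContDiffAt.comp (a.toEquiv x) (e0 ▸ hd) hd').congr_of_eventuallyEq ?_
    filter_upwards [hev'] with v hv
    simp only [Function.comp]
    rw [b.toEquiv.left_inv hv]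

variable {EN : Type*} [NormedAddCommGroup EN] [NormedSpace ℝ EN] {HN : Type*} [TopologicalSpace HN]
  {J : ModelWithCorners ℝ EN HN} {N : Type*} [TopologicalSpace N] [ChartedSpace HN N]

theorem mderiv_add {g : Y → N} (hg : B.SmoothInto J g) {y : Y} (c : B.ChartAt y)
    (η η' : B.TangentSp y) : B.mderiv J g y (η + η') = B.mderiv J g y η + B.mderiv J g y η' := by
  rw [mderiv_apply hg c, mderiv_apply hg c, mderiv_apply hg c]
  exact (mfderiv 𝓘(ℝ, c.1.V) J (fun v => g (c.1.toEquiv.symm v)) (c.1.toEquiv y)).map_add _ _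

theorem mderiv_smul {g : Y → N} (hg : B.SmoothInto J g) {y : Y} (c : B.ChartAt y) (r : ℝ)
    (η : B.TangentSp y) : B.mderiv J g y (r • η) = r • B.mderiv J g y η := by
  rw [mderiv_apply hg c, mderiv_apply hg c]
  exact (mfderiv 𝓘(ℝ, c.1.V) J (fun v => g (c.1.toEquiv.symm v)) (c.1.toEquiv y)).map_smul _ _

variable {Z : Type*} [NormedAddCommGroup Z] [NormedSpace ℝ Z]

theorem mdifferentiableAt_comp {g : Y → N} (hg : B.SmoothInto J g) {S : Z → Y} {z : Z}
    (c : B.ChartAt (S z)) (hS : ∀ᶠ w in 𝓝 z, S w ∈ c.1.toEquiv.source)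
    (hd : DifferentiableAt ℝ (fun w => c.1.toEquiv (S w)) z) :
    MDifferentiableAt 𝓘(ℝ, Z) J (fun w => g (S w)) z := by
  have h1 := (hg.contMDiffAt c.2.1 c.2.2).mdifferentiableAt (by simp)
  refine (MDifferentiableAt.comp (f := fun w => c.1.toEquiv (S w)) z h1
    hd.mdifferentiableAt).congr_of_eventuallyEq ?_
  filter_upwards [hS] with w hw
  simp only [Function.comp]
  rw [c.1.toEquiv.left_inv hw]

theorem mderiv_mkTangent_fderiv {g : Y → N} (hg : B.SmoothInto J g) {S : Z → Y} {z : Z}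
    (c : B.ChartAt (S z)) (hS : ∀ᶠ w in 𝓝 z, S w ∈ c.1.toEquiv.source)
    (hd : DifferentiableAt ℝ (fun w => c.1.toEquiv (S w)) z) (v : Z) :
    B.mderiv J g (S z) (B.mkTangent c (fderiv ℝ (fun w => c.1.toEquiv (S w)) z v)) =
      mfderiv 𝓘(ℝ, Z) J (fun w => g (S w)) z v := by
  have h1 := ((hg.contMDiffAt c.2.1 c.2.2).mdifferentiableAt (by simp)).hasMFDerivAt
  have h2 := HasMFDerivAt.comp (f := fun w => c.1.toEquiv (S w)) z h1
    hd.hasFDerivAt.hasMFDerivAt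
  have h3 : (fun w => g (S w)) =ᶠ[𝓝 z]
      (fun y => g (c.1.toEquiv.symm y)) ∘ fun w => c.1.toEquiv (S w) := by
    filter_upwards [hS] with w hw
    simp only [Function.comp]
    rw [c.1.toEquiv.left_inv hw]
  rw [mderiv_apply hg c, mkTangent_self]
  exact (DFunLike.congr_fun (h2.congr_of_eventuallyEq h3).mfderiv v).symm

end TangentMaps

end BanachAtlas

/-! ### Smooth sections given by local trivializations -/

namespace LinearFibration.LocalTriv

section Sections

variable {X : Type u} {Y : Type u'} {L : LinearFibration.{u, u', uf, w} X Y} (t : L.LocalTriv)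

theorem contDiffAt_s {c : BanachChart.{u, w} X} (hc : c ∈ L.base.charts)
    {C : BanachChart.{u', w} Y} (hC : C ∈ L.total.charts) {z : c.V} (hz : z ∈ c.toEquiv.target)
    (hzU : c.toEquiv.symm z ∈ t.U) {e : t.E₀}
    (he : L.pt (t.s (c.toEquiv.symm z) e) ∈ C.toEquiv.source) :
    (∀ᶠ q : c.V × t.E₀ in 𝓝 (z, e), L.pt (t.s (c.toEquiv.symm q.1) q.2) ∈ C.toEquiv.source) ∧
      ContDiffAt ℝ ∞ (fun q : c.V × t.E₀ => C.toEquiv (L.pt (t.s (c.toEquiv.symm q.1) q.2)))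
        (z, e) := by
  have h1 := (t.smooth_s _ hzU e).contDiffAt
    (BanachAtlas.mem_charts_prod hc (BanachAtlas.mem_charts_ofSpace t.E₀)) hC
    ⟨c.toEquiv.map_target hz, mem_univ _⟩ he
  have h2 : (c.toEquiv (c.toEquiv.symm z), e) = (z, e) := by rw [c.toEquiv.right_inv hz]
  change (∀ᶠ q : c.V × t.E₀ in 𝓝 (c.toEquiv (c.toEquiv.symm z), e), _) ∧
    ContDiffAt ℝ ∞ _ (c.toEquiv (c.toEquiv.symm z), e) at h1
  rw [h2] at h1
  exact h1

theorem contDiffAt_s_left {c : BanachChart.{u, w} X} (hc : c ∈ L.base.charts)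
    {C : BanachChart.{u', w} Y} (hC : C ∈ L.total.charts) {z : c.V} (hz : z ∈ c.toEquiv.target)
    (hzU : c.toEquiv.symm z ∈ t.U) {e : t.E₀}
    (he : L.pt (t.s (c.toEquiv.symm z) e) ∈ C.toEquiv.source) :
    (∀ᶠ y in 𝓝 z, L.pt (t.s (c.toEquiv.symm y) e) ∈ C.toEquiv.source) ∧
      ContDiffAt ℝ ∞ (fun y => C.toEquiv (L.pt (t.s (c.toEquiv.symm y) e))) z := by
  obtain ⟨h1, h2⟩ := t.contDiffAt_s hc hC hz hzU he
  have h3 : ContDiffAt ℝ ∞ (fun y : c.V => (y, e)) z := contDiffAt_id.prodMk contDiffAt_const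
  exact ⟨h3.continuousAt.eventually h1, ContDiffAt.comp
    (g := fun q : c.V × t.E₀ => C.toEquiv (L.pt (t.s (c.toEquiv.symm q.1) q.2))) z h2 h3⟩

theorem contDiffAt_s_right {c : BanachChart.{u, w} X} (hc : c ∈ L.base.charts)
    {C : BanachChart.{u', w} Y} (hC : C ∈ L.total.charts) {z : c.V} (hz : z ∈ c.toEquiv.target)
    (hzU : c.toEquiv.symm z ∈ t.U) {e : t.E₀}
    (he : L.pt (t.s (c.toEquiv.symm z) e) ∈ C.toEquiv.source) :
    (∀ᶠ y in 𝓝 e, L.pt (t.s (c.toEquiv.symm z) y) ∈ C.toEquiv.source) ∧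
      ContDiffAt ℝ ∞ (fun y => C.toEquiv (L.pt (t.s (c.toEquiv.symm z) y))) e := by
  obtain ⟨h1, h2⟩ := t.contDiffAt_s hc hC hz hzU he
  have h3 : ContDiffAt ℝ ∞ (fun y : t.E₀ => (z, y)) e := contDiffAt_const.prodMk contDiffAt_id
  exact ⟨h3.continuousAt.eventually h1, ContDiffAt.comp
    (g := fun q : c.V × t.E₀ => C.toEquiv (L.pt (t.s (c.toEquiv.symm q.1) q.2))) e h2 h3⟩

/-- The differential of the section `y ↦ s y e`. -/
theorem tangentMap_s {c : BanachChart.{u, w} X} (hc : c ∈ L.base.charts) {z : c.V}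
    (hz : z ∈ c.toEquiv.target) (hzU : c.toEquiv.symm z ∈ t.U) {e : t.E₀}
    (C : L.total.ChartAt (L.pt (t.s (c.toEquiv.symm z) e)))
    (η : L.base.TangentSp (c.toEquiv.symm z)) :
    L.base.tangentMap L.total (fun x => L.pt (t.s x e)) (c.toEquiv.symm z) η =
      L.total.mkTangent C (fderiv ℝ (fun y => C.1.toEquiv (L.pt (t.s (c.toEquiv.symm y) e))) z
        (L.base.coord c ⟨c.toEquiv.symm z, η⟩)) := by
  have hs := c.toEquiv.map_target hz
  have h1 : L.base.SmoothAt L.total (fun x => L.pt (t.s x e)) (c.toEquiv.symm z) := by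
    obtain ⟨h2, h3⟩ := t.contDiffAt_s_left hc C.2.1 hz hzU C.2.2
    refine ⟨c, hc, C.1, C.2.1, hs, C.2.2, ?_, ?_⟩
    · rwa [c.toEquiv.right_inv hz]
    · rwa [c.toEquiv.right_inv hz]
  refine BanachAtlas.tangentSp_ext C ?_
  rw [BanachAtlas.tangentMap_apply h1 ⟨c, hc, hs⟩ C, BanachAtlas.mkTangent_self,
    BanachAtlas.coord_of_mem hc hs, c.toEquiv.right_inv hz]

end Sections

end LinearFibration.LocalTriv

/-! ### The natural connection -/

section CkConnection

universe uD uM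

local notation "𝔼" m:max => EuclideanSpace ℝ (Fin m)

variable {ED : Type*} [NormedAddCommGroup ED] [NormedSpace ℝ ED] [FiniteDimensional ℝ ED]
  {HD : Type*} [TopologicalSpace HD] {I : ModelWithCorners ℝ ED HD}
  {D : Type uD} [TopologicalSpace D] [ChartedSpace HD D] [CompactSpace D]
  [IsManifold I ∞ D] {k : ℕ}
  {EM : Type*} [NormedAddCommGroup EM] [NormedSpace ℝ EM] [FiniteDimensional ℝ EM]
  {HM : Type*} [TopologicalSpace HM]
  {IM : ModelWithCorners ℝ EM HM} [IM.Boundaryless]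
  {M : Type uM} [TopologicalSpace M] [ChartedSpace HM M] [IsManifold IM ∞ M] [T2Space M]
  {F : Type*} [NormedAddCommGroup F] [NormedSpace ℝ F] [FiniteDimensional ℝ F]
  {E : M → Type*} [∀ x, AddCommGroup (E x)] [∀ x, Module ℝ (E x)]
  [∀ x, TopologicalSpace (E x)] [∀ x, IsTopologicalAddGroup (E x)]
  [∀ x, ContinuousSMul ℝ (E x)]
  [TopologicalSpace (TotalSpace F E)] [FiberBundle F E] [VectorBundle ℝ F E]
  [ContMDiffVectorBundle ∞ F E IM]
  {PE : ∀ e : TotalSpace F E, TangentSpace (IM.prod 𝓘(ℝ, F)) e →ₗ[ℝ] E e.proj}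

local notation "𝓛" => ckBundle I D k IM F E

theorem smoothInto_eval_total (p : D) :
    (𝓛).total.SmoothInto (IM.prod 𝓘(ℝ, F))
      (fun G : CkMap I (IM.prod 𝓘(ℝ, F)) D (TotalSpace F E) k => G p) :=
  smoothInto_eval p

theorem exists_chartAt_total (G : CkMap I (IM.prod 𝓘(ℝ, F)) D (TotalSpace F E) k) :
    Nonempty ((𝓛).total.ChartAt G) := by
  obtain ⟨c, hc, hG⟩ := exists_isCkChart (I := I) (J := IM.prod 𝓘(ℝ, F)) G
  exact ⟨c, hc, hG⟩

variable (I D k) in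
/-- Left-composition with the connection `PE`. -/
def ckConnection (hPE : IsBundleConnection IM F PE)
    (G : CkMap I (IM.prod 𝓘(ℝ, F)) D (TotalSpace F E) k) :
    (𝓛).total.TangentSp G →ₗ[ℝ] (𝓛).Fib ((𝓛).proj G) where
  toFun η := ⟨fun p => PE (G p) ((𝓛).total.mderiv (IM.prod 𝓘(ℝ, F)) (fun G => G p) G η),
    (hPE.smooth.of_le (m := k) (by exact_mod_cast le_top)).comp
      (contMDiff_mderiv_eval (J := IM.prod 𝓘(ℝ, F)) η)⟩
  map_add' η η' := by
    obtain ⟨c⟩ := exists_chartAt_total G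
    apply Subtype.ext
    funext p
    refine (congrArg (PE (G p))
      (BanachAtlas.mderiv_add (smoothInto_eval_total p) c η η')).trans ?_
    exact (PE (G p)).map_add _ _
  map_smul' r η := by
    obtain ⟨c⟩ := exists_chartAt_total G
    apply Subtype.ext
    funext p
    refine (congrArg (PE (G p))
      (BanachAtlas.mderiv_smul (smoothInto_eval_total p) c r η)).trans ?_
    exact (PE (G p)).map_smul _ _

variable (hPE : IsBundleConnection IM F PE)

/-- After left-composition with `h`, this is left-composition of the tangent vector, seen as a map
into `TE`, with the smooth function `h ∘ PE`. -/
theorem smoothAt_ckConnection (η : (𝓛).total.TangentTotal) :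
    (𝓛).total.tangent.SmoothAt (𝓛).total
      (fun η => (𝓛).pt (ckConnection I D k hPE η.1 η.2)) η := by
  obtain ⟨c, hc, hG⟩ := exists_isCkChart (I := I) (J := IM.prod 𝓘(ℝ, F)) η.1
  refine smoothAt_ckAtlas_of_leftComp (c := (𝓛).total.tangentChart c hc) ⟨c, hc, rfl⟩ hG
    fun m h => ?_
  exact contDiffAt_comp_mderiv_eval (h.contMDiff.comp hPE.smooth) hc
    (Θ := fun η => leftComp I (IM.prod 𝓘(ℝ, F)) h ((𝓛).pt (ckConnection I D k hPE η.1 η.2)))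
    (fun _ _ => rfl) (c.toEquiv.map_source hG)

/-- The covariant derivative of the section `y ↦ s y e` in the direction `v`. -/
def ckCovariantDeriv (t : (𝓛).LocalTriv) (f : CkMap I IM D M k) (v : (𝓛).base.TangentSp f)
    (e : t.E₀) : (𝓛).Fib f :=
  ckConnection I D k hPE ((𝓛).pt (t.s f e))
    ((𝓛).base.tangentMap (𝓛).total (fun g => (𝓛).pt (t.s g e)) f v)

theorem mdifferentiableAt_s_apply (t : (𝓛).LocalTriv) {c : BanachChart (CkMap I IM D M k)}
    (hc : c ∈ (𝓛).base.charts) {z : c.V} (hz : z ∈ c.toEquiv.target)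
    (hzU : c.toEquiv.symm z ∈ t.U) (e : t.E₀) (p : D) :
    MDifferentiableAt 𝓘(ℝ, c.V) (IM.prod 𝓘(ℝ, F))
      (fun y => (⟨c.toEquiv.symm y p, (t.s (c.toEquiv.symm y) e).1 p⟩ : TotalSpace F E)) z := by
  obtain ⟨C⟩ := exists_chartAt_total ((𝓛).pt (t.s (c.toEquiv.symm z) e))
  obtain ⟨h1, h2⟩ := t.contDiffAt_s_left hc C.2.1 hz hzU C.2.2
  exact BanachAtlas.mdifferentiableAt_comp (smoothInto_eval_total p)
    (S := fun y => (𝓛).pt (t.s (c.toEquiv.symm y) e)) C h1 (h2.differentiableAt (by simp))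

theorem ckCovariantDeriv_apply (t : (𝓛).LocalTriv) {c : BanachChart (CkMap I IM D M k)}
    (hc : c ∈ (𝓛).base.charts) {z : c.V} (hz : z ∈ c.toEquiv.target)
    (hzU : c.toEquiv.symm z ∈ t.U) (v : (𝓛).base.TangentSp (c.toEquiv.symm z)) (e : t.E₀) (p : D) :
    (ckCovariantDeriv hPE t (c.toEquiv.symm z) v e).1 p =
      PE ⟨c.toEquiv.symm z p, (t.s (c.toEquiv.symm z) e).1 p⟩
        (mfderiv 𝓘(ℝ, c.V) (IM.prod 𝓘(ℝ, F))
          (fun y => (⟨c.toEquiv.symm y p, (t.s (c.toEquiv.symm y) e).1 p⟩ : TotalSpace F E)) z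
          ((𝓛).base.coord c ⟨c.toEquiv.symm z, v⟩)) := by
  obtain ⟨C⟩ := exists_chartAt_total ((𝓛).pt (t.s (c.toEquiv.symm z) e))
  obtain ⟨h1, h2⟩ := t.contDiffAt_s_left hc C.2.1 hz hzU C.2.2
  have h3 := BanachAtlas.mderiv_mkTangent_fderiv (smoothInto_eval_total p)
    (S := fun y => (𝓛).pt (t.s (c.toEquiv.symm y) e)) C h1 (h2.differentiableAt (by simp))
    ((𝓛).base.coord c ⟨c.toEquiv.symm z, v⟩)
  rw [← t.tangentMap_s hc hz hzU C v] at h3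
  exact congrArg (PE ((𝓛).pt (t.s (c.toEquiv.symm z) e) p)) h3

theorem isLinearMap_ckCovariantDeriv_left (t : (𝓛).LocalTriv) {f : CkMap I IM D M k}
    (hf : f ∈ t.U) (e : t.E₀) : IsLinearMap ℝ (fun v => ckCovariantDeriv hPE t f v e) := by
  obtain ⟨c, hc, hfc⟩ := exists_isCkChart (I := I) (J := IM) f
  obtain ⟨z, hz, rfl⟩ : ∃ z ∈ c.toEquiv.target, c.toEquiv.symm z = f :=
    ⟨_, c.toEquiv.map_source hfc, c.toEquiv.left_inv hfc⟩
  have hc' : c ∈ (𝓛).base.charts := hc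
  constructor
  · intro v v'
    apply Subtype.ext
    funext p
    change _ = (ckCovariantDeriv hPE t _ v e).1 p + (ckCovariantDeriv hPE t _ v' e).1 p
    have h1 : (𝓛).base.coord c ⟨c.toEquiv.symm z, v + v'⟩ =
        (𝓛).base.coord c ⟨c.toEquiv.symm z, v⟩ + (𝓛).base.coord c ⟨c.toEquiv.symm z, v'⟩ := by
      rw [BanachAtlas.coord_of_mem hc' hfc, BanachAtlas.coord_of_mem hc' hfc,
        BanachAtlas.coord_of_mem hc' hfc]
      rfl
    rw [ckCovariantDeriv_apply hPE t hc' hz hf, ckCovariantDeriv_apply hPE t hc' hz hf,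
      ckCovariantDeriv_apply hPE t hc' hz hf, h1]
    exact (congrArg (PE _) (ContinuousLinearMap.map_add _ _ _)).trans (LinearMap.map_add _ _ _)
  · intro r v
    apply Subtype.ext
    funext p
    change _ = r • (ckCovariantDeriv hPE t _ v e).1 p
    have h1 : (𝓛).base.coord c ⟨c.toEquiv.symm z, r • v⟩ =
        r • (𝓛).base.coord c ⟨c.toEquiv.symm z, v⟩ := by
      rw [BanachAtlas.coord_of_mem hc' hfc, BanachAtlas.coord_of_mem hc' hfc]
      rfl
    rw [ckCovariantDeriv_apply hPE t hc' hz hf, ckCovariantDeriv_apply hPE t hc' hz hf, h1]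
    exact (congrArg (PE _) (ContinuousLinearMap.map_smul _ _ _)).trans (LinearMap.map_smul _ _ _)

/-- At each `p` this is the covariant derivative for `PE` of the family `t.s · e`, evaluated at `p`,
which depends linearly on `e`. No topology on the fibres of the infinite-dimensional bundle is
involved. -/
theorem isLinearMap_ckCovariantDeriv_right (t : (𝓛).LocalTriv) {f : CkMap I IM D M k}
    (hf : f ∈ t.U) (v : (𝓛).base.TangentSp f) :
    IsLinearMap ℝ (fun e => ckCovariantDeriv hPE t f v e) := by
  obtain ⟨c, hc, hfc⟩ := exists_isCkChart (I := I) (J := IM) f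
  obtain ⟨z, hz, rfl⟩ : ∃ z ∈ c.toEquiv.target, c.toEquiv.symm z = f :=
    ⟨_, c.toEquiv.map_source hfc, c.toEquiv.left_inv hfc⟩
  have hc' : c ∈ (𝓛).base.charts := hc
  have h1 : ∀ p, IsLinearMap ℝ (fun e => (ckCovariantDeriv hPE t (c.toEquiv.symm z) v e).1 p) := by
    intro p
    have h2 := hPE.isLinearMap_mfderiv (G := t.E₀) (b := fun y => c.toEquiv.symm y p)
      (fun y => LinearMap.proj p ∘ₗ (ckFiber I IM F E (c.toEquiv.symm y)).subtype ∘ₗ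
        t.s (c.toEquiv.symm y)) (fun e => mdifferentiableAt_s_apply t hc' hz hf e p)
      ((𝓛).base.coord c ⟨c.toEquiv.symm z, v⟩)
    have h3 : (fun e => (ckCovariantDeriv hPE t (c.toEquiv.symm z) v e).1 p) = _ :=
      funext fun e => ckCovariantDeriv_apply hPE t hc' hz hf v e p
    rw [h3]
    exact h2
  exact ⟨fun e e' => Subtype.ext (funext fun p => (h1 p).map_add e e'),
    fun r e => Subtype.ext (funext fun p => (h1 p).map_smul r e)⟩

end CkConnection

/-! ### Coordinates of tangent vectors in a chart -/

namespace BanachAtlas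

variable {X : Type u} {A : BanachAtlas.{u, w} X}

theorem coord_ofCoord {c : BanachChart.{u, w} X} (hc : c ∈ A.charts) {z : c.V}
    (hz : z ∈ c.toEquiv.target) (v : c.V) : A.coord c (A.ofCoord c (z, v)) = v :=
  congrArg Prod.snd ((A.tangentChart c hc).toEquiv.right_inv (x := (z, v)) ⟨hz, mem_univ _⟩)

theorem ofCoord_coord {c : BanachChart.{u, w} X} (hc : c ∈ A.charts) {z : c.V}
    (hz : z ∈ c.toEquiv.target) (η : A.TangentSp (c.toEquiv.symm z)) :
    (A.ofCoord c (z, A.coord c ⟨c.toEquiv.symm z, η⟩)).2 = η := by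
  rw [coord_of_mem hc (c.toEquiv.map_target hz)]
  refine (dif_pos ⟨hc, c.toEquiv.map_target hz⟩).trans ?_
  exact A.mkTangent_coord ⟨c, hc, c.toEquiv.map_target hz⟩ η

theorem isLinearMap_ofCoord_snd {c : BanachChart.{u, w} X} (hc : c ∈ A.charts) {z : c.V}
    (hz : z ∈ c.toEquiv.target) :
    IsLinearMap ℝ (M := c.V) (M₂ := A.TangentSp (c.toEquiv.symm z))
      (fun v => (A.ofCoord c (z, v)).2) := by
  have h : ∀ v, (A.ofCoord c (z, v)).2 = A.mkTangent ⟨c, hc, c.toEquiv.map_target hz⟩ v :=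
    fun v => dif_pos ⟨hc, c.toEquiv.map_target hz⟩
  constructor
  · intro v v'
    rw [h, h, h]
    exact mkTangent_add (⟨c, hc, c.toEquiv.map_target hz⟩ : A.ChartAt (c.toEquiv.symm z)) v v'
  · intro r v
    rw [h, h]
    exact mkTangent_smul (⟨c, hc, c.toEquiv.map_target hz⟩ : A.ChartAt (c.toEquiv.symm z)) r v

end BanachAtlas

/-! ### Tangent vectors of the total space in a local trivialization -/

namespace LinearFibration.LocalTriv

section TangentVectors

variable {X : Type u} {Y : Type u'} {L : LinearFibration.{u, u', uf, w} X Y} (t : L.LocalTriv)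

/-- The differentials of the sections `y ↦ s y e` depend smoothly on `e`. -/
theorem contDiffAt_comp_tangentMap_s {c : BanachChart.{u, w} X} (hc : c ∈ L.base.charts) {z : c.V}
    (hz : z ∈ c.toEquiv.target) (hzU : c.toEquiv.symm z ∈ t.U) (v : c.V) (e : t.E₀)
    {C : BanachChart.{u', w} Y} (hC : C ∈ L.total.charts)
    (hCs : L.pt (t.s (c.toEquiv.symm z) e) ∈ C.toEquiv.source)
    {W : Type w} [NormedAddCommGroup W] [NormedSpace ℝ W] [CompleteSpace W]
    {Θ : L.total.TangentTotal → W}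
    (hΘ : ∀ η, η.1 = L.pt (t.s (c.toEquiv.symm z) e) →
      L.total.tangent.SmoothAt (BanachAtlas.ofSpace W) Θ η) :
    ContDiffAt ℝ ∞ (fun q : c.V × c.V × t.E₀ => Θ ⟨L.pt (t.s (c.toEquiv.symm q.1) q.2.2),
      L.base.tangentMap L.total (fun g => L.pt (t.s g q.2.2)) (c.toEquiv.symm q.1)
        (L.base.ofCoord c (q.1, q.2.1)).2⟩) (z, v, e) := by
  obtain ⟨hσev, hσ⟩ := t.contDiffAt_s hc hC hz hzU hCs
  set σ : c.V × t.E₀ → C.V := fun q => C.toEquiv (L.pt (t.s (c.toEquiv.symm q.1) q.2))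
  let η : c.V × c.V × t.E₀ → L.total.TangentTotal := fun q =>
    ⟨L.pt (t.s (c.toEquiv.symm q.1) q.2.2),
      L.base.tangentMap L.total (fun g => L.pt (t.s g q.2.2)) (c.toEquiv.symm q.1)
        (L.base.ofCoord c (q.1, q.2.1)).2⟩
  -- The coordinates of the tangent vector in the chart induced by `C`: the section in charts and
  -- its partial derivative in the base direction. Both are smooth in all the variables.
  let κ : c.V × c.V × t.E₀ → C.V × C.V := fun q =>
    (σ (q.1, q.2.2), fderiv ℝ (fun y => σ (y, q.2.2)) q.1 q.2.1)
  have hκ : ContDiffAt ℝ ∞ κ (z, v, e) := by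
    have h1 : ContDiffAt ℝ ∞ (fun q : c.V × c.V × t.E₀ => σ (q.1, q.2.2)) (z, v, e) :=
      ContDiffAt.comp (g := σ) (f := fun q : c.V × c.V × t.E₀ => (q.1, q.2.2)) (z, v, e) hσ
        (contDiffAt_fst.prodMk contDiffAt_snd.snd)
    have h2 : ContDiffAt ℝ ∞ (Function.uncurry fun (q : c.V × c.V × t.E₀) (y : c.V) =>
        σ (y, q.2.2)) ((z, v, e), z) :=
      ContDiffAt.comp (g := σ) (f := fun q : (c.V × c.V × t.E₀) × c.V => (q.2, q.1.2.2))
        ((z, v, e), z) hσ (contDiffAt_snd.prodMk contDiffAt_fst.snd.snd)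
    have h3 := ContDiffAt.fderiv (g := fun q : c.V × c.V × t.E₀ => q.1) (m := ∞) h2
      contDiffAt_fst (by simp)
    exact h1.prodMk (h3.clm_apply contDiffAt_snd.fst)
  have hηκ : ∀ q : c.V × c.V × t.E₀, q.1 ∈ c.toEquiv.target → c.toEquiv.symm q.1 ∈ t.U →
      L.pt (t.s (c.toEquiv.symm q.1) q.2.2) ∈ C.toEquiv.source →
      (L.total.tangentChart C hC).toEquiv (η q) = κ q := by
    intro q hq hqU hqC
    refine Prod.ext rfl ?_
    change L.total.coord C (η q) = _
    rw [BanachAtlas.coord_of_mem hC hqC]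
    refine (congrArg (fun ξ => ξ.1 ⟨C, hC, hqC⟩) (t.tangentMap_s hc hq hqU ⟨C, hC, hqC⟩
      (L.base.ofCoord c (q.1, q.2.1)).2)).trans ?_
    refine (BanachAtlas.mkTangent_self _ _ _).trans ?_
    exact congrArg _ (BanachAtlas.coord_ofCoord hc hq q.2.1)
  have h1 := ((hΘ (η (z, v, e)) rfl).contDiffAt (c := L.total.tangentChart C hC) ⟨C, hC, rfl⟩
    (BanachAtlas.mem_charts_ofSpace W) hCs (mem_univ _)).2
  rw [hηκ (z, v, e) hz hzU hCs] at h1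
  refine (ContDiffAt.comp (z, v, e) h1 hκ).congr_of_eventuallyEq ?_
  have h2 : ∀ᶠ q : c.V × c.V × t.E₀ in 𝓝 (z, v, e),
      q.1 ∈ c.toEquiv.target ∩ c.toEquiv.symm ⁻¹' t.U :=
    continuousAt_fst.eventually ((t.open_U c hc).mem_nhds ⟨hz, hzU⟩)
  have h3 : Tendsto (fun q : c.V × c.V × t.E₀ => (q.1, q.2.2)) (𝓝 (z, v, e)) (𝓝 (z, e)) :=
    (by fun_prop : Continuous fun q : c.V × c.V × t.E₀ => (q.1, q.2.2)).tendsto (z, v, e)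
  filter_upwards [h2, h3.eventually hσev] with q hq hqC
  have h4 := (L.total.tangentChart C hC).toEquiv.left_inv (x := η q) hqC
  rw [hηκ q hq.1 hq.2 hqC] at h4
  simp only [Function.comp]
  rw [h4]
  rfl

theorem inv_vec_pt {x : X} (hx : x ∈ t.U) (e : t.E₀) :
    t.inv (L.proj (L.pt (t.s x e))) (L.vec (L.pt (t.s x e))) = e := by
  have h : ∀ q : Σ x, L.Fib x, q = ⟨x, t.s x e⟩ → t.inv q.1 q.2 = e := by
    rintro _ rfl
    exact t.inv_s x hx e
  exact h _ (L.equiv.apply_symm_apply _)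

theorem pt_s_inv {y : Y} (hy : L.proj y ∈ t.U) :
    L.pt (t.s (L.proj y) (t.inv (L.proj y) (L.vec y))) = y := by
  rw [t.s_inv _ hy]
  exact L.equiv.symm_apply_apply y

theorem contDiffAt_inv {y : Y} (hy : L.proj y ∈ t.U) (C : L.total.ChartAt y) :
    ContDiffAt ℝ ∞ (fun w => t.inv (L.proj (C.1.toEquiv.symm w)) (L.vec (C.1.toEquiv.symm w)))
      (C.1.toEquiv y) :=
  ((t.smooth_inv y hy).contDiffAt C.2.1 (BanachAtlas.mem_charts_ofSpace t.E₀) C.2.2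
    (mem_univ _)).2

theorem mderiv_inv {y : Y} (hy : L.proj y ∈ t.U) (C : L.total.ChartAt y)
    (η : L.total.TangentSp y) :
    L.total.mderiv 𝓘(ℝ, t.E₀) (fun y => t.inv (L.proj y) (L.vec y)) y η =
      fderiv ℝ (fun w => t.inv (L.proj (C.1.toEquiv.symm w)) (L.vec (C.1.toEquiv.symm w)))
        (C.1.toEquiv y) (η.1 C) := by
  rw [BanachAtlas.mderiv_apply_of_mdifferentiableAt C
    ((t.contDiffAt_inv hy C).differentiableAt (by simp)).mdifferentiableAt, mfderiv_eq_fderiv]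
  rfl

/-- A tangent vector of the total space is the sum of a vertical vector and of the image of its
projection under the differential of a section `y ↦ s y e`. -/
theorem eq_mkTangent_add {c : BanachChart.{u, w} X} (hc : c ∈ L.base.charts) {z : c.V}
    (hz : z ∈ c.toEquiv.target) (hzU : c.toEquiv.symm z ∈ t.U) {e : t.E₀} {y : Y}
    (hy : y = L.pt (t.s (c.toEquiv.symm z) e)) (hyz : L.proj y = c.toEquiv.symm z)
    (hproj : L.total.SmoothAt L.base L.proj y) (C : L.total.ChartAt y)
    (η : L.total.TangentSp y) :
    η = L.total.mkTangent C (fderiv ℝ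
        (fun w => C.1.toEquiv (L.pt (t.s (c.toEquiv.symm z) w))) e
          (fderiv ℝ (fun w => t.inv (L.proj (C.1.toEquiv.symm w)) (L.vec (C.1.toEquiv.symm w)))
            (C.1.toEquiv y) (η.1 C))) +
      L.total.mkTangent C (fderiv ℝ
        (fun w => C.1.toEquiv (L.pt (t.s (c.toEquiv.symm w) e))) z
          (fderiv ℝ (fun w => c.toEquiv (L.proj (C.1.toEquiv.symm w)))
            (C.1.toEquiv y) (η.1 C))) := by
  have hyU : L.proj y ∈ t.U := by rwa [hyz]
  have hyc : L.proj y ∈ c.toEquiv.source := by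
    rw [hyz]
    exact c.toEquiv.map_target hz
  have hyC : C.1.toEquiv.symm (C.1.toEquiv y) = y := C.1.toEquiv.left_inv C.2.2
  have hσ := (t.contDiffAt_s hc C.2.1 hz hzU (e := e) (by
    rw [← hy]
    exact C.2.2)).2
  set σ : c.V × t.E₀ → C.1.V := fun q => C.1.toEquiv (L.pt (t.s (c.toEquiv.symm q.1) q.2))
  obtain ⟨hpev, hp⟩ := hproj.contDiffAt C.2.1 hc C.2.2 hyc
  have hi := t.contDiffAt_inv hyU C
  set n := η.1 C
  set v := fderiv ℝ (fun w => c.toEquiv (L.proj (C.1.toEquiv.symm w))) (C.1.toEquiv y) n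
  set w := fderiv ℝ (fun w => t.inv (L.proj (C.1.toEquiv.symm w)) (L.vec (C.1.toEquiv.symm w)))
    (C.1.toEquiv y) n
  have hσ' := (hσ.differentiableAt (by simp)).hasFDerivAt
  have hσ1 : fderiv ℝ (fun w => σ (w, e)) z v = fderiv ℝ σ (z, e) (v, 0) :=
    DFunLike.congr_fun (HasFDerivAt.comp (f := fun w : c.V => (w, e)) z hσ'
      (hasFDerivAt_prodMk_left z e)).fderiv v
  have hσ2 : fderiv ℝ (fun w => σ (z, w)) e w = fderiv ℝ σ (z, e) (0, w) :=
    DFunLike.congr_fun (HasFDerivAt.comp (f := fun w : t.E₀ => (z, w)) e hσ'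
      (hasFDerivAt_prodMk_right z e)).fderiv w
  -- Differentiate the identity that expresses a point near `y` through its projection and its fibre
  -- coordinate; `v` and `w` are the corresponding components of the derivative.
  have hdecomp : n = fderiv ℝ σ (z, e) (v, w) := by
    have h1 := (hp.differentiableAt (by simp)).hasFDerivAt.prodMk
      (hi.differentiableAt (by simp)).hasFDerivAt
    have h2 : (c.toEquiv (L.proj (C.1.toEquiv.symm (C.1.toEquiv y))),
        t.inv (L.proj (C.1.toEquiv.symm (C.1.toEquiv y)))
          (L.vec (C.1.toEquiv.symm (C.1.toEquiv y)))) = (z, e) := by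
      rw [hyC]
      refine Prod.ext ((congrArg c.toEquiv hyz).trans (c.toEquiv.right_inv hz)) ?_
      change t.inv (L.proj y) (L.vec y) = e
      rw [hy]
      exact t.inv_vec_pt hzU e
    have h3 := HasFDerivAt.comp (C.1.toEquiv y) (h2.symm ▸ hσ') h1
    have h4 : (σ ∘ fun w => (c.toEquiv (L.proj (C.1.toEquiv.symm w)),
        t.inv (L.proj (C.1.toEquiv.symm w)) (L.vec (C.1.toEquiv.symm w)))) =ᶠ[𝓝
          (C.1.toEquiv y)] id := by
      have hU : ∀ᶠ w in 𝓝 (C.1.toEquiv y), c.toEquiv (L.proj (C.1.toEquiv.symm w)) ∈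
          c.toEquiv.target ∩ c.toEquiv.symm ⁻¹' t.U := by
        refine hp.continuousAt.eventually ((t.open_U c hc).mem_nhds ?_)
        simp only [hyC]
        refine ⟨c.toEquiv.map_source hyc, ?_⟩
        change c.toEquiv.symm (c.toEquiv (L.proj y)) ∈ t.U
        rwa [c.toEquiv.left_inv hyc]
      filter_upwards [hpev, hU, C.1.open_target.mem_nhds (C.1.toEquiv.map_source C.2.2)]
        with w hw1 hw2 hw3
      simp only [Function.comp, σ]
      have h5 : L.proj (C.1.toEquiv.symm w) ∈ t.U := by
        have := hw2.2
        rwa [mem_preimage, c.toEquiv.left_inv hw1] at this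
      rw [c.toEquiv.left_inv hw1, t.pt_s_inv h5]
      exact C.1.toEquiv.right_inv hw3
    have h5 := h3.unique ((hasFDerivAt_id _).congr_of_eventuallyEq h4)
    have h6 := DFunLike.congr_fun h5 n
    rw [ContinuousLinearMap.comp_apply, h2] at h6
    exact h6.symm
  refine BanachAtlas.tangentSp_ext C ?_
  change n = (L.total.mkTangent C (fderiv ℝ (fun w => σ (z, w)) e w)).1 C +
    (L.total.mkTangent C (fderiv ℝ (fun w => σ (w, e)) z v)).1 C
  rw [BanachAtlas.mkTangent_self, BanachAtlas.mkTangent_self, hσ1, hσ2, hdecomp, ← map_add,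
    Prod.mk_add_mk, zero_add, add_zero]

end TangentVectors

end LinearFibration.LocalTriv

/-! ### The Christoffel symbols of the natural connection -/

section CkChristoffel

universe uD uM

variable {ED : Type*} [NormedAddCommGroup ED] [NormedSpace ℝ ED] [FiniteDimensional ℝ ED]
  {HD : Type*} [TopologicalSpace HD] {I : ModelWithCorners ℝ ED HD}
  {D : Type uD} [TopologicalSpace D] [ChartedSpace HD D] [CompactSpace D]
  [IsManifold I ∞ D] {k : ℕ}
  {EM : Type*} [NormedAddCommGroup EM] [NormedSpace ℝ EM] [FiniteDimensional ℝ EM]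
  {HM : Type*} [TopologicalSpace HM]
  {IM : ModelWithCorners ℝ EM HM} [IM.Boundaryless]
  {M : Type uM} [TopologicalSpace M] [ChartedSpace HM M] [IsManifold IM ∞ M] [T2Space M]
  {F : Type*} [NormedAddCommGroup F] [NormedSpace ℝ F] [FiniteDimensional ℝ F]
  {E : M → Type*} [∀ x, AddCommGroup (E x)] [∀ x, Module ℝ (E x)]
  [∀ x, TopologicalSpace (E x)] [∀ x, IsTopologicalAddGroup (E x)]
  [∀ x, ContinuousSMul ℝ (E x)]
  [TopologicalSpace (TotalSpace F E)] [FiberBundle F E] [VectorBundle ℝ F E]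
  [ContMDiffVectorBundle ∞ F E IM]
  {PE : ∀ e : TotalSpace F E, TangentSpace (IM.prod 𝓘(ℝ, F)) e →ₗ[ℝ] E e.proj}
  (hPE : IsBundleConnection IM F PE)

local notation "𝓛" => ckBundle I D k IM F E

/-- The connection and the fibre coordinate are smooth maps, and the tangent vector of the section
`g ↦ s g e` depends smoothly on the point, the direction and `e`. -/
theorem contDiffAt_ckCovariantDeriv (t : (𝓛).LocalTriv) {c : BanachChart (CkMap I IM D M k)}
    (hc : c ∈ (𝓛).base.charts) {z : c.V} (hz : z ∈ c.toEquiv.target)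
    (hzU : c.toEquiv.symm z ∈ t.U) (v : c.V) (e : t.E₀) :
    ContDiffAt ℝ ∞ (fun q : c.V × c.V × t.E₀ => t.inv (c.toEquiv.symm q.1)
      (ckCovariantDeriv hPE t (c.toEquiv.symm q.1) ((𝓛).base.ofCoord c (q.1, q.2.1)).2 q.2.2))
      (z, v, e) := by
  obtain ⟨C, hC, hCs⟩ := exists_chartAt_total ((𝓛).pt (t.s (c.toEquiv.symm z) e))
  refine t.contDiffAt_comp_tangentMap_s hc hz hzU v e hC hCs
    (Θ := fun η => t.inv ((𝓛).proj ((𝓛).pt (ckConnection I D k hPE η.1 η.2)))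
      ((𝓛).vec ((𝓛).pt (ckConnection I D k hPE η.1 η.2)))) fun η hη => ?_
  refine BanachAtlas.SmoothAt.comp
    (f := fun η : (𝓛).total.TangentTotal => (𝓛).pt (ckConnection I D k hPE η.1 η.2))
    (g := fun y => t.inv ((𝓛).proj y) ((𝓛).vec y)) (t.smooth_inv _ ?_)
    (smoothAt_ckConnection hPE η)
  change (𝓛).proj η.1 ∈ t.U
  rw [hη]
  exact hzU

/-- Evaluated at `p`, the curve stays in one fibre of `E`, where `PE` is the identity on velocities.
-/
theorem ckConnection_vertical (t : (𝓛).LocalTriv) {c : BanachChart (CkMap I IM D M k)}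
    (hc : c ∈ (𝓛).base.charts) {z : c.V} (hz : z ∈ c.toEquiv.target)
    (hzU : c.toEquiv.symm z ∈ t.U) (e w : t.E₀)
    (C : (𝓛).total.ChartAt ((𝓛).pt (t.s (c.toEquiv.symm z) e))) :
    ckConnection I D k hPE ((𝓛).pt (t.s (c.toEquiv.symm z) e))
      ((𝓛).total.mkTangent C
        (fderiv ℝ (fun w => C.1.toEquiv ((𝓛).pt (t.s (c.toEquiv.symm z) w))) e w)) =
      t.s (c.toEquiv.symm z) w := by
  obtain ⟨h1, h2⟩ := t.contDiffAt_s_right hc C.2.1 hz hzU C.2.2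
  apply Subtype.ext
  funext p
  have h3 := BanachAtlas.mderiv_mkTangent_fderiv (smoothInto_eval_total p)
    (S := fun u => (𝓛).pt (t.s (c.toEquiv.symm z) u)) C h1 (h2.differentiableAt (by simp)) w
  refine (congrArg (PE ((𝓛).pt (t.s (c.toEquiv.symm z) e) p)) h3).trans ?_
  exact hPE.mfderiv_vertical (Z := t.E₀)
    (LinearMap.proj p ∘ₗ (ckFiber I IM F E (c.toEquiv.symm z)).subtype ∘ₗ t.s (c.toEquiv.symm z))
    (BanachAtlas.mdifferentiableAt_comp (smoothInto_eval_total p)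
      (S := fun u => (𝓛).pt (t.s (c.toEquiv.symm z) u)) C h1 (h2.differentiableAt (by simp))) w

theorem ckConnection_horizontal (t : (𝓛).LocalTriv) {c : BanachChart (CkMap I IM D M k)}
    (hc : c ∈ (𝓛).base.charts) {z : c.V} (hz : z ∈ c.toEquiv.target)
    (hzU : c.toEquiv.symm z ∈ t.U) (e : t.E₀) (v : (𝓛).base.TangentSp (c.toEquiv.symm z))
    (C : (𝓛).total.ChartAt ((𝓛).pt (t.s (c.toEquiv.symm z) e))) :
    ckConnection I D k hPE ((𝓛).pt (t.s (c.toEquiv.symm z) e))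
      ((𝓛).total.mkTangent C
        (fderiv ℝ (fun w => C.1.toEquiv ((𝓛).pt (t.s (c.toEquiv.symm w) e))) z
          ((𝓛).base.coord c ⟨c.toEquiv.symm z, v⟩))) =
      ckCovariantDeriv hPE t (c.toEquiv.symm z) v e := by
  rw [← t.tangentMap_s hc hz hzU C v]
  rfl

theorem smoothAt_ckProj (G : CkMap I (IM.prod 𝓘(ℝ, F)) D (TotalSpace F E) k) :
    (𝓛).total.SmoothAt (𝓛).base (𝓛).proj G := by
  obtain ⟨C⟩ := exists_chartAt_total G
  exact smoothAt_ckAtlas_of_leftComp C.2.1 C.2.2 fun m h =>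
    contDiffAt_leftComp_ckProj C.2.1 C.2.2 h

/-- Split `η` into its vertical part and the differential of the section `g ↦ s g e` applied to its
projection; the connection is linear and its values on the two parts are known. -/
theorem ckConnection_eq (t : (𝓛).LocalTriv) {f : CkMap I IM D M k} (hf : f ∈ t.U) (e : t.E₀)
    (η : (𝓛).total.TangentSp ((𝓛).pt (t.s f e))) :
    ckConnection I D k hPE ((𝓛).pt (t.s f e)) η =
      t.s f ((𝓛).total.mderiv 𝓘(ℝ, t.E₀) (fun y => t.inv ((𝓛).proj y) ((𝓛).vec y))
        ((𝓛).pt (t.s f e)) η) +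
      ckCovariantDeriv hPE t f
        ((𝓛).total.tangentMap (𝓛).base (𝓛).proj ((𝓛).pt (t.s f e)) η) e := by
  obtain ⟨c, hc, hfc⟩ := exists_isCkChart (I := I) (J := IM) f
  obtain ⟨z, hz, rfl⟩ : ∃ z ∈ c.toEquiv.target, c.toEquiv.symm z = f :=
    ⟨_, c.toEquiv.map_source hfc, c.toEquiv.left_inv hfc⟩
  have hc' : c ∈ (𝓛).base.charts := hc
  obtain ⟨C⟩ := exists_chartAt_total ((𝓛).pt (t.s (c.toEquiv.symm z) e))
  have hproj := smoothAt_ckProj ((𝓛).pt (t.s (c.toEquiv.symm z) e))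
  have h1 := t.eq_mkTangent_add hc' hz hf rfl rfl hproj C η
  have h2 := t.mderiv_inv (y := (𝓛).pt (t.s (c.toEquiv.symm z) e)) hf C η
  have h3 := BanachAtlas.tangentMap_apply hproj C ⟨c, hc', hfc⟩ η
  have h4 : (𝓛).base.coord c ⟨c.toEquiv.symm z, (𝓛).total.tangentMap (𝓛).base (𝓛).proj
      ((𝓛).pt (t.s (c.toEquiv.symm z) e)) η⟩ = _ :=
    (BanachAtlas.coord_of_mem hc' hfc _).trans h3
  have h5 := ckConnection_vertical hPE t hc' hz hf e (fderiv ℝ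
    (fun w => t.inv ((𝓛).proj (C.1.toEquiv.symm w)) ((𝓛).vec (C.1.toEquiv.symm w)))
      (C.1.toEquiv ((𝓛).pt (t.s (c.toEquiv.symm z) e))) (η.1 C)) C
  have h6 := ckConnection_horizontal hPE t hc' hz hf e ((𝓛).total.tangentMap (𝓛).base (𝓛).proj
      ((𝓛).pt (t.s (c.toEquiv.symm z) e)) η) C
  rw [h4] at h6
  refine (congrArg _ h1).trans ((map_add _ _ _).trans ?_)
  exact congrArg₂ (· + ·) (h5.trans (congrArg (t.s (c.toEquiv.symm z)) h2.symm)) h6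

theorem isConnection_ckConnection : (𝓛).IsConnection (ckConnection I D k hPE) where
  smooth := smoothAt_ckConnection hPE
  christoffel t := by
    classical
    -- The covariant derivative of the section with constant coordinate `t.inv f e`. Off `t.U` the
    -- maps `s` and `inv` have no meaning, and the symbol is set to zero to keep it bilinear.
    let Γ : ∀ f, (𝓛).base.TangentSp f →ₗ[ℝ] (𝓛).Fib f →ₗ[ℝ] (𝓛).Fib f := fun f =>
      if hf : f ∈ t.U then
        LinearMap.mk₂ ℝ (fun v e => ckCovariantDeriv hPE t f v (t.inv f e))
          (fun v v' e => (isLinearMap_ckCovariantDeriv_left hPE t hf _).map_add v v')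
          (fun r v e => (isLinearMap_ckCovariantDeriv_left hPE t hf _).map_smul r v)
          (fun v e e' => by
            rw [map_add]
            exact (isLinearMap_ckCovariantDeriv_right hPE t hf v).map_add _ _)
          (fun r v e => by
            rw [map_smul]
            exact (isLinearMap_ckCovariantDeriv_right hPE t hf v).map_smul _ _)
      else 0
    have hΓ : ∀ f ∈ t.U, ∀ v e, Γ f v e = ckCovariantDeriv hPE t f v (t.inv f e) := by
      intro f hf v e
      simp only [Γ, dif_pos hf]
      rfl
    refine ⟨Γ, fun c hc => ?_, fun y hy η => ?_⟩
    · obtain ⟨γ, hγ, hγΨ⟩ := exists_contDiffOn_bilinear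
        (O := c.toEquiv.target ∩ c.toEquiv.symm ⁻¹' t.U)
        (Ψ := fun z v e => t.inv (c.toEquiv.symm z) (ckCovariantDeriv hPE t (c.toEquiv.symm z)
          ((𝓛).base.ofCoord c (z, v)).2 e))
        (fun z hz => contDiffAt_ckCovariantDeriv hPE t hc hz.1 hz.2 0 0)
        (fun z hz e => by
          have h1 := BanachAtlas.isLinearMap_ofCoord_snd hc hz.1
          have h2 := isLinearMap_ckCovariantDeriv_left hPE t hz.2 e
          exact ((t.inv (c.toEquiv.symm z)) ∘ₗ h2.mk' _ ∘ₗ h1.mk' _).isLinear)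
        (fun z hz v => by
          have h2 := isLinearMap_ckCovariantDeriv_right hPE t hz.2
            ((𝓛).base.ofCoord c (z, v)).2
          exact ((t.inv (c.toEquiv.symm z)) ∘ₗ h2.mk' _).isLinear)
      refine ⟨γ, hγ, fun f hfc hf v e => ?_⟩
      obtain ⟨z, hz, rfl⟩ : ∃ z ∈ c.toEquiv.target, c.toEquiv.symm z = f :=
        ⟨_, c.toEquiv.map_source hfc, c.toEquiv.left_inv hfc⟩
      rw [hΓ _ hf, c.toEquiv.right_inv hz, hγΨ z ⟨hz, hf⟩, BanachAtlas.ofCoord_coord hc hz]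
    · obtain ⟨f, e, hf, rfl⟩ : ∃ f e, f ∈ t.U ∧ (𝓛).pt (t.s f e) = y :=
        ⟨_, _, hy, t.pt_s_inv hy⟩
      refine (ckConnection_eq hPE t hf e η).trans ?_
      have h1 := hΓ f hf
        ((𝓛).total.tangentMap (𝓛).base (𝓛).proj ((𝓛).pt (t.s f e)) η) (t.s f e)
      rw [t.inv_s f hf] at h1
      exact congrArg (_ + ·) h1.symm

/-! ### Affine evaluation maps and uniqueness -/

theorem isAffineBundleMap_eval (p : D) :
    IsAffineBundleMap IM F 𝓛 (ckConnection I D k hPE) PE (fun f => f p) (fun G => G p) where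
  smooth_base := smoothInto_eval p
  smooth_total := smoothInto_eval p
  linear := ⟨fun f => LinearMap.proj p ∘ₗ (ckFiber I IM F E f).subtype, fun _ _ => rfl⟩
  affine _ _ := rfl

/-- Affinity of the evaluation at `p` says that `P η` has the value `PE (d ev_p η)` at `p`; a
section along a map is determined by its values. -/
theorem eq_ckConnection
    {P : ∀ G : CkMap I (IM.prod 𝓘(ℝ, F)) D (TotalSpace F E) k,
      (𝓛).total.TangentSp G →ₗ[ℝ] (𝓛).Fib ((𝓛).proj G)}
    (hP : ∀ p : D, IsAffineBundleMap IM F 𝓛 P PE (fun f => f p) (fun G => G p)) :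
    P = ckConnection I D k hPE := by
  funext G
  refine LinearMap.ext fun η => Subtype.ext (funext fun p => ?_)
  exact (eq_of_heq (TotalSpace.mk.inj ((hP p).affine G η)).2).symm

end CkChristoffel

end Construction

theorem proposition2p4
    -- the compact manifold with boundary `D`
    {ED : Type*} [NormedAddCommGroup ED] [NormedSpace ℝ ED] [FiniteDimensional ℝ ED]
    {HD : Type*} [TopologicalSpace HD] (I : ModelWithCorners ℝ ED HD)
    (D : Type*) [TopologicalSpace D] [ChartedSpace HD D] [IsManifold I ∞ D]
    [CompactSpace D] [T2Space D]
    -- the finite-dimensional manifold `M`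
    {EM : Type*} [NormedAddCommGroup EM] [NormedSpace ℝ EM] [FiniteDimensional ℝ EM]
    {HM : Type*} [TopologicalSpace HM] (IM : ModelWithCorners ℝ EM HM) [IM.Boundaryless]
    {M : Type*} [TopologicalSpace M] [ChartedSpace HM M] [IsManifold IM ∞ M]
    [T2Space M] [SigmaCompactSpace M]
    -- the finite-dimensional vector bundle `E → M`
    (F : Type*) [NormedAddCommGroup F] [NormedSpace ℝ F] [FiniteDimensional ℝ F]
    (E : M → Type*) [∀ x, AddCommGroup (E x)] [∀ x, Module ℝ (E x)]
    [∀ x, TopologicalSpace (E x)] [∀ x, IsTopologicalAddGroup (E x)]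
    [∀ x, ContinuousSMul ℝ (E x)]
    [TopologicalSpace (TotalSpace F E)] [FiberBundle F E] [VectorBundle ℝ F E]
    [ContMDiffVectorBundle ∞ F E IM]
    -- its connection, and the order of differentiability
    (PE : ∀ e : TotalSpace F E, TangentSpace (IM.prod 𝓘(ℝ, F)) e →ₗ[ℝ] E e.proj)
    (hPE : IsBundleConnection IM F PE)
    (k : ℕ) (hk : 2 ≤ k) :
    -- `C^k(D, E) → C^k(D, M)` is a Banach vector bundle
    (ckBundle I D k IM F E).IsBanachVectorBundle ∧
    -- the tangent bundle of `C^k(D, E)` is identified with `C^k(D, TE)`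
    BijOn
      (fun (η : (ckBundle I D k IM F E).total.TangentTotal) (p : D) =>
        (⟨η.1 p, (ckBundle I D k IM F E).total.mderiv (IM.prod 𝓘(ℝ, F)) (fun G => G p) η.1 η.2⟩ :
          TangentBundle (IM.prod 𝓘(ℝ, F)) (TotalSpace F E)))
      univ {ζ | ContMDiff I (IM.prod 𝓘(ℝ, F)).tangent k ζ} ∧
    ∃ P : ∀ G : CkMap I (IM.prod 𝓘(ℝ, F)) D (TotalSpace F E) k,
        (ckBundle I D k IM F E).total.TangentSp G →ₗ[ℝ]
          (ckBundle I D k IM F E).Fib ((ckBundle I D k IM F E).proj G),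
      -- `P` is the left-composition with `PE`
      (∀ G η p, ((ckBundle I D k IM F E).pt (P G η)) p =
        ⟨(G p).proj,
          PE (G p) ((ckBundle I D k IM F E).total.mderiv (IM.prod 𝓘(ℝ, F)) (fun G => G p) G η)⟩) ∧
      -- it is a connection for which the evaluation maps are affine, and the only one
      (ckBundle I D k IM F E).IsConnection P ∧
      (∀ p : D, IsAffineBundleMap IM F (ckBundle I D k IM F E) P PE (fun f => f p)
        (fun G => G p)) ∧
      ∀ P' : ∀ G : CkMap I (IM.prod 𝓘(ℝ, F)) D (TotalSpace F E) k,
        (ckBundle I D k IM F E).total.TangentSp G →ₗ[ℝ]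
          (ckBundle I D k IM F E).Fib ((ckBundle I D k IM F E).proj G),
        (ckBundle I D k IM F E).IsConnection P' →
        (∀ p : D, IsAffineBundleMap IM F (ckBundle I D k IM F E) P' PE (fun f => f p)
          (fun G => G p)) →
        P' = P :=
  ⟨isBanachVectorBundle_ckBundle I D k IM F E, bijOn_mderiv_eval (IM.prod 𝓘(ℝ, F)) _ I D k,
    ckConnection I D k hPE, fun _ _ _ => rfl, isConnection_ckConnection hPE,
    isAffineBundleMap_eval hPE, fun _ _ hP => eq_ckConnection hPE hP⟩
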